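/- Let $\mathbb Z^2_{even}=\{(x,t)\in\mathbb Z^2: x+t \text{ even}\}$. To each $z\in\mathbb Z^2_{even}$ attach an arrow, which at dynamical time $\tau=0$ has a direction $\xi^0_z\in\{-1,+1\}$ chosen by a fair coin, and a rate one Poisson clock; whenever the clock at $z$ rings, the direction of the arrow at $z$ is reset by a new fair coin. All clocks and coins are independent. Let $\xi^\tau_z$ (right continuous in $\tau\ge 0$) be the direction of the arrow at $z$ at dynamical time $\tau$, and let $S^\tau_z$ be the piecewise linear path that starts at $z$ and follows the arrows $(x,t)\to(x+\xi^\tau_{(x,t)},t+1)$; write $S^\tau_0$ for the path that starts at $(0,0)$. For $K>0$ let $$\mathcal T(K)=\{\tau\in[0,\infty): S^\tau_0(t)\ge -K\sqrt t \ \text{ for all } t\ge 0\}.$$ For $\gamma>2$ put $K(\gamma)=(\gamma-2)\sqrt{\frac{\gamma+1}{\gamma-1}}$; this is an increasing bijection from $(2,\infty)$ onto $(0,\infty)$, and $\gamma(K)\in(2,\infty)$ denotes the solution of $K(\gamma)=K$. Given $K>0$ and $\gamma=\gamma(K)$, let $d_k=2(\lfloor \gamma^k/2\rfloor+1)$, $x_k=\sum_{i<k}d_i$,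 $t_k=\sum_{i<k}d_i^2$ and $\bar z_k=(x_k,t_k)$ for $k\ge 0$, and let $$A_k(K)=\{S^0_{\bar z_k}(t)>x_k-d_k \ \text{ for all } t\in[t_k,t_{k+1}], \text{ and } S^0_{\bar z_k}(t_{k+1})>x_{k+1}\}.$$ Let $\gamma_0=\sup_{k\ge 0,\,K>0} 1/\mathbb P(A_k(K))$. Then $2<\gamma_0<\infty$, and for every $K>K(\gamma_0)$, almost surely, $$\dim_H(\mathcal T(K))\ \ge\ 1-\frac{\log\gamma_0}{\log\gamma(K)}.$$ Moreover, almost surely, $\lim_{K\uparrow\infty}\dim_H(\mathcal T(K))=1$. -/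

import Mathlib

open MeasureTheory ProbabilityTheory
open scoped ENNReal Topology

namespace DynWeb

noncomputable section

/-- The space-time lattice `{(x, t) ∈ ℤ² : x + t even}`. -/
abbrev Site : Type := {z : ℤ × ℤ // Even (z.1 + z.2)}

/-- The increment of an arrow: `true` points to the right, `false` to the left. -/
def dir (b : Bool) : ℤ := if b then 1 else -1

/-- The endpoint `(x ± 1, t + 1)` of the arrow that starts at `z = (x, t)` in the arrow
configuration `a`. -/
def step (a : Site → Bool) (z : Site) : Site :=
  ⟨(z.1.1 + dir (a z), z.1.2 + 1), by
    have hz := z.2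
    rcases h : a z <;> simp only [dir] <;> grind⟩

/-- The spatial position, after `n` steps, of the walk that starts at `z` and follows the arrows. -/
def pos (a : Site → Bool) (z : Site) (n : ℕ) : ℤ := ((step a)^[n] z).1.1

/-- The path that starts at `z` and follows the arrows, as a piecewise linear function of the real
time `t ≥ z.1.2`. -/
def path (a : Site → Bool) (z : Site) (t : ℝ) : ℝ :=
  let s : ℝ := t - (z.1.2 : ℝ)
  let n : ℕ := ⌊s⌋₊
  (pos a z n : ℝ) + (s - n) * ((pos a z (n + 1) : ℝ) - (pos a z n : ℝ))

/-- The origin of space-time. -/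
def origin : Site := ⟨(0, 0), by simp⟩

section Dynamics

variable {Ω : Type*}

/-- The law of a fair coin. -/
def fairCoin : Measure Bool := (PMF.uniformOfFintype Bool).toMeasure

/-- The randomness of the dynamical discrete web. At each site `z` there is a rate one Poisson
clock, given by its i.i.d. exponential waiting times `W z 0, W z 1, …`, and a sequence of fair
coins: `ε z 0` is the initial direction of the arrow at `z`, and `ε z n` is the direction to which
the arrow is reset when the clock rings for the `n`-th time. All of these are independent. -/
structure IsWebNoise [MeasurableSpace Ω] (P : Measure Ω)
    (W : Site → ℕ → Ω → ℝ) (ε : Site → ℕ → Ω → Bool) : Prop where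
  measurable_wait : ∀ z n, Measurable (W z n)
  measurable_coin : ∀ z n, Measurable (ε z n)
  law : ∀ z n, P.map (fun ω => (W z n ω, ε z n ω)) = (expMeasure 1).prod fairCoin
  indep : iIndepFun (fun (i : Site × ℕ) (ω : Ω) => (W i.1 i.2 ω, ε i.1 i.2 ω)) P

/-- The number of rings of the clock at `z` during the dynamical time interval `[0, τ]`. -/
def rings (W : Site → ℕ → Ω → ℝ) (τ : ℝ) (ω : Ω) (z : Site) : ℕ :=
  Set.ncard {n : ℕ | ∑ i ∈ Finset.range (n + 1), W z i ω ≤ τ}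

/-- The arrow configuration at the dynamical time `τ`. -/
def arrows (W : Site → ℕ → Ω → ℝ) (ε : Site → ℕ → Ω → Bool) (τ : ℝ) (ω : Ω) (z : Site) : Bool :=
  ε z (rings W τ ω z) ω

/-- The set of `K`-exceptional times: those `τ ∈ [0, ∞)` at which the path from the origin does not
cross the moving boundary `t ↦ -K √t`. -/
def exceptionalTimes (W : Site → ℕ → Ω → ℝ) (ε : Site → ℕ → Ω → Bool) (K : ℝ) (ω : Ω) : Set ℝ :=
  {τ | 0 ≤ τ ∧ ∀ t : ℝ, 0 ≤ t → -K * √t ≤ path (arrows W ε τ ω) origin t}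

end Dynamics

/-- The function `γ ↦ K(γ) = (γ - 2) √((γ + 1) / (γ - 1))`. -/
def kOf (γ : ℝ) : ℝ := (γ - 2) * √((γ + 1) / (γ - 1))

theorem exists_kOf_eq {K : ℝ} (hK : 0 < K) : ∃ γ ∈ Set.Ioi (2 : ℝ), kOf γ = K := by
  have hc : ContinuousOn kOf (Set.Icc 2 (K + 2)) := by
    unfold kOf
    refine ContinuousOn.mul (by fun_prop) (ContinuousOn.sqrt (ContinuousOn.div (by fun_prop)
      (by fun_prop) ?_))
    intro x hx
    have := hx.1
    linarith
  have h2 : kOf 2 = 0 := by simp [kOf]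
  have h3 : K ≤ kOf (K + 2) := by
    have : 1 ≤ √((K + 2 + 1) / (K + 2 - 1)) := by
      rw [Real.one_le_sqrt, one_le_div (by linarith)]
      linarith
    unfold kOf
    nlinarith
  obtain ⟨γ, hγ, h⟩ := intermediate_value_Icc (by linarith) hc ⟨by linarith [h2], h3⟩
  refine ⟨γ, ?_, h⟩
  rcases hγ.1.lt_or_eq with h' | h'
  · exact h'
  · subst h'
    linarith

theorem kOf_strictMonoOn : StrictMonoOn kOf (Set.Ioi 2) := by
  intro a ha b hb hab
  simp only [Set.mem_Ioi] at ha hb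
  have hs : ∀ x : ℝ, 2 < x → kOf x = √((x - 2) ^ 2 * ((x + 1) / (x - 1))) := by
    intro x hx
    rw [Real.sqrt_mul (sq_nonneg _), Real.sqrt_sq (by linarith), kOf]
  rw [hs a ha, hs b hb]
  apply Real.sqrt_lt_sqrt
  · have : 0 < a - 1 := by linarith
    have : 0 < a + 1 := by linarith
    positivity
  · rw [← mul_div_assoc, ← mul_div_assoc, div_lt_div_iff₀ (by linarith) (by linarith)]
    obtain ⟨u, rfl⟩ : ∃ u, a = 2 + u := ⟨a - 2, by ring⟩
    obtain ⟨w, rfl⟩ : ∃ w, b = 2 + u + w := ⟨b - (2 + u), by ring⟩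
    have hu : 0 < u := by linarith
    have hw : 0 < w := by linarith
    rw [← sub_pos]
    ring_nf
    positivity

/-- `γ(K)`: for `K > 0`, the solution `γ ∈ (2, ∞)` of `K(γ) = K`. -/
def gammaOf (K : ℝ) : ℝ := Function.invFunOn kOf (Set.Ioi 2) K

theorem gammaOf_spec {K : ℝ} (hK : 0 < K) : 2 < gammaOf K ∧ kOf (gammaOf K) = K :=
  ⟨Function.invFunOn_mem (exists_kOf_eq hK), Function.invFunOn_eq (exists_kOf_eq hK)⟩

theorem eq_gammaOf {K γ : ℝ} (hK : 0 < K) (hγ : 2 < γ) (h : kOf γ = K) : γ = gammaOf K :=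
  kOf_strictMonoOn.injOn hγ (gammaOf_spec hK).1 (h.trans (gammaOf_spec hK).2.symm)

/-- The half-width `d_k = 2 (⌊γ ^ k / 2⌋ + 1)` of the `k`-th box; its height is `d_k ^ 2`. -/
def boxSize (γ : ℝ) (k : ℕ) : ℤ := 2 * (⌊γ ^ k / 2⌋ + 1)

/-- The abscissa `x_k` of the middle point of the lower edge of the `k`-th box. -/
def boxX (γ : ℝ) (k : ℕ) : ℤ := ∑ i ∈ Finset.range k, boxSize γ i

/-- The time `t_k` of the lower edge of the `k`-th box. -/
def boxT (γ : ℝ) (k : ℕ) : ℤ := ∑ i ∈ Finset.range k, boxSize γ i ^ 2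

/-- The middle point `(x_k, t_k)` of the lower edge of the `k`-th box. -/
def boxBase (γ : ℝ) (k : ℕ) : Site :=
  ⟨(boxX γ k, boxT γ k), by
    have h : ∀ i, Even (boxSize γ i) := fun i => even_two_mul _
    simp only [boxX, boxT]
    exact (Finset.even_sum _ fun i _ => h i).add
      (Finset.even_sum _ fun i _ => (h i).pow_of_ne_zero two_ne_zero)⟩

variable {Ω : Type*}

/-- The event `A_k^τ`: the path from `(x_k, t_k)` stays, during `[t_k, t_{k+1}]`, to the right of
the left side of the `k`-th box, and ends to the right of `x_{k+1}`. -/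
def boxEvent (W : Site → ℕ → Ω → ℝ) (ε : Site → ℕ → Ω → Bool) (γ : ℝ) (k : ℕ) (τ : ℝ) : Set Ω :=
  {ω | (∀ t ∈ Set.Icc (boxT γ k : ℝ) (boxT γ (k + 1) : ℝ),
          (boxX γ k : ℝ) - (boxSize γ k : ℝ) < path (arrows W ε τ ω) (boxBase γ k) t) ∧
        (boxX γ (k + 1) : ℝ) < path (arrows W ε τ ω) (boxBase γ k) (boxT γ (k + 1) : ℝ)}

/-- `γ₀ = sup 1 / P(A_k(K))`, over all `k ≥ 0` and `K > 0`, where `A_k(K)` is the event `A_k^0` for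
`γ = γ(K)`. The supremum is taken in `[0, ∞]`. -/
def gammaZero [MeasurableSpace Ω] (P : Measure Ω)
    (W : Site → ℕ → Ω → ℝ) (ε : Site → ℕ → Ω → Bool) : ℝ≥0∞ :=
  ⨆ (k : ℕ) (K : ℝ) (_ : 0 < K), (P (boxEvent W ε (gammaOf K) k 0))⁻¹

end

end DynWeb

/-!
A dynamical time at which every box is survived is exceptional for `K(γ)`: by non-crossing, the
path from the origin stays to the right of the paths through the boxes, and the left sides of the
boxes lie to the right of the moving boundary. Different boxes use disjoint sets of arrows, so their
survival is independent. Within the `k`-th box, the walks at two dynamical times at distance `δ` are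
sticky: they take independent steps when apart and steps of correlation `ρ = exp (-δ)` when
together. As they spend little time together before they separate, the ratio between the joint
survival probability and its value for independent walks is at most `1 + C (δ γ ^ k) ^ (-1/3)`; it
is also at most `γ₀`, and these two bounds multiply to a two-point correlation of order
`δ ^ (-log γ₀ / log γ)`.

Normalized Lebesgue measure on the times in `[0, L]` at which the first `n` boxes are survived
therefore has bounded expected `s`-energy for every `s < 1 - log γ₀ / log γ`, and the energy method
gives dimension at least `s` whenever its mass does not degenerate. By the second moment method this
has probability close to one as `L → ∞`, because the correlations decay. The times at which all
boxes are survived do not form a closed set, but only countably many ring times are missing from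
the intersection of the closures, which does not affect the dimension.
-/

namespace DynWeb

noncomputable section

open Filter

/-! ### The heat kernel of the simple random walk -/

theorem centralBinom_sq_mul_le (m : ℕ) : (2 * m + 1) * m.centralBinom ^ 2 ≤ 16 ^ m := by
  induction m with
  | zero => simp
  | succ m ih =>
    refine Nat.le_of_mul_le_mul_left (c := (m + 1) ^ 2) ?_ (by positivity)
    calc (m + 1) ^ 2 * ((2 * (m + 1) + 1) * (m + 1).centralBinom ^ 2)
        = (2 * m + 3) * ((m + 1) * (m + 1).centralBinom) ^ 2 := by ring
      _ = 4 * (2 * m + 1) * (2 * m + 3) * ((2 * m + 1) * m.centralBinom ^ 2) := by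
          rw [Nat.succ_mul_centralBinom_succ]; ring
      _ ≤ 4 * (2 * m + 1) * (2 * m + 3) * 16 ^ m := by gcongr
      _ ≤ 16 * (m + 1) ^ 2 * 16 ^ m := Nat.mul_le_mul_right _ (by nlinarith)
      _ = (m + 1) ^ 2 * 16 ^ (m + 1) := by ring

theorem pow_le_mul_centralBinom_sq {m : ℕ} (hm : 0 < m) :
    16 ^ m ≤ 4 * m * m.centralBinom ^ 2 := by
  induction m, hm using Nat.le_induction with
  | base => simp [Nat.centralBinom, Nat.choose]
  | succ m hm ih =>
    refine Nat.le_of_mul_le_mul_left (c := m + 1) ?_ (by positivity)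
    calc (m + 1) * 16 ^ (m + 1) = 16 * (m + 1) * 16 ^ m := by ring
      _ ≤ 16 * (m + 1) * (4 * m * m.centralBinom ^ 2) := by gcongr
      _ = 16 * (4 * m * (m + 1)) * m.centralBinom ^ 2 := by ring
      _ ≤ 16 * (2 * m + 1) ^ 2 * m.centralBinom ^ 2 := by gcongr; nlinarith
      _ = 4 * (2 * (2 * m + 1) * m.centralBinom) ^ 2 := by ring
      _ = (m + 1) * (4 * (m + 1) * (m + 1).centralBinom ^ 2) := by
          rw [← Nat.succ_mul_centralBinom_succ]; ring

theorem succ_mul_choose_sq_le (j a : ℕ) : (j + 1) * j.choose a ^ 2 ≤ 4 ^ j := by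
  suffices (j + 1) * j.choose (j / 2) ^ 2 ≤ 4 ^ j from
    le_trans (by gcongr; exact Nat.choose_le_middle a j) this
  obtain ⟨m, rfl | rfl⟩ := j.even_or_odd'
  · simpa [pow_mul, Nat.centralBinom] using centralBinom_sq_mul_le m
  · have hmid : (m + 1).centralBinom = 2 * (2 * m + 1).choose m := by
      rw [Nat.centralBinom, mul_add_one, Nat.choose_succ_succ, Nat.choose_symm_half]
      ring
    have hle := centralBinom_sq_mul_le (m + 1)
    rw [hmid, pow_succ 16] at hle
    rw [show (2 * m + 1) / 2 = m by lia, pow_succ 4, pow_mul]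
    norm_num
    nlinarith

theorem exp_mul_centralBinom_le_choose {m a : ℕ} (ha : a < m) :
    Real.exp (-(2 * a ^ 2 / (m - a))) * m.centralBinom ≤ (2 * m).choose (m + a) := by
  have ha' : (a : ℝ) < m := by exact_mod_cast ha
  set q : ℝ := (m - a) / (m + a) with hq
  have : 0 ≤ q := div_nonneg (by linarith) (by positivity)
  have hratio : ∀ b ≤ a, q ^ b * (m.centralBinom : ℝ) ≤ ((2 * m).choose (m + b) : ℝ) := by
    intro b hb
    induction b with
    | zero => simp [Nat.centralBinom]
    | succ b ih =>
      have hb' : (b : ℝ) + 1 ≤ a := by exact_mod_cast hb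
      have hm0 : (0 : ℝ) < m + b + 1 := by positivity
      have hstep : ((2 * m).choose (m + b + 1) : ℝ) * (m + b + 1) =
          (2 * m).choose (m + b) * (m - b) := by
        have := Nat.choose_succ_right_eq (2 * m) (m + b)
        rw [show 2 * m - (m + b) = m - b by lia] at this
        rw [← Nat.cast_sub (by lia : b ≤ m)]
        exact_mod_cast this
      have hqb : q ≤ (m - b) / (m + b + 1) := by
        rw [hq, div_le_div_iff₀ (by linarith) hm0]
        nlinarith
      calc q ^ (b + 1) * (m.centralBinom : ℝ) = q ^ b * m.centralBinom * q := by ring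
        _ ≤ (2 * m).choose (m + b) * ((m - b) / (m + b + 1)) := by
            gcongr; exact ih (by lia)
        _ = (2 * m).choose (m + (b + 1)) := by
            rw [← mul_div_assoc, ← hstep, mul_div_cancel_right₀ _ hm0.ne', add_assoc]
  have hexp : Real.exp (-(2 * a / (m - a))) ≤ q := by
    rw [Real.exp_neg, inv_le_comm₀ (Real.exp_pos _) (div_pos (by linarith) (by linarith)), inv_div]
    calc ((m : ℝ) + a) / (m - a) = 2 * a / (m - a) + 1 := by
          rw [div_add_one (sub_ne_zero.2 ha'.ne')]; ring
      _ ≤ _ := Real.add_one_le_exp _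
  calc Real.exp (-(2 * a ^ 2 / (m - a))) * m.centralBinom
      = Real.exp (-(2 * a / (m - a))) ^ a * m.centralBinom := by
        rw [← Real.exp_nat_mul]; ring_nf
    _ ≤ q ^ a * m.centralBinom := by gcongr
    _ ≤ (2 * m).choose (m + a) := hratio a le_rfl

/-- The heat kernel of the simple random walk on `ℤ`: the probability that the walk from `0` is at
`x` after `j` steps. -/
def heatKernel : ℕ → ℤ → ℝ
  | 0, x => if x = 0 then 1 else 0
  | j + 1, x => (heatKernel j (x + 1) + heatKernel j (x - 1)) / 2

theorem heatKernel_nonneg (j : ℕ) (x : ℤ) : 0 ≤ heatKernel j x := by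
  induction j generalizing x with
  | zero => simp only [heatKernel]; positivity
  | succ j ih => exact div_nonneg (add_nonneg (ih _) (ih _)) zero_le_two

theorem heatKernel_neg (j : ℕ) (x : ℤ) : heatKernel j (-x) = heatKernel j x := by
  induction j generalizing x with
  | zero => simp [heatKernel]
  | succ j ih =>
    simp only [heatKernel]
    rw [← ih (x + 1), ← ih (x - 1)]
    ring_nf

theorem heatKernel_eq_zero {j : ℕ} {x : ℤ} (hx : (j : ℤ) < |x| ∨ Odd (x + j)) :
    heatKernel j x = 0 := by
  induction j generalizing x with
  | zero => exact if_neg (by rintro rfl; simp at hx)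
  | succ j ih =>
    push_cast at hx
    simp only [heatKernel]
    rw [ih (by grind), ih (by grind)]
    simp

theorem heatKernel_eq_choose (j a : ℕ) :
    heatKernel j (2 * a - j) = (j.choose a : ℝ) / 2 ^ j := by
  induction j generalizing a with
  | zero => cases a <;> simp [heatKernel]; norm_cast
  | succ j ih =>
    have hright : heatKernel j (2 * a - (j + 1 : ℕ) + 1) = (j.choose a : ℝ) / 2 ^ j := by
      rw [← ih a]; push_cast; ring_nf
    rw [heatKernel, hright]
    cases a with
    | zero =>
      rw [heatKernel_eq_zero (Or.inl (by grind))]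
      simp [pow_succ]
      ring
    | succ a =>
      have hleft : heatKernel j (2 * (a + 1 : ℕ) - (j + 1 : ℕ) - 1) = (j.choose a : ℝ) / 2 ^ j := by
        rw [← ih a]; push_cast; ring_nf
      rw [hleft, Nat.choose_succ_succ]
      push_cast
      ring

theorem heatKernel_le (j : ℕ) (x : ℤ) : heatKernel j x ≤ 1 / √(j + 1) := by
  by_cases hx : (j : ℤ) < |x| ∨ Odd (x + j)
  · rw [heatKernel_eq_zero hx]; positivity
  obtain ⟨a, rfl⟩ : ∃ a : ℕ, x = 2 * a - j := by
    rw [not_or, not_lt, Int.not_odd_iff_even] at hx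
    obtain ⟨b, hb⟩ := hx.2
    exact ⟨b.toNat, by grind⟩
  have hsq : (((j + 1) * j.choose a ^ 2 : ℕ) : ℝ) ≤ (4 ^ j : ℕ) :=
    Nat.cast_le.2 (succ_mul_choose_sq_le j a)
  rw [heatKernel_eq_choose, div_le_div_iff₀ (by positivity) (by positivity), one_mul]
  refine abs_le_of_sq_le_sq' ?_ (by positivity) |>.2
  rw [mul_pow, Real.sq_sqrt (by positivity), ← pow_mul, mul_comm j 2, pow_mul]
  norm_num at hsq ⊢
  linarith

theorem le_heatKernel {m a : ℕ} (ha : a < m) :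
    Real.exp (-(2 * a ^ 2 / (m - a))) / (2 * √m) ≤ heatKernel (2 * m) (2 * a) := by
  have hm : (0 : ℝ) < m := by exact_mod_cast (Nat.zero_le a).trans_lt ha
  have hcentral : (2 : ℝ) ^ (2 * m) ≤ 2 * √m * m.centralBinom := by
    refine abs_le_of_sq_le_sq' ?_ (by positivity) |>.2
    have : ((16 ^ m : ℕ) : ℝ) ≤ (4 * m * m.centralBinom ^ 2 : ℕ) :=
      Nat.cast_le.2 (pow_le_mul_centralBinom_sq (by lia))
    rw [mul_pow, mul_pow, Real.sq_sqrt hm.le, ← pow_mul, mul_right_comm, pow_mul]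
    norm_num at this ⊢
    exact this
  have hchoose : heatKernel (2 * m) (2 * a) = ((2 * m).choose (m + a) : ℝ) / 2 ^ (2 * m) := by
    rw [← heatKernel_eq_choose]; push_cast; ring_nf
  rw [hchoose, div_le_div_iff₀ (by positivity) (by positivity)]
  calc Real.exp (-(2 * a ^ 2 / (m - a))) * 2 ^ (2 * m)
      ≤ Real.exp (-(2 * a ^ 2 / (m - a))) * (2 * √m * m.centralBinom) := by gcongr
    _ = Real.exp (-(2 * a ^ 2 / (m - a))) * m.centralBinom * (2 * √m) := by ring
    _ ≤ (2 * m).choose (m + a) * (2 * √m) := by gcongr; exact exp_mul_centralBinom_le_choose ha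

/-! ### The survival of a single walk -/

/-- The probability that the simple random walk from `y` stays positive during the first `j` of its
steps and is then above `h`. -/
def survProb (h : ℤ) : ℕ → ℤ → ℝ
  | 0, y => if h < y then 1 else 0
  | j + 1, y => if y ≤ 0 then 0 else (survProb h j (y + 1) + survProb h j (y - 1)) / 2

/-- The discrete derivative of the survival probability in the starting point, given by the method
of images and thereby extended to an even function on `ℤ`. -/
def survSlope (h : ℤ) (j : ℕ) (y : ℤ) : ℝ :=
  heatKernel j (y - h) + heatKernel j (y - h - 1) + heatKernel j (y + h) + heatKernel j (y + h + 1)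

theorem survSlope_succ (h : ℤ) (j : ℕ) (y : ℤ) :
    survSlope h (j + 1) y = (survSlope h j (y + 1) + survSlope h j (y - 1)) / 2 := by
  simp only [survSlope, heatKernel]
  ring_nf

theorem survSlope_nonneg (h : ℤ) (j : ℕ) (y : ℤ) : 0 ≤ survSlope h j y := by
  have := heatKernel_nonneg j
  unfold survSlope
  linarith [this (y - h), this (y - h - 1), this (y + h), this (y + h + 1)]

theorem survSlope_le (h : ℤ) (j : ℕ) (y : ℤ) : survSlope h j y ≤ 4 * (1 / √(j + 1)) := by
  have := heatKernel_le j
  unfold survSlope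
  linarith [this (y - h), this (y - h - 1), this (y + h), this (y + h + 1)]

theorem survSlope_neg (h : ℤ) (j : ℕ) (y : ℤ) : survSlope h j (-y) = survSlope h j y := by
  unfold survSlope
  rw [← heatKernel_neg j (y - h), ← heatKernel_neg j (y - h - 1), ← heatKernel_neg j (y + h),
    ← heatKernel_neg j (y + h + 1)]
  ring_nf

section Survival

variable {h : ℤ} (hh : 0 ≤ h) (j : ℕ)

include hh

theorem survProb_of_nonpos {y : ℤ} (hy : y ≤ 0) : survProb h j y = 0 := by
  cases j with
  | zero => simp only [survProb]; rw [if_neg (by lia)]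
  | succ j => simp [survProb, hy]

theorem survProb_sub_survProb_aux :
    survProb h j 1 = survSlope h j 0 / 2 ∧
      ∀ y : ℤ, 1 ≤ y → survProb h j (y + 1) - survProb h j (y - 1) = survSlope h j y := by
  induction j with
  | zero =>
    constructor
    · simp only [survProb, survSlope, heatKernel]
      grind
    · intro y hy
      simp only [survProb, survSlope, heatKernel]
      grind
  | succ j ih =>
    obtain ⟨ihone, ihsub⟩ := ih
    have hzero : survProb h j 0 = 0 := survProb_of_nonpos hh j le_rfl
    constructor
    · have hslope := ihsub 1 le_rfl
      have heven := survSlope_neg h j 1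
      rw [survSlope_succ]
      norm_num [survProb] at hslope heven ⊢
      linarith
    · intro y hy
      rw [survSlope_succ]
      rcases hy.eq_or_lt with rfl | hy
      · have hslope := ihsub 2 (by norm_num)
        norm_num [survProb] at hslope ⊢
        linarith
      · have hright := ihsub (y + 1) (by lia)
        have hleft := ihsub (y - 1) (by lia)
        simp only [survProb]
        rw [if_neg (by lia), if_neg (by lia), ← hright, ← hleft]
        ring_nf

theorem survProb_sub_survProb {y : ℤ} (hy : 1 ≤ y) :
    survProb h j (y + 1) - survProb h j (y - 1) = survSlope h j y :=
  (survProb_sub_survProb_aux hh j).2 y hy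

theorem survProb_two_mul (e : ℕ) :
    survProb h j (2 * e) = ∑ i ∈ Finset.range e, survSlope h j (2 * i + 1) := by
  induction e with
  | zero => simp [survProb_of_nonpos hh]
  | succ e ih =>
    rw [Finset.sum_range_succ, ← ih, ← survProb_sub_survProb hh j (by lia)]
    push_cast
    ring_nf

end Survival

theorem le_heatKernel_of_le_two_mul {e a : ℕ} (he : 2 ≤ e) (ha : a ≤ 2 * e) :
    Real.exp (-8) / (3 * e) ≤ heatKernel ((2 * e) ^ 2) (2 * a) := by
  have he' : (2 : ℝ) ≤ e := by exact_mod_cast he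
  have ha' : (a : ℝ) ≤ 2 * e := by exact_mod_cast ha
  have hsqrt : 2 * √((2 * e ^ 2 : ℕ) : ℝ) ≤ 3 * e := by
    rw [← Real.sqrt_sq (by positivity : (0 : ℝ) ≤ 3 * e), ← Real.sqrt_sq zero_le_two,
      ← Real.sqrt_mul (by positivity)]
    apply Real.sqrt_le_sqrt
    push_cast
    nlinarith
  have hgap : (0 : ℝ) < (2 * e ^ 2 : ℕ) - a := by push_cast; nlinarith
  have hexp : 2 * (a : ℝ) ^ 2 / ((2 * e ^ 2 : ℕ) - a) ≤ 8 := by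
    rw [div_le_iff₀ hgap]
    push_cast
    nlinarith
  calc Real.exp (-8) / (3 * e)
      ≤ Real.exp (-(2 * a ^ 2 / ((2 * e ^ 2 : ℕ) - a))) / (2 * √((2 * e ^ 2 : ℕ) : ℝ)) := by
        have : 0 < 2 * e ^ 2 := by positivity
        gcongr
    _ ≤ heatKernel (2 * (2 * e ^ 2)) (2 * a) := le_heatKernel (by nlinarith)
    _ = heatKernel ((2 * e) ^ 2) (2 * a) := by ring_nf

/-- A walk started in the middle of the lower edge of a box of half-width `2 e` stays to the right
of the left edge and leaves to the right. -/
theorem le_survProb {e : ℕ} (he : 1 ≤ e) :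
    Real.exp (-8) / 3 ≤ survProb (2 * (2 * e)) ((2 * e) ^ 2) (2 * e) := by
  rcases he.eq_or_lt with rfl | he
  · have : Real.exp (-8) ≤ 1 / 9 := by
      rw [Real.exp_neg, ← one_div]
      gcongr
      linarith [Real.add_one_le_exp 8]
    norm_num [survProb]
    linarith
  rw [survProb_two_mul (by positivity)]
  have hterm : ∀ i ∈ Finset.range e, Real.exp (-8) / (3 * e) ≤
      survSlope (2 * (2 * e)) ((2 * e) ^ 2) (2 * i + 1) := by
    intro i hi
    have hi := Finset.mem_range.1 hi
    have hkernel := le_heatKernel_of_le_two_mul he (by lia : 2 * e - i ≤ 2 * e)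
    rw [← heatKernel_neg, show -(2 * ((2 * e - i : ℕ) : ℤ)) = 2 * i + 1 - 2 * (2 * e) - 1 by
      push_cast [show i ≤ 2 * e by lia]; ring] at hkernel
    have hnonneg := heatKernel_nonneg ((2 * e) ^ 2)
    unfold survSlope
    linarith [hnonneg (2 * i + 1 - 2 * (2 * e)), hnonneg (2 * i + 1 + 2 * (2 * e)),
      hnonneg (2 * i + 1 + 2 * (2 * e) + 1)]
  calc Real.exp (-8) / 3 = e * (Real.exp (-8) / (3 * e)) := by field_simp
    _ = (Finset.range e).card • (Real.exp (-8) / (3 * e)) := by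
        rw [Finset.card_range, nsmul_eq_mul]
    _ ≤ _ := Finset.card_nsmul_le_sum _ _ _ hterm

/-! ### The survival of two sticky walks -/

/-- One step of the pair of sticky walks on functions: the two steps are fair signs, independent
when the walks are at different places and of correlation `ρ` when they are at the same place. -/
def pairStep (ρ : ℝ) (f : ℤ → ℤ → ℝ) (x y : ℤ) : ℝ :=
  (1 + if x = y then ρ else 0) / 4 * (f (x + 1) (y + 1) + f (x - 1) (y - 1)) +
    (1 - if x = y then ρ else 0) / 4 * (f (x + 1) (y - 1) + f (x - 1) (y + 1))

/-- The probability that both of two sticky walks from `x` and `y` survive as in `survProb`. -/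
def pairSurvProb (ρ : ℝ) (h : ℤ) : ℕ → ℤ → ℤ → ℝ
  | 0, x, y => if h < x ∧ h < y then 1 else 0
  | j + 1, x, y => if x ≤ 0 ∨ y ≤ 0 then 0 else pairStep ρ (pairSurvProb ρ h j) x y

/-- The covariance of the survival of two sticky walks. -/
def survCov (ρ : ℝ) (h : ℤ) (j : ℕ) (x y : ℤ) : ℝ :=
  pairSurvProb ρ h j x y - survProb h j x * survProb h j y

/-- A supersolution for the expected time which two sticky walks spend together in `i` steps, with
`q = 1 - ρ` and a free length scale `l`. It majorizes `-|x - y| / q`, whose increments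
compensate that time, by `|a| ≤ (l + a ^ 2 / l) / 2`. -/
def meetPotential (q l : ℝ) (i : ℕ) (x y : ℤ) : ℝ :=
  ((l + (((x - y : ℤ) : ℝ) ^ 2 + 2 * i) / l) / 2 - |((x - y : ℤ) : ℝ)|) / q

theorem pairStep_mono {ρ : ℝ} (hρ₀ : 0 ≤ ρ) (hρ₁ : ρ ≤ 1) {f g : ℤ → ℤ → ℝ}
    (hfg : ∀ x y, f x y ≤ g x y) (x y : ℤ) : pairStep ρ f x y ≤ pairStep ρ g x y := by
  have hsame : 0 ≤ (1 + if x = y then ρ else 0) / 4 := by split_ifs <;> linarith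
  have hopp : 0 ≤ (1 - if x = y then ρ else 0) / 4 := by split_ifs <;> linarith
  exact add_le_add (mul_le_mul_of_nonneg_left (add_le_add (hfg _ _) (hfg _ _)) hsame)
    (mul_le_mul_of_nonneg_left (add_le_add (hfg _ _) (hfg _ _)) hopp)

theorem survCov_zero (ρ : ℝ) (h : ℤ) (x y : ℤ) : survCov ρ h 0 x y = 0 := by
  by_cases hx : h < x <;> by_cases hy : h < y <;> simp [survCov, pairSurvProb, survProb, hx, hy]

theorem survCov_succ_of_nonpos (ρ : ℝ) (h : ℤ) (j : ℕ) {x y : ℤ} (hxy : x ≤ 0 ∨ y ≤ 0) :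
    survCov ρ h (j + 1) x y = 0 := by
  rcases hxy with hx | hy <;> simp [survCov, pairSurvProb, survProb, *]

theorem survCov_succ (ρ : ℝ) {h : ℤ} (hh : 0 ≤ h) (j : ℕ) {x y : ℤ} (hx : 1 ≤ x) (hy : 1 ≤ y) :
    survCov ρ h (j + 1) x y =
      pairStep ρ (survCov ρ h j) x y + (if x = y then ρ else 0) * (survSlope h j x / 2) ^ 2 := by
  simp only [survCov, pairSurvProb, survProb]
  rw [if_neg (by lia), if_neg (by lia), if_neg (by lia)]
  by_cases hxy : x = y
  · subst hxy
    rw [← survProb_sub_survProb hh j hx]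
    simp only [pairStep, survCov, if_true]
    ring
  · simp only [pairStep, survCov, if_neg hxy]
    ring

theorem survCov_le_of_supersolution {ρ : ℝ} (hρ₀ : 0 ≤ ρ) (hρ₁ : ρ ≤ 1) {h : ℤ} (hh : 0 ≤ h)
    {j : ℕ} {G : ℕ → ℤ → ℤ → ℝ} (hG : ∀ i x y, 0 ≤ G i x y)
    (hinit : ∀ x y, survCov ρ h j x y ≤ G 0 x y)
    (hstep : ∀ i x y, pairStep ρ (G i) x y +
      (if x = y then ρ else 0) * (survSlope h (j + i) x / 2) ^ 2 ≤ G (i + 1) x y)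
    (i : ℕ) (x y : ℤ) : survCov ρ h (j + i) x y ≤ G i x y := by
  induction i generalizing x y with
  | zero => exact hinit x y
  | succ i ih =>
    rw [← add_assoc]
    by_cases hxy : x ≤ 0 ∨ y ≤ 0
    · exact (survCov_succ_of_nonpos ρ h _ hxy).trans_le (hG _ _ _)
    rw [survCov_succ ρ hh _ (by lia) (by lia)]
    linarith [pairStep_mono hρ₀ hρ₁ ih x y, hstep i x y]

theorem one_div_sqrt_succ_le (j : ℕ) : 1 / √((j : ℝ) + 1) ≤ 2 * (√((j : ℝ) + 1) - √j) := by
  have hj := Real.sq_sqrt (Nat.cast_nonneg' j : (0 : ℝ) ≤ j)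
  have hj' := Real.sq_sqrt (by positivity : (0 : ℝ) ≤ j + 1)
  rw [div_le_iff₀ (by positivity)]
  nlinarith [sq_nonneg (√((j : ℝ) + 1) - √j)]

theorem survCov_le_survSlope {ρ : ℝ} (hρ₀ : 0 ≤ ρ) (hρ₁ : ρ ≤ 1) {h : ℤ} (hh : 0 ≤ h) (j : ℕ)
    (x y : ℤ) : survCov ρ h (j + 1) x y ≤ ρ * (2 * √(j + 1)) * survSlope h j x := by
  have hsource : ∀ (i : ℕ) (x y : ℤ), (if x = y then ρ else 0) * (survSlope h i x / 2) ^ 2 ≤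
      ρ * (2 * (√((i : ℝ) + 1) - √i)) * survSlope h i x := by
    intro i x y
    have hρ : (if x = y then ρ else 0) ≤ ρ := by split_ifs <;> simp [hρ₀]
    have hslope := survSlope_nonneg h i x
    calc _ ≤ ρ * (survSlope h i x / 2) ^ 2 := by gcongr
      _ = ρ * (survSlope h i x / 4) * survSlope h i x := by ring
      _ ≤ _ := by gcongr; linarith [survSlope_le h i x, one_div_sqrt_succ_le i]
  have hmain := survCov_le_of_supersolution hρ₀ hρ₁ hh (j := 0)
    (G := fun i x _ => ρ * (2 * √i) * survSlope h (i - 1) x)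
    (fun i x _ => by have := survSlope_nonneg h (i - 1) x; positivity)
    (fun x y => by simp [survCov_zero]) (fun i x y => ?_) (j + 1) x y
  · simpa using hmain
  · have hi := hsource i x y
    cases i with
    | zero => simpa [pairStep] using hi
    | succ i =>
      simp only [pairStep, zero_add, Nat.add_sub_cancel, survSlope_succ h i] at hi ⊢
      push_cast at hi ⊢
      linarith

theorem meetPotential_nonneg {q l : ℝ} (hq : 0 < q) (hl : 0 < l) (i : ℕ) (x y : ℤ) :
    0 ≤ meetPotential q l i x y := by
  set a : ℝ := ((x - y : ℤ) : ℝ) with ha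
  have hsq : 2 * |a| ≤ l + a ^ 2 / l := by
    have heq : l + a ^ 2 / l - 2 * |a| = (l - |a|) ^ 2 / l := by
      field_simp
      rw [← sq_abs a]
      ring
    linarith [show 0 ≤ (l - |a|) ^ 2 / l by positivity]
  have hmono : a ^ 2 / l ≤ (a ^ 2 + 2 * i) / l := by
    gcongr
    exact le_add_of_nonneg_right (by positivity)
  exact div_nonneg (by rw [← ha]; linarith) hq.le

theorem pairStep_meetPotential_le {ρ l : ℝ} (hρ₀ : 0 ≤ ρ) (hρ₁ : ρ < 1) (hl : 0 < l) (i : ℕ)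
    (x y : ℤ) :
    pairStep ρ (meetPotential (1 - ρ) l i) x y + (if x = y then 1 else 0) ≤
      meetPotential (1 - ρ) l (i + 1) x y := by
  have hq : 0 < 1 - ρ := by linarith
  simp only [pairStep, meetPotential]
  push_cast
  rw [← sub_nonneg]
  by_cases hxy : x = y
  · subst hxy
    have habs : |(x : ℝ) + 1 - (x - 1)| = 2 ∧ |(x : ℝ) - 1 - (x + 1)| = 2 := by
      constructor <;> ring_nf <;> norm_num
    simp only [habs, if_true, sub_self, abs_zero]
    refine (show 0 ≤ ρ / (l * (1 - ρ)) by positivity).trans (le_of_eq ?_)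
    field_simp
    ring
  · simp only [if_neg hxy, add_sub_add_right_eq_sub, sub_sub_sub_cancel_right]
    set a : ℝ := (x : ℝ) - y with ha
    rw [show (x : ℝ) + 1 - (y - 1) = a + 2 by rw [ha]; ring,
      show (x : ℝ) - 1 - (y + 1) = a - 2 by rw [ha]; ring]
    have hconvex : 2 * |a| ≤ |a + 2| + |a - 2| := by
      have := abs_add_le (a + 2) (a - 2)
      rwa [show a + 2 + (a - 2) = 2 * a by ring, abs_mul, abs_two] at this
    have : 0 ≤ (|a + 2| + |a - 2| - 2 * |a|) / (4 * (1 - ρ)) :=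
      div_nonneg (by linarith) (by linarith)
    refine this.trans (le_of_eq ?_)
    field_simp
    ring

theorem sq_survSlope_le {h : ℤ} {j k : ℕ} (hjk : j ≤ k) (x : ℤ) :
    (survSlope h k x / 2) ^ 2 ≤ 4 / (j + 1) := by
  have hslope : survSlope h k x / 2 ≤ 2 / √((j : ℝ) + 1) := by
    have : 1 / √((k : ℝ) + 1) ≤ 1 / √((j : ℝ) + 1) := by gcongr
    have := survSlope_le h k x
    rw [← mul_one_div 2]
    linarith
  calc (survSlope h k x / 2) ^ 2 ≤ (2 / √((j : ℝ) + 1)) ^ 2 :=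
        pow_le_pow_left₀ (div_nonneg (survSlope_nonneg h k x) zero_le_two) hslope 2
    _ = 4 / (j + 1) := by rw [div_pow, Real.sq_sqrt (by positivity)]; norm_num

/-- During the first `i` steps the covariance grows at rate at most `4 ρ / (j + 1)` while the walks
are together; the remaining `j + 1` steps are covered by `survCov_le_survSlope`. -/
theorem survCov_le_add_meetPotential {ρ l : ℝ} (hρ₀ : 0 ≤ ρ) (hρ₁ : ρ < 1) (hl : 0 < l) {h : ℤ}
    (hh : 0 ≤ h) (j i : ℕ) (x y : ℤ) :
    survCov ρ h (j + 1 + i) x y ≤ ρ * (2 * √(j + 1)) * survSlope h (j + i) x +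
      ρ * (4 / (j + 1)) * meetPotential (1 - ρ) l i x y := by
  have hpot : ∀ i x y, 0 ≤ meetPotential (1 - ρ) l i x y :=
    meetPotential_nonneg (sub_pos.2 hρ₁) hl
  refine survCov_le_of_supersolution hρ₀ hρ₁.le hh (G := fun i x y =>
    ρ * (2 * √(j + 1)) * survSlope h (j + i) x + ρ * (4 / (j + 1)) * meetPotential (1 - ρ) l i x y)
    (fun i x y => ?_) (fun x y => ?_) (fun i x y => ?_) i x y
  · have := hpot i x y
    have := survSlope_nonneg h (j + i) x
    positivity
  · refine (survCov_le_survSlope hρ₀ hρ₁.le hh j x y).trans (le_add_of_nonneg_right ?_)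
    have := hpot 0 x y
    positivity
  · have hsource : (if x = y then ρ else 0) * (survSlope h (j + 1 + i) x / 2) ^ 2 ≤
        ρ * (4 / (j + 1)) * (if x = y then 1 else 0) := by
      split_ifs
      · rw [mul_one]
        gcongr
        exact sq_survSlope_le (by lia) x
      · simp
    have hstep : ρ * (4 / ((j : ℝ) + 1)) *
        (pairStep ρ (meetPotential (1 - ρ) l i) x y + (if x = y then 1 else 0)) ≤
        ρ * (4 / (j + 1)) * meetPotential (1 - ρ) l (i + 1) x y := by
      gcongr
      exact pairStep_meetPotential_le hρ₀ hρ₁ hl i x y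
    rw [← add_assoc, survSlope_succ]
    simp only [pairStep] at hstep ⊢
    linarith

theorem meetPotential_self_le {q : ℝ} (hq : 0 < q) {d i : ℕ} (hd : 0 < d) (hi : i ≤ d ^ 2)
    (x : ℤ) : meetPotential q d i x x ≤ 3 * d / (2 * q) := by
  have hd' : (0 : ℝ) < d := by exact_mod_cast hd
  have hi' : 2 * (i : ℝ) / d ≤ 2 * d := by
    have : (i : ℝ) ≤ d ^ 2 := by exact_mod_cast hi
    rw [div_le_iff₀ hd']
    nlinarith
  calc meetPotential q d i x x = (d + 2 * (i : ℝ) / d) / (2 * q) := by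
        simp [meetPotential, div_div]
    _ ≤ 3 * d / (2 * q) := by gcongr; linarith

theorem survCov_self_le {ρ : ℝ} (hρ₀ : 0 ≤ ρ) (hρ₁ : ρ < 1) {h : ℤ} (hh : 0 ≤ h) {d j : ℕ}
    (hj : j + 1 ≤ d ^ 2) (x : ℤ) :
    survCov ρ h (d ^ 2) x x ≤
      ρ * (8 * √(j + 1) / d) + ρ * (6 * d / ((1 - ρ) * (j + 1))) := by
  have hd : 0 < d := Nat.pos_of_ne_zero (by rintro rfl; simp at hj)
  have hd' : (0 : ℝ) < d := by exact_mod_cast hd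
  have hq : 0 < 1 - ρ := by linarith
  obtain ⟨i, hi⟩ := Nat.exists_eq_add_of_le hj
  have hslope : survSlope h (j + i) x ≤ 4 / d := by
    have hji : ((j + i : ℕ) : ℝ) + 1 = d ^ 2 := by norm_cast; lia
    have hle := survSlope_le h (j + i) x
    rwa [hji, Real.sqrt_sq hd'.le, mul_one_div] at hle
  have hpot := meetPotential_self_le hq hd (by lia : i ≤ d ^ 2) x
  calc survCov ρ h (d ^ 2) x x
      ≤ ρ * (2 * √(j + 1)) * survSlope h (j + i) x +
          ρ * (4 / (j + 1)) * meetPotential (1 - ρ) d i x x := by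
        rw [hi]; exact survCov_le_add_meetPotential hρ₀ hρ₁ hd' hh j i x x
    _ ≤ ρ * (2 * √(j + 1)) * (4 / d) + ρ * (4 / (j + 1)) * (3 * d / (2 * (1 - ρ))) := by gcongr
    _ = _ := by field_simp; ring

theorem survCov_le_eight_mul {ρ : ℝ} (hρ₀ : 0 ≤ ρ) (hρ₁ : ρ ≤ 1) {h : ℤ} (hh : 0 ≤ h) (j : ℕ)
    (x y : ℤ) : survCov ρ h j x y ≤ 8 * ρ := by
  cases j with
  | zero => rw [survCov_zero]; positivity
  | succ j =>
    calc survCov ρ h (j + 1) x y ≤ ρ * (2 * √(j + 1)) * survSlope h j x :=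
          survCov_le_survSlope hρ₀ hρ₁ hh j x y
      _ ≤ ρ * (2 * √(j + 1)) * (4 * (1 / √(j + 1))) := by gcongr; exact survSlope_le h j x
      _ = 8 * ρ := by field_simp; ring

/-- The choice `j + 1 ≈ (d r) ^ 2` in `survCov_self_le` balances its two terms. -/
theorem survCov_self_le_of_pow_three {ρ : ℝ} (hρ₀ : 0 ≤ ρ) (hρ₁ : ρ < 1) {h : ℤ} (hh : 0 ≤ h)
    {d : ℕ} {r : ℝ} (hr₀ : 0 < r) (hr₁ : r ≤ 1) (hr₃ : r ^ 3 * ((1 - ρ) * d) = 1)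
    (hdr : 1 ≤ d * r) (x : ℤ) : survCov ρ h (d ^ 2) x x ≤ 22 * ρ * r := by
  have hd : (0 : ℝ) < d := pos_of_mul_pos_left (by linarith) hr₀.le
  have : 0 < 1 - ρ := by linarith
  obtain ⟨j, hj⟩ : ∃ j : ℕ, ⌈((d : ℝ) * r) ^ 2⌉₊ = j + 1 :=
    Nat.exists_eq_add_one_of_ne_zero (Nat.ceil_pos.2 (by positivity)).ne'
  have hle : ((d : ℝ) * r) ^ 2 ≤ (j : ℝ) + 1 := by exact_mod_cast hj ▸ Nat.le_ceil _
  have hge : √((j : ℝ) + 1) ≤ 2 * (d * r) := by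
    have := Nat.ceil_lt_add_one (by positivity : 0 ≤ ((d : ℝ) * r) ^ 2)
    rw [hj] at this
    push_cast at this
    rw [Real.sqrt_le_left (by positivity)]
    nlinarith
  have hjd : j + 1 ≤ d ^ 2 := by
    rw [← hj, Nat.ceil_le]
    push_cast
    gcongr
    nlinarith
  calc survCov ρ h (d ^ 2) x x
      ≤ ρ * (8 * √(j + 1) / d) + ρ * (6 * d / ((1 - ρ) * (j + 1))) :=
        survCov_self_le hρ₀ hρ₁ hh hjd x
    _ ≤ ρ * (8 * (2 * (d * r)) / d) + ρ * (6 * d / ((1 - ρ) * (d * r) ^ 2)) := by gcongr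
    _ = ρ * (16 * r) + ρ * (6 * r) := by
        congr 2
        · field_simp; norm_num
        · rw [div_eq_iff (by positivity)]
          linear_combination (-6 * d) * hr₃
    _ = 22 * ρ * r := by ring

theorem survCov_self_le_mul_rpow {ρ : ℝ} (hρ₀ : 0 ≤ ρ) (hρ₁ : ρ < 1) {h : ℤ} (hh : 0 ≤ h) {d : ℕ}
    (hge : 1 ≤ (1 - ρ) * d) (x : ℤ) :
    survCov ρ h (d ^ 2) x x ≤ 22 * ρ * ((1 - ρ) * d) ^ (-(1 / 3) : ℝ) := by
  have hqd : 0 < (1 - ρ) * d := by linarith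
  set r : ℝ := ((1 - ρ) * d) ^ (-(1 / 3) : ℝ) with hr
  have hr₀ : 0 < r := Real.rpow_pos_of_pos hqd _
  have hr₁ : r ≤ 1 := Real.rpow_le_one_of_one_le_of_nonpos hge (by norm_num)
  have hr₃ : r ^ 3 * ((1 - ρ) * d) = 1 := by
    rw [hr, ← Real.rpow_mul_natCast hqd.le]
    norm_num
    rw [Real.rpow_neg_one, inv_mul_cancel₀ hqd.ne']
  have hdr : 1 ≤ d * r := by
    have : r ^ 3 * ((1 - ρ) * d) ≤ r * 1 * d := by
      rw [← mul_assoc]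
      gcongr
      · simpa using pow_le_pow_of_le_one hr₀.le hr₁ (by norm_num : 1 ≤ 3)
      · linarith
    linarith
  exact survCov_self_le_of_pow_three hρ₀ hρ₁ hh hr₀ hr₁ hr₃ hdr x

theorem pairSurvProb_le {ρ : ℝ} (hρ₀ : 0 ≤ ρ) (hρ₁ : ρ < 1) {h : ℤ} (hh : 0 ≤ h) {d : ℕ}
    (hd : 0 < d) (x : ℤ) :
    pairSurvProb ρ h (d ^ 2) x x ≤
      survProb h (d ^ 2) x ^ 2 + 22 * ρ * ((1 - ρ) * d) ^ (-(1 / 3) : ℝ) := by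
  suffices survCov ρ h (d ^ 2) x x ≤ 22 * ρ * ((1 - ρ) * d) ^ (-(1 / 3) : ℝ) by
    unfold survCov at this; linarith
  rcases le_or_gt 1 ((1 - ρ) * d) with hge | hlt
  · exact survCov_self_le_mul_rpow hρ₀ hρ₁ hh hge x
  have hqd : 0 < (1 - ρ) * d := mul_pos (by linarith) (by exact_mod_cast hd)
  have : 1 ≤ ((1 - ρ) * d) ^ (-(1 / 3) : ℝ) :=
    Real.one_le_rpow_of_pos_of_le_one_of_nonpos hqd hlt.le (by norm_num)
  calc survCov ρ h (d ^ 2) x x ≤ 8 * ρ := survCov_le_eight_mul hρ₀ hρ₁.le hh _ x x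
    _ ≤ 22 * ρ * ((1 - ρ) * d) ^ (-(1 / 3) : ℝ) := by nlinarith

/-! ### The clocks and the coins -/

section Noise

variable {Ω : Type*}

/-- The index of a single random variable of the web: `((z, n), true)` stands for the waiting time
`W z n`, and `((z, n), false)` for the coin `ε z n`. -/
abbrev NoiseIndex : Type := (Site × ℕ) × Bool

/-- The waiting times and the coins as one family of real random variables; the coins take the
values `0` and `1`. -/
def noise (W : Site → ℕ → Ω → ℝ) (ε : Site → ℕ → Ω → Bool) (p : NoiseIndex) (ω : Ω) : ℝ :=
  if p.2 then W p.1.1 p.1.2 ω else if ε p.1.1 p.1.2 ω then 1 else 0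

/-- The σ-algebra generated by the part of the noise with index in `S`. -/
@[reducible]
def noiseAlg (W : Site → ℕ → Ω → ℝ) (ε : Site → ℕ → Ω → Bool) (S : Set NoiseIndex) :
    MeasurableSpace Ω :=
  ⨆ p ∈ S, MeasurableSpace.comap (noise W ε p) inferInstance

/-- The σ-algebra generated by the clocks and coins at the sites in `T`. -/
@[reducible]
def siteAlg (W : Site → ℕ → Ω → ℝ) (ε : Site → ℕ → Ω → Bool) (T : Set Site) :
    MeasurableSpace Ω := noiseAlg W ε {p | p.1.1 ∈ T}

/-- The time at which the clock at `z` rings for the `n`-th time; it is `0` for `n = 0`. -/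
def ringTime (W : Site → ℕ → Ω → ℝ) (z : Site) (n : ℕ) (ω : Ω) : ℝ :=
  ∑ i ∈ Finset.range n, W z i ω

/-- The almost sure properties of the clocks: the waiting times are positive, and the ring times
do not accumulate. -/
def GoodClocks (W : Site → ℕ → Ω → ℝ) (ω : Ω) : Prop :=
  ∀ z, (∀ n, 0 < W z n ω) ∧ ∀ t : ℝ, ∃ n, t < ringTime W z n ω

theorem ringTime_succ (W : Site → ℕ → Ω → ℝ) (z : Site) (n : ℕ) (ω : Ω) :
    ringTime W z (n + 1) ω = ringTime W z n ω + W z n ω :=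
  Finset.sum_range_succ _ _

theorem rings_eq_ncard (W : Site → ℕ → Ω → ℝ) (τ : ℝ) (ω : Ω) (z : Site) :
    rings W τ ω z = Set.ncard {n : ℕ | ringTime W z (n + 1) ω ≤ τ} := rfl

theorem measurable_ncard_setOf_mem {α ι : Type*} [MeasurableSpace α] [Countable ι] {s : ι → Set α}
    (hs : ∀ i, MeasurableSet (s i)) : Measurable fun a => Set.ncard {i | a ∈ s i} :=
  measurable_ncard.comp (measurable_set_iff.2 fun i => measurable_mem.2 (hs i))

theorem measurable_apply_index {α β ι : Type*} [MeasurableSpace α] [MeasurableSpace β]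
    [Countable ι] [MeasurableSpace ι] [MeasurableSingletonClass ι] {N : α → ι} (hN : Measurable N)
    {f : ι → α → β} (hf : ∀ i, Measurable (f i)) : Measurable fun a => f (N a) a :=
  (measurable_from_prod_countable_right (f := fun p : ι × α => f p.1 p.2) hf).comp
    (hN.prodMk measurable_id)

namespace GoodClocks

variable {W : Site → ℕ → Ω → ℝ} {ω : Ω}

theorem strictMono_ringTime (hω : GoodClocks W ω) (z : Site) :
    StrictMono fun n => ringTime W z n ω :=
  strictMono_nat_of_lt_succ fun n => by
    rw [ringTime_succ]
    exact lt_add_of_pos_right _ ((hω z).1 n)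

theorem rings_eq_of_mem_Ico (hω : GoodClocks W ω) {z : Site} {τ : ℝ} {n : ℕ}
    (hτ : τ ∈ Set.Ico (ringTime W z n ω) (ringTime W z (n + 1) ω)) : rings W τ ω z = n := by
  have hmono := hω.strictMono_ringTime z
  have hset : {m : ℕ | ringTime W z (m + 1) ω ≤ τ} = Set.Iio n := by
    ext m
    refine ⟨fun hm => ?_, fun hm => (hmono.monotone (Nat.succ_le_of_lt hm)).trans hτ.1⟩
    exact Nat.lt_of_succ_lt_succ (hmono.lt_iff_lt.1 (hm.trans_lt hτ.2))
  rw [rings_eq_ncard, hset, ← Finset.coe_Iio, Set.ncard_coe_finset, Nat.card_Iio]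

theorem mem_Ico_ringTime_rings (hω : GoodClocks W ω) (z : Site) {τ : ℝ} (hτ : 0 ≤ τ) :
    τ ∈ Set.Ico (ringTime W z (rings W τ ω z) ω) (ringTime W z (rings W τ ω z + 1) ω) := by
  classical
  have hex : ∃ n, τ < ringTime W z n ω := (hω z).2 τ
  obtain ⟨n, hn⟩ : ∃ n, Nat.find hex = n + 1 := by
    refine Nat.exists_eq_succ_of_ne_zero fun h0 => hτ.not_gt ?_
    have hlt := Nat.find_spec hex
    rwa [h0, ringTime, Finset.range_zero, Finset.sum_empty] at hlt
  have hmem : τ ∈ Set.Ico (ringTime W z n ω) (ringTime W z (n + 1) ω) :=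
    ⟨not_lt.1 (Nat.find_min hex (by lia)), hn ▸ Nat.find_spec hex⟩
  rwa [hω.rings_eq_of_mem_Ico hmem]

theorem rings_eq_iff (hω : GoodClocks W ω) (z : Site) {τ : ℝ} (hτ : 0 ≤ τ) (n : ℕ) :
    rings W τ ω z = n ↔ τ ∈ Set.Ico (ringTime W z n ω) (ringTime W z (n + 1) ω) :=
  ⟨fun h => h ▸ hω.mem_Ico_ringTime_rings z hτ, hω.rings_eq_of_mem_Ico⟩

end GoodClocks

section Measurability

variable {W : Site → ℕ → Ω → ℝ} {ε : Site → ℕ → Ω → Bool} {S : Set NoiseIndex} {z : Site} {n : ℕ}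

theorem noiseAlg_measurable_noise {p : NoiseIndex} (hp : p ∈ S) :
    Measurable[noiseAlg W ε S] (noise W ε p) :=
  measurable_iff_comap_le.2 (le_biSup (fun p => MeasurableSpace.comap (noise W ε p) _) hp)

theorem noiseAlg_measurable_wait (h : ((z, n), true) ∈ S) : Measurable[noiseAlg W ε S] (W z n) :=
  noiseAlg_measurable_noise h

theorem noiseAlg_measurable_coin (h : ((z, n), false) ∈ S) :
    Measurable[noiseAlg W ε S] (ε z n) := by
  have hdecode : ε z n = (fun x : ℝ => decide (x = 1)) ∘ noise W ε ((z, n), false) := by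
    ext ω
    rcases hb : ε z n ω <;> simp [noise, hb]
  have hdecide : Measurable fun x : ℝ => decide (x = 1) :=
    measurable_to_bool (by simp [Set.preimage])
  rw [hdecode]
  exact hdecide.comp (noiseAlg_measurable_noise h)

theorem noiseAlg_measurable_ringTime (h : ∀ i < n, ((z, i), true) ∈ S) :
    Measurable[noiseAlg W ε S] (ringTime W z n) :=
  Finset.measurable_fun_sum _ fun i hi => noiseAlg_measurable_wait (h i (Finset.mem_range.1 hi))

theorem noiseAlg_measurable_rings (h : ∀ i, ((z, i), true) ∈ S) (τ : ℝ) :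
    Measurable[noiseAlg W ε S] fun ω => rings W τ ω z := by
  let _ : MeasurableSpace Ω := noiseAlg W ε S
  exact measurable_ncard_setOf_mem fun n =>
    measurableSet_le (noiseAlg_measurable_ringTime fun i _ => h i) measurable_const

theorem siteAlg_mono {T T' : Set Site} (h : T ⊆ T') : siteAlg W ε T ≤ siteAlg W ε T' :=
  biSup_mono fun _ hp => h hp

theorem siteAlg_measurable_arrows {T : Set Site} (h : z ∈ T) (τ : ℝ) :
    Measurable[siteAlg W ε T] fun ω => arrows W ε τ ω z := by
  let _ : MeasurableSpace Ω := siteAlg W ε T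
  exact measurable_apply_index (noiseAlg_measurable_rings (fun _ => h) τ)
    fun _ => noiseAlg_measurable_coin h

end Measurability

theorem iIndepFun_bool {β : Bool → Type*} {mβ : ∀ b, MeasurableSpace (β b)}
    [MeasurableSpace Ω] {μ : Measure Ω} [IsProbabilityMeasure μ] {X : ∀ b, Ω → β b}
    (hX : IndepFun (X true) (X false) μ) : iIndepFun X μ := by
  rw [iIndepFun_iff_measure_inter_preimage_eq_mul]
  rw [indepFun_iff_measure_inter_preimage_eq_mul] at hX
  intro S sets hsets
  have hS : S = ∅ ∨ S = {true} ∨ S = {false} ∨ S = {true, false} := by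
    clear hsets
    revert S
    decide
  rcases hS with rfl | rfl | rfl | rfl
  · simp
  · simp
  · simp
  · rw [Finset.set_biInter_insert, Finset.set_biInter_singleton, Finset.prod_pair (by simp)]
    exact hX _ _ (hsets true (by simp)) (hsets false (by simp))

theorem expMeasure_one_Ioi {x : ℝ} (hx : 0 ≤ x) :
    expMeasure 1 (Set.Ioi x) = ENNReal.ofReal (Real.exp (-x)) := by
  have : IsProbabilityMeasure (expMeasure 1) := isProbabilityMeasure_expMeasure one_pos
  rw [← Set.compl_Iic, prob_compl_eq_one_sub measurableSet_Iic, ← ofReal_cdf,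
    cdf_expMeasure_eq one_pos, if_pos hx, ← ENNReal.ofReal_one,
    ← ENNReal.ofReal_sub _ (by simpa using hx), one_mul, sub_sub_cancel]

theorem measure_setOf_mem_eq_lintegral {ι : Type*} [Countable ι] [MeasurableSpace ι]
    [MeasurableSingletonClass ι] [MeasurableSpace Ω] {P : Measure Ω} {X : Ω → ι}
    (hX : Measurable X) {E : ι → Set Ω} (hE : ∀ i, MeasurableSet (E i)) {f : ι → ℝ≥0∞}
    (hf : ∀ i, P (E i ∩ X ⁻¹' {i}) = f i * P (X ⁻¹' {i})) :
    P {ω | ω ∈ E (X ω)} = ∫⁻ ω, f (X ω) ∂P := by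
  have hfib : ∀ i, MeasurableSet (X ⁻¹' {i}) := fun i => hX (measurableSet_singleton i)
  calc P {ω | ω ∈ E (X ω)}
      = P (⋃ i, E i ∩ X ⁻¹' {i}) := by
        congr 1
        ext ω
        simp
    _ = ∑' i, P (E i ∩ X ⁻¹' {i}) :=
        measure_iUnion (fun i j hij => (pairwise_disjoint_fiber X hij).mono
          Set.inter_subset_right Set.inter_subset_right) fun i => (hE i).inter (hfib i)
    _ = ∑' i, f i * P.map X {i} :=
        tsum_congr fun i => by rw [hf, Measure.map_apply hX (measurableSet_singleton i)]
    _ = ∫⁻ ω, f (X ω) ∂P := by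
        rw [← lintegral_countable', lintegral_map (measurable_of_countable f) hX]

namespace IsWebNoise

variable {W : Site → ℕ → Ω → ℝ} {ε : Site → ℕ → Ω → Bool} [mΩ : MeasurableSpace Ω] {P : Measure Ω}

theorem measurable_noise (h : IsWebNoise P W ε) (p : NoiseIndex) : Measurable (noise W ε p) := by
  unfold noise
  split_ifs
  · exact h.measurable_wait _ _
  · exact Measurable.ite (h.measurable_coin _ _ (measurableSet_singleton true))
      measurable_const measurable_const

theorem noiseAlg_le (h : IsWebNoise P W ε) (S : Set NoiseIndex) : noiseAlg W ε S ≤ mΩ :=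
  iSup₂_le fun p _ => (h.measurable_noise p).comap_le

theorem siteAlg_le (h : IsWebNoise P W ε) (T : Set Site) : siteAlg W ε T ≤ mΩ :=
  h.noiseAlg_le _

theorem measurable_arrows_uncurry (h : IsWebNoise P W ε) (z : Site) :
    Measurable fun p : ℝ × Ω => arrows W ε p.1 p.2 z := by
  have hring : ∀ n, MeasurableSet {p : ℝ × Ω | ringTime W z (n + 1) p.2 ≤ p.1} := fun n =>
    measurableSet_le (Finset.measurable_fun_sum _ fun i _ =>
      (h.measurable_wait z i).comp measurable_snd) measurable_fst
  exact measurable_apply_index (measurable_ncard_setOf_mem hring)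
    fun n => (h.measurable_coin z n).comp measurable_snd

theorem law_wait (h : IsWebNoise P W ε) (z : Site) (n : ℕ) : P.map (W z n) = expMeasure 1 := by
  have : IsProbabilityMeasure fairCoin := by unfold fairCoin; infer_instance
  have hmap := congrArg Measure.fst (h.law z n)
  rwa [Measure.fst_map_prodMk (h.measurable_coin z n), Measure.fst_prod] at hmap

theorem law_coin (h : IsWebNoise P W ε) (z : Site) (n : ℕ) : P.map (ε z n) = fairCoin := by
  have : IsProbabilityMeasure (expMeasure 1) := isProbabilityMeasure_expMeasure one_pos
  have : IsProbabilityMeasure fairCoin := by unfold fairCoin; infer_instance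
  have hmap := congrArg Measure.snd (h.law z n)
  rwa [Measure.snd_map_prodMk (h.measurable_wait z n), Measure.snd_prod] at hmap

theorem measure_wait_gt (h : IsWebNoise P W ε) (z : Site) (n : ℕ) {t : ℝ} (ht : 0 ≤ t) :
    P {ω | t < W z n ω} = ENNReal.ofReal (Real.exp (-t)) := by
  rw [← expMeasure_one_Ioi ht, ← h.law_wait z n,
    Measure.map_apply (h.measurable_wait z n) measurableSet_Ioi]
  rfl

theorem measurable_ringTime (h : IsWebNoise P W ε) (z : Site) (n : ℕ) :
    Measurable (ringTime W z n) :=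
  Finset.measurable_fun_sum _ fun i _ => h.measurable_wait z i

theorem measure_coin (h : IsWebNoise P W ε) (z : Site) (n : ℕ) (b : Bool) :
    P {ω | ε z n ω = b} = 2⁻¹ := by
  have hmap : P {ω | ε z n ω = b} = P.map (ε z n) {b} := by
    rw [Measure.map_apply (h.measurable_coin z n) (measurableSet_singleton b)]
    rfl
  rw [hmap, h.law_coin, fairCoin, PMF.toMeasure_apply_singleton _ _ (measurableSet_singleton b)]
  simp

variable [IsProbabilityMeasure P]

theorem indepFun_wait_coin (h : IsWebNoise P W ε) (z : Site) (n : ℕ) :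
    IndepFun (W z n) (ε z n) P := by
  rw [indepFun_iff_map_prod_eq_prod_map_map (h.measurable_wait z n).aemeasurable
    (h.measurable_coin z n).aemeasurable, h.law, h.law_wait, h.law_coin]

theorem iIndepFun_noise (h : IsWebNoise P W ε) : iIndepFun (noise W ε) P := by
  have hcode : Measurable fun b : Bool => if b then (1 : ℝ) else 0 := measurable_of_countable _
  refine iIndepFun_uncurry' (X := fun i j => noise W ε (i, j))
    (fun i j => h.measurable_noise (i, j)) ?_ fun i => iIndepFun_bool ?_
  · refine h.indep.comp (fun _ (p : ℝ × Bool) (j : Bool) =>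
      if j then p.1 else if p.2 then (1 : ℝ) else 0) fun _ => measurable_pi_lambda _ fun j => ?_
    cases j
    · exact hcode.comp measurable_snd
    · exact measurable_fst
  · exact (h.indepFun_wait_coin i.1 i.2).comp measurable_id hcode

theorem indep_noiseAlg (h : IsWebNoise P W ε) {S T : Set NoiseIndex} (hST : Disjoint S T) :
    Indep (noiseAlg W ε S) (noiseAlg W ε T) P :=
  indep_iSup_of_disjoint (fun p => (h.measurable_noise p).comap_le)
    ((iIndepFun_iff_iIndep _ _ _).1 h.iIndepFun_noise) hST

theorem measure_inter_of_disjoint (h : IsWebNoise P W ε) {S T : Set NoiseIndex}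
    (hST : Disjoint S T) {A B : Set Ω} (hA : MeasurableSet[noiseAlg W ε S] A)
    (hB : MeasurableSet[noiseAlg W ε T] B) : P (A ∩ B) = P A * P B :=
  (Indep_iff _ _ _).1 (h.indep_noiseAlg hST) A B hA hB

theorem measure_inter_of_disjoint_sites (h : IsWebNoise P W ε) {T T' : Set Site}
    (hT : Disjoint T T') {A B : Set Ω} (hA : MeasurableSet[siteAlg W ε T] A)
    (hB : MeasurableSet[siteAlg W ε T'] B) : P (A ∩ B) = P A * P B :=
  h.measure_inter_of_disjoint (hT.preimage fun p : NoiseIndex => p.1.1) hA hB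

theorem ae_wait_pos (h : IsWebNoise P W ε) (z : Site) : ∀ᵐ ω ∂P, ∀ n, 0 < W z n ω := by
  refine ae_all_iff.2 fun n => ?_
  refine (prob_compl_eq_zero_iff (measurableSet_lt measurable_const (h.measurable_wait z n))).2 ?_
  rw [h.measure_wait_gt z n le_rfl, neg_zero, Real.exp_zero, ENNReal.ofReal_one]

theorem ae_exists_wait_gt (h : IsWebNoise P W ε) (z : Site) {t : ℝ} (ht : 0 ≤ t) :
    ∀ᵐ ω ∂P, ∃ n, t < W z n ω := by
  have hmeas : ∀ n, MeasurableSet {ω | t < W z n ω} := fun n =>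
    measurableSet_lt measurable_const (h.measurable_wait z n)
  have hindep : iIndepSet (fun n => {ω | t < W z n ω}) P := by
    have hwait : iIndepFun (fun n => noise W ε ((z, n), true)) P :=
      h.iIndepFun_noise.precomp (g := fun n : ℕ => (((z, n), true) : NoiseIndex))
        fun m n hmn => by simpa using hmn
    rw [iIndepSet_iff_meas_biInter hmeas]
    exact fun s => hwait.measure_inter_preimage_eq_mul _ (sets := fun _ => Set.Ioi t)
      fun _ _ => measurableSet_Ioi
  have hsum : ∑' n, P {ω | t < W z n ω} = ∞ := by
    simp_rw [h.measure_wait_gt z _ ht]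
    exact ENNReal.tsum_const_eq_top_of_ne_zero (by simp [Real.exp_pos])
  have hlim : limsup (fun n => {ω | t < W z n ω}) atTop ∈ ae P :=
    (prob_compl_eq_zero_iff (MeasurableSet.measurableSet_limsup hmeas)).2
      (measure_limsup_eq_one hmeas hindep hsum)
  filter_upwards [hlim] with ω hω
  exact (mem_limsup_iff_frequently_mem.1 hω).exists

theorem ae_goodClocks (h : IsWebNoise P W ε) : ∀ᵐ ω ∂P, GoodClocks W ω := by
  refine ae_all_iff.2 fun z => ?_
  filter_upwards [h.ae_wait_pos z, ae_all_iff.2 fun k : ℕ => h.ae_exists_wait_gt z k.cast_nonneg]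
    with ω hpos hgt
  refine ⟨hpos, fun t => ?_⟩
  obtain ⟨k, hk⟩ := exists_nat_ge t
  obtain ⟨n, hn⟩ := hgt k
  refine ⟨n + 1, ?_⟩
  rw [ringTime_succ]
  have : 0 ≤ ringTime W z n ω := Finset.sum_nonneg fun i _ => (hpos i).le
  linarith

theorem map_ringTime_wait (h : IsWebNoise P W ε) (z : Site) (n : ℕ) :
    P.map (fun ω => (ringTime W z n ω, W z n ω)) =
      (P.map (ringTime W z n)).prod (expMeasure 1) := by
  have hindep : IndepFun (ringTime W z n) (W z n) P := by
    have hdisj : Disjoint {p : NoiseIndex | p.1.2 < n} {p | p.1.2 = n} :=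
      Set.disjoint_left.2 fun p hlt heq => hlt.ne heq
    exact indep_of_indep_of_le_left (indep_of_indep_of_le_right (h.indep_noiseAlg hdisj)
      (noiseAlg_measurable_wait (by simp)).comap_le)
      (noiseAlg_measurable_ringTime (by simp)).comap_le
  rw [hindep.map_prod_eq_prod_map_map (h.measurable_ringTime z n).aemeasurable
    (h.measurable_wait z n).aemeasurable, h.law_wait]

theorem measure_ringTime_le_lt (h : IsWebNoise P W ε) (z : Site) (n : ℕ) {τ t : ℝ} (ht : τ ≤ t) :
    P {ω | ringTime W z n ω ≤ τ ∧ t < ringTime W z (n + 1) ω} =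
      ENNReal.ofReal (Real.exp (-t)) *
        ∫⁻ s in Set.Iic τ, ENNReal.ofReal (Real.exp s) ∂(P.map (ringTime W z n)) := by
  have : IsProbabilityMeasure (expMeasure 1) := isProbabilityMeasure_expMeasure one_pos
  have hmeas : MeasurableSet {p : ℝ × ℝ | p.1 ≤ τ ∧ t < p.1 + p.2} :=
    (measurableSet_le measurable_fst measurable_const).inter
      (measurableSet_lt measurable_const (measurable_fst.add measurable_snd))
  have hsection : ∀ s : ℝ, expMeasure 1 (Prod.mk s ⁻¹' {p : ℝ × ℝ | p.1 ≤ τ ∧ t < p.1 + p.2}) =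
      (Set.Iic τ).indicator (fun s => ENNReal.ofReal (Real.exp (-t)) *
        ENNReal.ofReal (Real.exp s)) s := by
    intro s
    by_cases hs : s ≤ τ
    · have hIoi : Prod.mk s ⁻¹' {p : ℝ × ℝ | p.1 ≤ τ ∧ t < p.1 + p.2} = Set.Ioi (t - s) := by
        ext w
        simp [hs, sub_lt_iff_lt_add']
      rw [hIoi, expMeasure_one_Ioi (by linarith), Set.indicator_of_mem (Set.mem_Iic.2 hs),
        ← ENNReal.ofReal_mul (Real.exp_pos _).le, ← Real.exp_add]
      ring_nf
    · simp [hs]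
  calc P {ω | ringTime W z n ω ≤ τ ∧ t < ringTime W z (n + 1) ω}
      = P.map (fun ω => (ringTime W z n ω, W z n ω)) {p | p.1 ≤ τ ∧ t < p.1 + p.2} := by
        rw [Measure.map_apply ((h.measurable_ringTime z n).prodMk (h.measurable_wait z n)) hmeas]
        simp only [ringTime_succ]
        rfl
    _ = _ := by
        rw [h.map_ringTime_wait, Measure.prod_apply hmeas, lintegral_congr hsection,
          lintegral_indicator measurableSet_Iic, lintegral_const_mul' _ _ ENNReal.ofReal_ne_top]

theorem measure_rings_eq (h : IsWebNoise P W ε) (z : Site) {τ δ : ℝ} (hτ : 0 ≤ τ) (hδ : 0 ≤ δ) :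
    P {ω | rings W τ ω z = rings W (τ + δ) ω z} = ENNReal.ofReal (Real.exp (-δ)) := by
  have hN : Measurable fun ω => rings W τ ω z :=
    (noiseAlg_measurable_rings (ε := ε) (S := Set.univ) (fun _ => trivial) τ).mono
      (h.noiseAlg_le _) le_rfl
  have hring : ∀ n, MeasurableSet {ω | τ + δ < ringTime W z (n + 1) ω} := fun n =>
    measurableSet_lt measurable_const (h.measurable_ringTime z (n + 1))
  have hmem : ∀ᵐ ω ∂P, ∀ n, ω ∈ (fun ω => rings W τ ω z) ⁻¹' {n} ↔
      ringTime W z n ω ≤ τ ∧ τ < ringTime W z (n + 1) ω := by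
    filter_upwards [h.ae_goodClocks] with ω hω n using hω.rings_eq_iff z hτ n
  calc P {ω | rings W τ ω z = rings W (τ + δ) ω z}
      = P {ω | τ + δ < ringTime W z (rings W τ ω z + 1) ω} := by
        refine measure_congr ?_
        filter_upwards [h.ae_goodClocks] with ω hω
        have hle := (hω.mem_Ico_ringTime_rings z hτ).1
        refine propext ⟨fun heq => ?_, fun hlt => ?_⟩
        · exact ((hω.rings_eq_iff z (by positivity) _).1 heq.symm).2
        · exact (hω.rings_eq_of_mem_Ico ⟨by linarith, hlt⟩).symm
    _ = ∫⁻ _, ENNReal.ofReal (Real.exp (-δ)) ∂P := by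
        refine measure_setOf_mem_eq_lintegral hN hring (f := fun _ => _) fun n => ?_
        have hinter : P ({ω | τ + δ < ringTime W z (n + 1) ω} ∩ (fun ω => rings W τ ω z) ⁻¹' {n}) =
            P {ω | ringTime W z n ω ≤ τ ∧ τ + δ < ringTime W z (n + 1) ω} := by
          refine measure_congr ?_
          filter_upwards [hmem] with ω hω
          refine propext ⟨fun hr => ⟨((hω n).1 hr.2).1, hr.1⟩, fun hr => ⟨hr.2, ?_⟩⟩
          exact (hω n).2 ⟨hr.1, by linarith [hr.2]⟩
        have hfiber : P ((fun ω => rings W τ ω z) ⁻¹' {n}) =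
            P {ω | ringTime W z n ω ≤ τ ∧ τ < ringTime W z (n + 1) ω} :=
          measure_congr (by filter_upwards [hmem] with ω hω using propext (hω n))
        rw [hinter, hfiber, h.measure_ringTime_le_lt z n (by linarith : τ ≤ τ + δ),
          h.measure_ringTime_le_lt z n le_rfl, ← mul_assoc,
          ← ENNReal.ofReal_mul (Real.exp_pos _).le, ← Real.exp_add]
        ring_nf
    _ = ENNReal.ofReal (Real.exp (-δ)) := by simp

theorem measure_two_coins (h : IsWebNoise P W ε) (z : Site) (m n : ℕ) (b c : Bool) :
    P {ω | ε z m ω = b ∧ ε z n ω = c} = if m = n then (if b = c then 2⁻¹ else 0) else 4⁻¹ := by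
  split_ifs with hmn hbc
  · subst hmn hbc
    simpa using h.measure_coin z m b
  · subst hmn
    convert measure_empty (μ := P)
    exact Set.eq_empty_of_forall_notMem fun ω hω => hbc (hω.1.symm.trans hω.2)
  · have hdisj : Disjoint {p : NoiseIndex | p.1.2 = m} {p | p.1.2 = n} :=
      Set.disjoint_left.2 fun p hm hn => hmn (hm.symm.trans hn)
    have hmul := h.measure_inter_of_disjoint hdisj
      (noiseAlg_measurable_coin (z := z) (n := m) (by simp) (measurableSet_singleton b))
      (noiseAlg_measurable_coin (z := z) (n := n) (by simp) (measurableSet_singleton c))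
    refine hmul.trans ?_
    rw [show ε z m ⁻¹' {b} = {ω | ε z m ω = b} from rfl,
      show ε z n ⁻¹' {c} = {ω | ε z n ω = c} from rfl, h.measure_coin, h.measure_coin,
      ← ENNReal.mul_inv (by simp) (by simp)]
    norm_num

theorem measure_arrows_pair_eq_lintegral (h : IsWebNoise P W ε) (z : Site) (σ τ : ℝ) (b c : Bool) :
    P {ω | arrows W ε σ ω z = b ∧ arrows W ε τ ω z = c} =
      ∫⁻ ω, if rings W σ ω z = rings W τ ω z then (if b = c then 2⁻¹ else 0) else 4⁻¹ ∂P := by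
  have hrings : ∀ τ, Measurable[noiseAlg W ε {p | p.2 = true}] fun ω => rings W τ ω z :=
    noiseAlg_measurable_rings (by simp)
  have hX : Measurable[noiseAlg W ε {p | p.2 = true}]
      fun ω => (rings W σ ω z, rings W τ ω z) := (hrings σ).prodMk (hrings τ)
  have hcoins : ∀ q : ℕ × ℕ, MeasurableSet[noiseAlg W ε {p | p.2 = false}]
      {ω | ε z q.1 ω = b ∧ ε z q.2 ω = c} := fun q =>
    MeasurableSet.inter (noiseAlg_measurable_coin (by simp) (measurableSet_singleton b))
      (noiseAlg_measurable_coin (by simp) (measurableSet_singleton c))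
  have hdisj : Disjoint {p : NoiseIndex | p.2 = false} {p | p.2 = true} :=
    Set.disjoint_left.2 fun p hf ht => Bool.false_ne_true (hf.symm.trans ht)
  refine measure_setOf_mem_eq_lintegral (hX.mono (h.noiseAlg_le _) le_rfl)
    (fun q => h.noiseAlg_le _ _ (hcoins q)) (f := fun q => if q.1 = q.2 then _ else _) fun q => ?_
  rw [h.measure_inter_of_disjoint hdisj (hcoins q) (hX (measurableSet_singleton q)),
    h.measure_two_coins]

theorem measure_arrows_pair (h : IsWebNoise P W ε) (z : Site) {τ δ : ℝ} (hτ : 0 ≤ τ)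
    (hδ : 0 ≤ δ) (b c : Bool) :
    P.real {ω | arrows W ε τ ω z = b ∧ arrows W ε (τ + δ) ω z = c} =
      (1 + (if b = c then 1 else -1) * Real.exp (-δ)) / 4 := by
  classical
  set D : Set Ω := {ω | rings W τ ω z = rings W (τ + δ) ω z}
  have hrings : ∀ σ, Measurable fun ω => rings W σ ω z := fun σ =>
    (noiseAlg_measurable_rings (ε := ε) (S := Set.univ) (fun _ => trivial) σ).mono
      (h.noiseAlg_le _) le_rfl
  have hDm : MeasurableSet D := measurableSet_eq_fun (hrings τ) (hrings (τ + δ))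
  have hD : P.real D = Real.exp (-δ) := by
    rw [Measure.real, h.measure_rings_eq z hτ hδ, ENNReal.toReal_ofReal (Real.exp_pos _).le]
  have hE : P {ω | arrows W ε τ ω z = b ∧ arrows W ε (τ + δ) ω z = c} =
      (if b = c then 2⁻¹ else 0) * P D + 4⁻¹ * P Dᶜ := by
    rw [h.measure_arrows_pair_eq_lintegral, ← setLIntegral_const, ← setLIntegral_const,
      ← lintegral_piecewise hDm]
    rfl
  rw [Measure.real, hE, ENNReal.toReal_add (by split_ifs <;> finiteness) (by finiteness),
    ENNReal.toReal_mul, ENNReal.toReal_mul, ← Measure.real, ← Measure.real,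
    probReal_compl_eq_one_sub hDm, hD]
  split_ifs <;> simp <;> ring

theorem measure_arrows (h : IsWebNoise P W ε) (z : Site) {τ : ℝ} (hτ : 0 ≤ τ) (b : Bool) :
    P.real {ω | arrows W ε τ ω z = b} = 1 / 2 := by
  have hpair := h.measure_arrows_pair z hτ le_rfl b b
  simp only [add_zero, and_self, if_true, neg_zero, Real.exp_zero] at hpair
  rw [hpair]
  norm_num

end IsWebNoise

end Noise

/-! ### The walks of the web -/

/-- The endpoint of the arrow at `z` if that arrow has direction `b`. -/
def nbr (z : Site) (b : Bool) : Site := step (fun _ => b) z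

/-- The walk from `z` stays to the right of `lo` before the `n`-th step, and is to the right of `hi`
after the `n`-th step. -/
def Survives (a : Site → Bool) (lo hi : ℤ) : ℕ → Site → Prop
  | 0, z => hi < z.1.1
  | n + 1, z => lo < z.1.1 ∧ Survives a lo hi n (step a z)

/-- The sites with time coordinate in `[s, t)`. -/
def rows (s t : ℤ) : Set Site := {z | z.1.2 ∈ Set.Ico s t}

theorem nbr_fst (z : Site) (b : Bool) : (nbr z b).1.1 = z.1.1 + dir b := rfl

theorem nbr_snd (z : Site) (b : Bool) : (nbr z b).1.2 = z.1.2 + 1 := rfl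

theorem rows_disjoint {s t u v : ℤ} (h : t ≤ u) : Disjoint (rows s t) (rows u v) :=
  Set.disjoint_left.2 fun _ hst huv => (hst.2.trans_le (h.trans huv.1)).false

theorem rows_subset {s t u v : ℤ} (hsu : u ≤ s) (htv : t ≤ v) : rows s t ⊆ rows u v :=
  fun _ hz => ⟨hsu.trans hz.1, hz.2.trans_le htv⟩

theorem survives_succ {a : Site → Bool} {lo hi : ℤ} {n : ℕ} {z : Site} :
    Survives a lo hi (n + 1) z ↔ lo < z.1.1 ∧ Survives a lo hi n (nbr z (a z)) := Iff.rfl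

theorem survives_iff {a : Site → Bool} {lo hi : ℤ} (h : lo ≤ hi) (n : ℕ) (z : Site) :
    Survives a lo hi n z ↔ (∀ i ≤ n, lo < pos a z i) ∧ hi < pos a z n := by
  induction n generalizing z with
  | zero => simpa [Survives, pos] using h.trans_lt
  | succ n ih =>
    simp only [Survives, ih, ← Nat.lt_succ_iff, Nat.forall_lt_succ_left' (n := n + 1), and_assoc]
    rfl

theorem measurableSet_survives {α : Type*} [MeasurableSpace α] (A : α → Site → Bool) (lo hi : ℤ)
    (n : ℕ) (z : Site) (hA : ∀ y ∈ rows z.1.2 (z.1.2 + n), Measurable (A · y)) :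
    MeasurableSet {x | Survives (A x) lo hi n z} := by
  induction n generalizing z with
  | zero => exact MeasurableSet.const _
  | succ n ih =>
    have hcases : {x | Survives (A x) lo hi (n + 1) z} = {_x | lo < z.1.1} ∩
        ⋃ b : Bool, (A · z) ⁻¹' {b} ∩ {x | Survives (A x) lo hi n (nbr z b)} := by
      ext
      simp [survives_succ]
    rw [hcases]
    refine (MeasurableSet.const _).inter (MeasurableSet.iUnion fun b => ?_)
    refine (hA z ⟨le_rfl, by lia⟩ (measurableSet_singleton b)).inter (ih _ fun y hy => hA y ?_)
    rw [nbr_snd] at hy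
    exact ⟨by linarith [hy.1], by push_cast; linarith [hy.2]⟩

theorem pairSurvProb_one_self (h : ℤ) (n : ℕ) (x : ℤ) :
    pairSurvProb 1 h n x x = survProb h n x := by
  induction n generalizing x with
  | zero => simp [pairSurvProb, survProb]
  | succ n ih =>
    simp only [pairSurvProb, survProb, or_self, pairStep, ih, if_true]
    ring_nf

theorem measureReal_eq_sum_inter_preimage_singleton {α ι : Type*} [MeasurableSpace α] [Fintype ι]
    [MeasurableSpace ι] [MeasurableSingletonClass ι] {μ : Measure α} [IsFiniteMeasure μ]
    {X : α → ι} (hX : Measurable X) (A : Set α) : μ.real A = ∑ i, μ.real (X ⁻¹' {i} ∩ A) := by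
  have hfib : ∀ i, MeasurableSet (X ⁻¹' {i}) := fun i => hX (measurableSet_singleton i)
  simp_rw [← measureReal_restrict_apply (hfib _)]
  rw [sum_measureReal_preimage_singleton _ fun i _ => hfib i]
  simp

section

variable {Ω : Type*} {W : Site → ℕ → Ω → ℝ} {ε : Site → ℕ → Ω → Bool}

theorem siteAlg_measurableSet_survives {T : Set Site} {z : Site} {n : ℕ}
    (hT : rows z.1.2 (z.1.2 + n) ⊆ T) (τ : ℝ) (lo hi : ℤ) :
    MeasurableSet[siteAlg W ε T] {ω | Survives (arrows W ε τ ω) lo hi n z} := by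
  let _ : MeasurableSpace Ω := siteAlg W ε T
  exact measurableSet_survives _ lo hi n z fun _ hy => siteAlg_measurable_arrows (hT hy) τ

variable [mΩ : MeasurableSpace Ω] {P : Measure Ω} [IsProbabilityMeasure P]

namespace IsWebNoise

theorem measureReal_inter_of_disjoint_sites (h : IsWebNoise P W ε) {T T' : Set Site}
    (hT : Disjoint T T') {A B : Set Ω} (hA : MeasurableSet[siteAlg W ε T] A)
    (hB : MeasurableSet[siteAlg W ε T'] B) : P.real (A ∩ B) = P.real A * P.real B := by
  simp only [Measure.real, h.measure_inter_of_disjoint_sites hT hA hB, ENNReal.toReal_mul]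

theorem measure_arrows_pair_sites (h : IsWebNoise P W ε) (z y : Site) {τ δ : ℝ} (hτ : 0 ≤ τ)
    (hδ : 0 ≤ δ) (b c : Bool) :
    P.real {ω | arrows W ε τ ω z = b ∧ arrows W ε (τ + δ) ω y = c} =
      (1 + (if b = c then 1 else -1) * (if z = y then Real.exp (-δ) else 0)) / 4 := by
  by_cases hzy : z = y
  · subst hzy
    simpa using h.measure_arrows_pair z hτ hδ b c
  · have hmul := h.measureReal_inter_of_disjoint_sites (Set.disjoint_singleton.2 hzy)
      (siteAlg_measurable_arrows (Set.mem_singleton z) τ (measurableSet_singleton b))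
      (siteAlg_measurable_arrows (Set.mem_singleton y) (τ + δ) (measurableSet_singleton c))
    refine hmul.trans ?_
    rw [if_neg hzy]
    refine (congrArg₂ (· * ·) (h.measure_arrows z hτ b)
      (h.measure_arrows y (add_nonneg hτ hδ) c)).trans ?_
    norm_num

theorem measureReal_survives_inter_succ (h : IsWebNoise P W ε) {τ δ : ℝ} (hτ : 0 ≤ τ) (hδ : 0 ≤ δ)
    {lo : ℤ} (hi : ℤ) (n : ℕ) {z y : Site} (hzy : z.1.2 = y.1.2) (hz : lo < z.1.1)
    (hy : lo < y.1.1) :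
    P.real ({ω | Survives (arrows W ε τ ω) lo hi (n + 1) z} ∩
        {ω | Survives (arrows W ε (τ + δ) ω) lo hi (n + 1) y}) =
      ∑ b, ∑ c, (1 + (if b = c then 1 else -1) * (if z = y then Real.exp (-δ) else 0)) / 4 *
        P.real ({ω | Survives (arrows W ε τ ω) lo hi n (nbr z b)} ∩
          {ω | Survives (arrows W ε (τ + δ) ω) lo hi n (nbr y c)}) := by
  have harrow : ∀ (σ : ℝ) (x : Site), x.1.2 = y.1.2 →
      Measurable[siteAlg W ε (rows y.1.2 (y.1.2 + 1))] fun ω => arrows W ε σ ω x :=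
    fun σ x hx =>
      siteAlg_measurable_arrows (T := rows y.1.2 (y.1.2 + 1)) ⟨hx.ge, by lia⟩ σ
  have hX : Measurable[siteAlg W ε (rows y.1.2 (y.1.2 + 1))]
      fun ω => (arrows W ε τ ω z, arrows W ε (τ + δ) ω y) :=
    (harrow τ z hzy).prodMk (harrow (τ + δ) y rfl)
  have hsurv : ∀ (σ : ℝ) (x : Site) (b : Bool), x.1.2 = y.1.2 →
      MeasurableSet[siteAlg W ε (rows (y.1.2 + 1) (y.1.2 + 1 + n))]
        {ω | Survives (arrows W ε σ ω) lo hi n (nbr x b)} := fun σ x b hx =>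
    siteAlg_measurableSet_survives (by rw [nbr_snd, hx]) σ lo hi
  rw [measureReal_eq_sum_inter_preimage_singleton (hX.mono (h.siteAlg_le _) le_rfl),
    Fintype.sum_prod_type]
  refine Finset.sum_congr rfl fun b _ => Finset.sum_congr rfl fun c _ => ?_
  rw [← h.measure_arrows_pair_sites z y hτ hδ,
    ← h.measureReal_inter_of_disjoint_sites (rows_disjoint le_rfl)
      (A := {ω | arrows W ε τ ω z = b ∧ arrows W ε (τ + δ) ω y = c})
      ((harrow τ z hzy (measurableSet_singleton b)).inter
        (harrow (τ + δ) y rfl (measurableSet_singleton c)))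
      (MeasurableSet.inter (hsurv τ z b hzy) (hsurv (τ + δ) y c rfl))]
  congr 1
  ext ω
  simp only [survives_succ, Set.mem_inter_iff, Set.mem_preimage, Set.mem_singleton_iff,
    Prod.mk.injEq, Set.mem_ofPred_eq, hz, hy, true_and]
  exact and_congr_right fun harr => by rw [harr.1, harr.2]

theorem measureReal_survives_inter (h : IsWebNoise P W ε) {τ δ : ℝ} (hτ : 0 ≤ τ) (hδ : 0 ≤ δ)
    (lo hi : ℤ) (n : ℕ) (z y : Site) (hzy : z.1.2 = y.1.2) :
    P.real ({ω | Survives (arrows W ε τ ω) lo hi n z} ∩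
      {ω | Survives (arrows W ε (τ + δ) ω) lo hi n y}) =
      pairSurvProb (Real.exp (-δ)) (hi - lo) n (z.1.1 - lo) (y.1.1 - lo) := by
  induction n generalizing z y with
  | zero =>
    simp only [Survives, pairSurvProb, sub_lt_sub_iff_right]
    by_cases hz : hi < z.1.1 <;> by_cases hy : hi < y.1.1 <;> simp [hz, hy]
  | succ n ih =>
    simp only [pairSurvProb, sub_nonpos]
    split_ifs with hdead
    · convert measureReal_empty (μ := P)
      exact Set.eq_empty_of_forall_notMem fun ω hω =>
        hdead.elim hω.1.1.not_ge hω.2.1.not_ge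
    · push Not at hdead
      have heq : z.1.1 - lo = y.1.1 - lo ↔ z = y := by
        rw [sub_left_inj, Subtype.ext_iff, Prod.ext_iff]
        exact (and_iff_left hzy).symm
      rw [h.measureReal_survives_inter_succ hτ hδ hi n hzy hdead.1 hdead.2]
      simp only [fun b c => ih (nbr z b) (nbr y c) (congrArg (· + 1) hzy), nbr_fst, pairStep, heq,
        Fintype.sum_bool, dir, if_true, Bool.false_eq_true, reduceCtorEq, if_false]
      ring_nf

theorem measureReal_survives (h : IsWebNoise P W ε) {τ : ℝ} (hτ : 0 ≤ τ) (lo hi : ℤ) (n : ℕ)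
    (z : Site) :
    P.real {ω | Survives (arrows W ε τ ω) lo hi n z} = survProb (hi - lo) n (z.1.1 - lo) := by
  have hpair := h.measureReal_survives_inter hτ le_rfl lo hi n z z rfl
  rwa [add_zero, Set.inter_self, neg_zero, Real.exp_zero, pairSurvProb_one_self] at hpair

end IsWebNoise

end

/-! ### Geometry of the paths -/

theorem iterate_step_snd (a : Site → Bool) (z : Site) (n : ℕ) :
    ((step a)^[n] z).1.2 = z.1.2 + n := by
  induction n with
  | zero => simp
  | succ n ih =>
    rw [Function.iterate_succ_apply', Nat.cast_succ, ← add_assoc, ← ih]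
    rfl

theorem pos_add (a : Site → Bool) (z : Site) (m n : ℕ) :
    pos a z (m + n) = pos a ((step a)^[m] z) n := by
  rw [pos, pos, add_comm, Function.iterate_add_apply]

theorem pos_succ (a : Site → Bool) (z : Site) (n : ℕ) :
    pos a z (n + 1) = pos a z n + dir (a ((step a)^[n] z)) := by
  rw [pos, pos, Function.iterate_succ_apply', step]

theorem abs_dir (b : Bool) : |dir b| = 1 := by
  cases b <;> rfl

theorem abs_pos_sub_le (a : Site → Bool) (z : Site) (n : ℕ) : |pos a z n - z.1.1| ≤ n := by
  induction n with
  | zero => simp [pos]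
  | succ n ih =>
    rw [pos_succ, add_sub_right_comm, Nat.cast_succ, ← abs_dir (a ((step a)^[n] z))]
    exact (abs_add_le _ _).trans (by gcongr)

/-- Paths do not cross because two sites with the same time coordinate have abscissae of the same
parity. -/
theorem pos_mono (a : Site → Bool) {z y : Site} (ht : z.1.2 = y.1.2) (hx : z.1.1 ≤ y.1.1) (n : ℕ) :
    pos a z n ≤ pos a y n := by
  induction n with
  | zero => exact hx
  | succ n ih =>
    have htime : ((step a)^[n] z).1.2 = ((step a)^[n] y).1.2 := by
      rw [iterate_step_snd, iterate_step_snd, ht]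
    rw [pos_succ, pos_succ]
    rcases ih.eq_or_lt with heq | hlt
    · rw [heq, (Subtype.ext (Prod.ext heq htime) : (step a)^[n] z = (step a)^[n] y)]
    · have hgap : pos a z n + 2 ≤ pos a y n := by
        obtain ⟨r, hr⟩ := ((step a)^[n] z).2
        obtain ⟨s, hs⟩ := ((step a)^[n] y).2
        simp only [pos] at hlt ⊢
        lia
      have hz := (abs_le.1 (abs_dir (a ((step a)^[n] z))).le).2
      have hy := (abs_le.1 (abs_dir (a ((step a)^[n] y))).le).1
      linarith

theorem path_add (a : Site → Bool) (z : Site) (s : ℝ) :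
    path a z (z.1.2 + s) =
      (1 - (s - ⌊s⌋₊)) * pos a z ⌊s⌋₊ + (s - ⌊s⌋₊) * pos a z (⌊s⌋₊ + 1) := by
  simp only [path, add_sub_cancel_left]
  ring

theorem path_add_natCast (a : Site → Bool) (z : Site) (n : ℕ) :
    path a z (z.1.2 + n) = pos a z n := by
  simp [path_add]

theorem le_path_of_convexOn {a : Site → Bool} {z : Site} {f : ℝ → ℝ}
    (hf : ConvexOn ℝ (Set.Ici 0) f) {s : ℝ} (hs : 0 ≤ s)
    (h : ∀ n ≤ ⌈s⌉₊, f n ≤ pos a z n) : f s ≤ path a z (z.1.2 + s) := by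
  have hfloor := Nat.floor_le hs
  rcases hfloor.eq_or_lt with heq | hlt
  · rw [← heq, path_add_natCast]
    exact h _ (Nat.floor_le_ceil s)
  · have hceil : ⌊s⌋₊ + 1 ≤ ⌈s⌉₊ := Nat.lt_ceil.2 hlt
    have hnext := (Nat.lt_floor_add_one s).le
    have hconv := hf.2 (x := ⌊s⌋₊) (y := (⌊s⌋₊ + 1 : ℕ)) (Set.mem_Ici.2 (Nat.cast_nonneg _))
      (Set.mem_Ici.2 (Nat.cast_nonneg _))
      (show 0 ≤ 1 - (s - ⌊s⌋₊) by linarith) (sub_nonneg.2 hfloor) (by ring)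
    have hcomb : (1 - (s - ⌊s⌋₊)) * (⌊s⌋₊ : ℝ) + (s - ⌊s⌋₊) * ((⌊s⌋₊ + 1 : ℕ) : ℝ) = s := by
      push_cast
      ring
    simp only [smul_eq_mul, hcomb] at hconv
    rw [path_add]
    refine hconv.trans (add_le_add ?_ ?_)
    · exact mul_le_mul_of_nonneg_left (h _ (Nat.floor_le_ceil s)) (by linarith)
    · exact mul_le_mul_of_nonneg_left (h _ hceil) (by linarith)

/-! ### The boxes -/

theorem two_le_boxSize {γ : ℝ} (hγ : 0 ≤ γ) (k : ℕ) : 2 ≤ boxSize γ k := by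
  have : 0 ≤ ⌊γ ^ k / 2⌋ := Int.floor_nonneg.2 (by positivity)
  rw [boxSize]
  lia

theorem natCast_toNat_boxSize {γ : ℝ} (hγ : 0 ≤ γ) (k : ℕ) :
    ((boxSize γ k).toNat : ℤ) = boxSize γ k :=
  Int.toNat_of_nonneg (zero_le_two.trans (two_le_boxSize hγ k))

theorem pow_lt_boxSize (γ : ℝ) (k : ℕ) : γ ^ k < boxSize γ k := by
  have := Int.lt_floor_add_one (γ ^ k / 2)
  rw [boxSize]
  push_cast
  linarith

theorem boxSize_le_pow_add_two (γ : ℝ) (k : ℕ) : boxSize γ k ≤ γ ^ k + 2 := by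
  have := Int.floor_le (γ ^ k / 2)
  rw [boxSize]
  push_cast
  linarith

theorem boxX_succ (γ : ℝ) (k : ℕ) : boxX γ (k + 1) = boxX γ k + boxSize γ k :=
  Finset.sum_range_succ _ _

theorem boxT_succ {γ : ℝ} (hγ : 0 ≤ γ) (k : ℕ) :
    boxT γ (k + 1) = boxT γ k + ((boxSize γ k).toNat ^ 2 : ℕ) := by
  rw [Nat.cast_pow, natCast_toNat_boxSize hγ]
  exact Finset.sum_range_succ _ _

theorem boxX_nonneg {γ : ℝ} (hγ : 0 ≤ γ) (k : ℕ) : 0 ≤ boxX γ k :=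
  Finset.sum_nonneg fun i _ => zero_le_two.trans (two_le_boxSize hγ i)

theorem natCast_le_boxT {γ : ℝ} (hγ : 0 ≤ γ) (k : ℕ) : (k : ℤ) ≤ boxT γ k := by
  simpa [boxT] using Finset.card_nsmul_le_sum (Finset.range k) (boxSize γ · ^ 2) 1 fun i _ =>
    one_le_pow₀ (one_le_two.trans (two_le_boxSize hγ i))

theorem pow_sub_one_le_boxX {γ : ℝ} (hγ : 1 ≤ γ) (k : ℕ) : γ ^ k - 1 ≤ (γ - 1) * boxX γ k := by
  rw [← mul_geom_sum, boxX, Int.cast_sum]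
  have : 0 ≤ γ - 1 := sub_nonneg.2 hγ
  gcongr
  exact (pow_lt_boxSize γ _).le

theorem sq_pow_sub_one_le_boxT {γ : ℝ} (hγ : 1 ≤ γ) (k : ℕ) :
    (γ ^ k) ^ 2 - 1 ≤ (γ ^ 2 - 1) * boxT γ k := by
  rw [pow_right_comm, ← mul_geom_sum, boxT, Int.cast_sum]
  have : 0 ≤ γ ^ 2 - 1 := sub_nonneg.2 (one_le_pow₀ hγ)
  gcongr with i
  rw [pow_right_comm, Int.cast_pow]
  gcongr
  exact (pow_lt_boxSize γ _).le

/-- The event `A_k` for the arrow configuration `a`, in terms of the positions of the walk at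
integer times only. -/
def BoxSurvives (γ : ℝ) (k : ℕ) (a : Site → Bool) : Prop :=
  Survives a (boxX γ k - boxSize γ k) (boxX γ (k + 1)) ((boxSize γ k).toNat ^ 2) (boxBase γ k)

theorem boxSurvives_iff {γ : ℝ} (hγ : 0 ≤ γ) (k : ℕ) (a : Site → Bool) :
    BoxSurvives γ k a ↔
      (∀ i ≤ (boxSize γ k).toNat ^ 2, boxX γ k - boxSize γ k < pos a (boxBase γ k) i) ∧
        boxX γ (k + 1) < pos a (boxBase γ k) ((boxSize γ k).toNat ^ 2) := by
  refine survives_iff ?_ _ _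
  have := two_le_boxSize hγ k
  rw [boxX_succ]
  lia

theorem mem_boxEvent_iff {Ω : Type*} (W : Site → ℕ → Ω → ℝ) (ε : Site → ℕ → Ω → Bool) {γ : ℝ}
    (hγ : 0 ≤ γ) (k : ℕ) (τ : ℝ) (ω : Ω) :
    ω ∈ boxEvent W ε γ k τ ↔ BoxSurvives γ k (arrows W ε τ ω) := by
  have htop : (boxT γ (k + 1) : ℝ) =
      ((boxBase γ k).1.2 : ℝ) + ((boxSize γ k).toNat ^ 2 : ℕ) := by
    rw [boxT_succ hγ, Int.cast_add, Int.cast_natCast]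
    rfl
  rw [boxSurvives_iff hγ, boxEvent, Set.mem_ofPred_eq, htop, path_add_natCast, Int.cast_lt,
    and_congr_left_iff]
  rintro -
  constructor
  · intro h i hi
    have hi' := h ((boxBase γ k).1.2 + i) ⟨le_add_of_nonneg_right i.cast_nonneg, by gcongr⟩
    rw [path_add_natCast] at hi'
    exact_mod_cast hi'
  · intro h t ht
    obtain ⟨s, rfl⟩ : ∃ s, t = (boxBase γ k).1.2 + s := ⟨t - (boxBase γ k).1.2, by ring⟩
    have hs : 0 ≤ s := nonneg_of_le_add_right ht.1
    refine (lt_add_one _).trans_le (le_path_of_convexOn (convexOn_const _ (convex_Ici 0)) hs ?_)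
    intro i hi
    exact_mod_cast h i (hi.trans (Nat.ceil_le.2 ((add_le_add_iff_left _).1 ht.2)))

/-! ### The boxes lie to the right of the moving boundary -/

theorem sub_one_mul_kOf {γ : ℝ} (hγ : 1 < γ) : (γ - 1) * kOf γ = (γ - 2) * √(γ ^ 2 - 1) := by
  have hpos : 0 < γ - 1 := sub_pos.2 hγ
  have hsq : γ ^ 2 - 1 = (γ - 1) ^ 2 * ((γ + 1) / (γ - 1)) := by
    field_simp
    ring
  rw [kOf, hsq, Real.sqrt_mul (sq_nonneg _), Real.sqrt_sq hpos.le]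
  ring

theorem boxSize_sub_boxX_le {γ : ℝ} (hγ : 4 ≤ γ) (k : ℕ) :
    boxSize γ k - boxX γ k ≤ kOf γ * √(boxT γ k + boxSize γ k) := by
  have hγ1 : 0 < γ - 1 := by linarith
  have hd₂ : (2 : ℝ) ≤ boxSize γ k := by exact_mod_cast two_le_boxSize (by linarith) k
  have hd := (pow_lt_boxSize γ k).le
  have hsq : (15 : ℝ) ≤ γ ^ 2 - 1 := by nlinarith
  have hsqrt : γ ^ k + 7 / 2 ≤ √((γ ^ 2 - 1) * (boxT γ k + boxSize γ k)) := by
    refine Real.le_sqrt_of_sq_le ?_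
    have hT := sq_pow_sub_one_le_boxT (show 1 ≤ γ by linarith) k
    have hmul := mul_le_mul_of_nonneg_right hsq (show (0 : ℝ) ≤ boxSize γ k by linarith)
    linarith
  refine le_of_mul_le_mul_left ?_ hγ1
  calc (γ - 1) * (boxSize γ k - boxX γ k)
      ≤ (γ - 1) * (γ ^ k + 2) - (γ ^ k - 1) := by
        rw [mul_sub]
        gcongr
        · exact boxSize_le_pow_add_two γ k
        · exact pow_sub_one_le_boxX (by linarith) k
    _ ≤ (γ - 2) * (γ ^ k + 7 / 2) := by linarith
    _ ≤ (γ - 2) * √((γ ^ 2 - 1) * (boxT γ k + boxSize γ k)) := by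
        gcongr
        linarith
    _ = (γ - 1) * (kOf γ * √(boxT γ k + boxSize γ k)) := by
        rw [Real.sqrt_mul (by linarith), ← mul_assoc, ← mul_assoc,
          sub_one_mul_kOf (by linarith)]

theorem kOf_nonneg {γ : ℝ} (hγ : 2 ≤ γ) : 0 ≤ kOf γ :=
  mul_nonneg (sub_nonneg.2 hγ) (Real.sqrt_nonneg _)

theorem min_sub_boxX_le {γ : ℝ} (hγ : 4 ≤ γ) (k : ℕ) {s : ℝ} (hs : 0 ≤ s) :
    min s (boxSize γ k) - boxX γ k ≤ kOf γ * √(boxT γ k + s) := by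
  have hγ₀ : 0 ≤ γ := by linarith
  have hd : (0 : ℝ) < boxSize γ k := by
    exact_mod_cast zero_lt_two.trans_le (two_le_boxSize hγ₀ k)
  have hX : (0 : ℝ) ≤ boxX γ k := by exact_mod_cast boxX_nonneg hγ₀ k
  have hT : (0 : ℝ) ≤ boxT γ k := by
    exact_mod_cast (Nat.cast_nonneg k).trans (natCast_le_boxT hγ₀ k)
  set θ : ℝ := min s (boxSize γ k) / boxSize γ k
  have hθ₀ : 0 ≤ θ := div_nonneg (le_min hs hd.le) hd.le
  have hθ₁ : θ ≤ 1 := (div_le_one hd).2 (min_le_right _ _)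
  have hmin : min s (boxSize γ k) = θ * boxSize γ k := (div_mul_cancel₀ _ hd.ne').symm
  have hsqrt : θ * √(boxT γ k + boxSize γ k) ≤ √(boxT γ k + s) := by
    refine Real.le_sqrt_of_sq_le ?_
    rw [mul_pow, Real.sq_sqrt (by positivity)]
    have hs' : θ * boxSize γ k ≤ s := hmin ▸ min_le_left _ _
    nlinarith [mul_le_of_le_one_left hθ₀ hθ₁, mul_nonneg hθ₀ hT]
  calc min s (boxSize γ k) - boxX γ k ≤ θ * (boxSize γ k - boxX γ k) := by
        rw [hmin, mul_sub]
        linarith [mul_le_of_le_one_left hX hθ₁]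
    _ ≤ θ * (kOf γ * √(boxT γ k + boxSize γ k)) := by
        gcongr
        exact boxSize_sub_boxX_le hγ k
    _ = kOf γ * (θ * √(boxT γ k + boxSize γ k)) := by ring
    _ ≤ kOf γ * √(boxT γ k + s) := by
        gcongr
        exact kOf_nonneg (by linarith)

section

variable {γ : ℝ} {a : Site → Bool}

theorem boxBase_snd_eq_iterate (hγ : 0 ≤ γ) (a : Site → Bool) (k : ℕ) :
    (boxBase γ k).1.2 = ((step a)^[(boxT γ k).toNat] origin).1.2 := by
  rw [iterate_step_snd, Int.toNat_of_nonneg ((Nat.cast_nonneg k).trans (natCast_le_boxT hγ k))]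
  exact (zero_add _).symm

theorem toNat_boxT_succ (hγ : 0 ≤ γ) (k : ℕ) :
    (boxT γ (k + 1)).toNat = (boxT γ k).toNat + (boxSize γ k).toNat ^ 2 := by
  have := natCast_le_boxT hγ k
  rw [boxT_succ hγ]
  lia

theorem boxX_le_pos (hγ : 0 ≤ γ) (h : ∀ k, BoxSurvives γ k a) (k : ℕ) :
    boxX γ k ≤ pos a origin (boxT γ k).toNat := by
  induction k with
  | zero => simp [boxX, boxT, pos, origin]
  | succ k ih =>
    rw [toNat_boxT_succ hγ, pos_add]
    exact ((boxSurvives_iff hγ k a).1 (h k)).2.le.trans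
      (pos_mono a (boxBase_snd_eq_iterate hγ a k) ih _)

theorem neg_kOf_mul_sqrt_le_pos_add (hγ : 4 ≤ γ) (h : ∀ k, BoxSurvives γ k a) (k : ℕ) {i : ℕ}
    (hi : i ≤ (boxSize γ k).toNat ^ 2) :
    -kOf γ * √((boxT γ k).toNat + i : ℕ) ≤ pos a origin ((boxT γ k).toNat + i) := by
  have hγ₀ : 0 ≤ γ := by linarith
  set y := (step a)^[(boxT γ k).toNat] origin
  have hy : boxX γ k ≤ y.1.1 := boxX_le_pos hγ₀ h k
  have hslow : boxX γ k - i ≤ pos a y i := by linarith [(abs_le.1 (abs_pos_sub_le a y i)).1]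
  have hbox : boxX γ k - boxSize γ k ≤ pos a y i :=
    (((boxSurvives_iff hγ₀ k a).1 (h k)).1 i hi).le.trans
      (pos_mono a (boxBase_snd_eq_iterate hγ₀ a k) hy i)
  have hmin : (boxX γ k : ℝ) - min (i : ℝ) (boxSize γ k) ≤ pos a y i := by
    rw [sub_le_comm, le_min_iff, sub_le_comm, sub_le_comm (c := (boxSize γ k : ℝ))]
    exact ⟨by exact_mod_cast hslow, by exact_mod_cast hbox⟩
  have hT : (((boxT γ k).toNat : ℕ) : ℝ) = boxT γ k := by
    exact_mod_cast Int.toNat_of_nonneg ((Nat.cast_nonneg k).trans (natCast_le_boxT hγ₀ k))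
  rw [pos_add, Nat.cast_add, hT]
  linarith [min_sub_boxX_le hγ k (Nat.cast_nonneg (α := ℝ) i)]

theorem neg_kOf_mul_sqrt_le_pos (hγ : 4 ≤ γ) (h : ∀ k, BoxSurvives γ k a) (n : ℕ) :
    -kOf γ * √n ≤ pos a origin n := by
  have hγ₀ : 0 ≤ γ := by linarith
  have hbefore : ∀ k m : ℕ, m ≤ (boxT γ k).toNat → -kOf γ * √m ≤ pos a origin m := by
    intro k
    induction k with
    | zero =>
      intro m hm
      obtain rfl : m = 0 := by simpa [boxT] using hm
      simp [pos, origin]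
    | succ k ih =>
      intro m hm
      rcases le_total m (boxT γ k).toNat with hle | hle
      · exact ih m hle
      · obtain ⟨i, rfl⟩ := Nat.exists_eq_add_of_le hle
        rw [toNat_boxT_succ hγ₀] at hm
        exact neg_kOf_mul_sqrt_le_pos_add hγ h k (Nat.le_of_add_le_add_left hm)
  exact hbefore n n ((Int.le_toNat ((Nat.cast_nonneg n).trans (natCast_le_boxT hγ₀ n))).2
    (natCast_le_boxT hγ₀ n))

theorem neg_kOf_mul_sqrt_le_path (hγ : 4 ≤ γ) (h : ∀ k, BoxSurvives γ k a) {t : ℝ} (ht : 0 ≤ t) :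
    -kOf γ * √t ≤ path a origin t := by
  have hconv : ConvexOn ℝ (Set.Ici 0) fun s : ℝ => -kOf γ * √s := by
    simp_rw [neg_mul]
    exact (Real.strictConcaveOn_sqrt.concaveOn.smul (kOf_nonneg (by linarith))).neg
  have hpath := le_path_of_convexOn (z := origin) hconv ht fun n _ =>
    neg_kOf_mul_sqrt_le_pos hγ h n
  rwa [show (origin.1.2 : ℝ) = 0 from Int.cast_zero, zero_add] at hpath

end

/-! ### The energy method -/

theorem le_mul_sq_mul_inv_add_div (x : ℝ≥0∞) {δ θ : ℝ≥0∞} (hδ : δ ≠ 0) (hδ' : δ ≠ ⊤) (hθ : θ ≠ 0)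
    (hθ' : θ ≠ ⊤) : x ≤ θ * (x ^ 2 * δ⁻¹) + δ / θ := by
  rcases le_or_gt x (δ / θ) with hle | hlt
  · exact hle.trans le_add_self
  · have hone : 1 ≤ x * θ * δ⁻¹ := by
      rw [← ENNReal.mul_inv_cancel hδ hδ']
      gcongr
      exact (ENNReal.div_le_iff hθ hθ').1 hlt.le
    calc x = x * 1 := (mul_one x).symm
      _ ≤ x * (x * θ * δ⁻¹) := by gcongr
      _ = θ * (x ^ 2 * δ⁻¹) := by ring
      _ ≤ θ * (x ^ 2 * δ⁻¹) + δ / θ := le_self_add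

section

variable {X : Type*} [EMetricSpace X]

theorem exists_isOpen_ediam_rpow_le_add {s : ℝ} (hs : 0 ≤ s) {t : Set X}
    (ht : Metric.ediam t ≠ ⊤) {e : ℝ≥0∞} (he : 0 < e) :
    ∃ V, IsOpen V ∧ t ⊆ V ∧ Metric.ediam V ≠ ⊤ ∧
      Metric.ediam V ^ s ≤ Metric.ediam t ^ s + e := by
  have hcont : Continuous fun δ : NNReal => (Metric.ediam t + 2 * (δ : ℝ≥0∞)) ^ s :=
    ENNReal.continuous_rpow_const.comp (continuous_const.add
      ((ENNReal.continuous_const_mul (by simp)).comp ENNReal.continuous_coe))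
  have hlt : (Metric.ediam t + 2 * ((0 : NNReal) : ℝ≥0∞)) ^ s < Metric.ediam t ^ s + e := by
    simpa using ENNReal.lt_add_right (ENNReal.rpow_ne_top_of_nonneg hs ht) he.ne'
  have hev := (hcont.tendsto 0).mono_left (nhdsWithin_le_nhds (s := Set.Ioi 0))
    |>.eventually (gt_mem_nhds hlt)
  obtain ⟨δ, hδ, hδ₀⟩ := (hev.and self_mem_nhdsWithin).exists
  have hV := Metric.ediam_thickening_le (s := t) δ
  refine ⟨Metric.thickening δ t, Metric.isOpen_thickening,
    Metric.self_subset_thickening (by exact_mod_cast hδ₀) t, (hV.trans_lt ?_).ne,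
    (ENNReal.rpow_le_rpow hV hs).trans hδ.le⟩
  exact ENNReal.add_lt_top.2 ⟨ht.lt_top, ENNReal.mul_lt_top (by simp) (by simp)⟩

theorem dimH_iInter_closure_le {E : ℕ → Set X} (hE : ∀ n, (closure (E n) \ E n).Countable) :
    dimH (⋂ n, closure (E n)) ≤ dimH (⋂ n, E n) := by
  have hsub : ⋂ n, closure (E n) ⊆ (⋂ n, E n) ∪ ⋃ n, (closure (E n) \ E n) := by
    intro x hx
    by_cases hxE : ∀ n, x ∈ E n
    · exact Or.inl (Set.mem_iInter.2 hxE)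
    · push Not at hxE
      obtain ⟨n, hn⟩ := hxE
      exact Or.inr (Set.mem_iUnion.2 ⟨n, Set.mem_iInter.1 hx n, hn⟩)
  refine (dimH_mono hsub).trans_eq ?_
  rw [dimH_union, dimH_countable (Set.countable_iUnion hE), max_eq_left zero_le]

variable [MeasurableSpace X]

/-- The `s`-energy of a measure, whose finiteness bounds from below the Hausdorff dimension of the
sets that the measure charges. -/
def energy (s : ℝ) (μ : Measure X) : ℝ≥0∞ := ∫⁻ x, ∫⁻ y, edist x y ^ (-s) ∂μ ∂μ

variable {s : ℝ} {μ : Measure X}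

theorem tsum_sq_measure_mul_inv_le_energy (hs : 0 ≤ s) {D : ℕ → Set X}
    (hDm : ∀ n, MeasurableSet (D n)) (hD : Pairwise (Function.onFun Disjoint D)) :
    ∑' n, μ (D n) ^ 2 * (Metric.ediam (D n) ^ s)⁻¹ ≤ energy s μ := by
  have hpot : ∀ n, ∀ x ∈ D n,
      (Metric.ediam (D n) ^ s)⁻¹ * μ (D n) ≤ ∫⁻ y, edist x y ^ (-s) ∂μ := fun n x hx =>
    calc (Metric.ediam (D n) ^ s)⁻¹ * μ (D n)
        = ∫⁻ _ in D n, (Metric.ediam (D n) ^ s)⁻¹ ∂μ := (setLIntegral_const _ _).symm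
      _ ≤ ∫⁻ y in D n, edist x y ^ (-s) ∂μ := by
        refine setLIntegral_mono' (hDm n) fun y hy => ?_
        rw [ENNReal.rpow_neg]
        gcongr
        exact Metric.edist_le_ediam_of_mem hx hy
      _ ≤ ∫⁻ y, edist x y ^ (-s) ∂μ := setLIntegral_le_lintegral _ _
  calc ∑' n, μ (D n) ^ 2 * (Metric.ediam (D n) ^ s)⁻¹
      = ∑' n, ∫⁻ _ in D n, (Metric.ediam (D n) ^ s)⁻¹ * μ (D n) ∂μ :=
        tsum_congr fun n => by rw [setLIntegral_const]; ring
    _ ≤ ∑' n, ∫⁻ x in D n, ∫⁻ y, edist x y ^ (-s) ∂μ ∂μ :=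
        ENNReal.tsum_le_tsum fun n => setLIntegral_mono' (hDm n) (hpot n)
    _ = ∫⁻ x in ⋃ n, D n, ∫⁻ y, edist x y ^ (-s) ∂μ ∂μ := (lintegral_iUnion hDm hD _).symm
    _ ≤ energy s μ := setLIntegral_le_lintegral _ _

theorem measure_le_mul_energy_add [NullSingletonClass μ] (hs : 0 ≤ s) {E : Set X} {U : ℕ → Set X}
    (hU : ∀ n, MeasurableSet (U n)) (hEU : E ⊆ ⋃ n, U n) (hUd : ∀ n, Metric.ediam (U n) ≠ ⊤)
    {θ : ℝ≥0∞} (hθ : θ ≠ 0) (hθ' : θ ≠ ⊤) :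
    μ E ≤ θ * energy s μ + (∑' n, Metric.ediam (U n) ^ s) / θ := by
  set D : ℕ → Set X := disjointed U
  have hDU : ∀ n, Metric.ediam (D n) ≤ Metric.ediam (U n) := fun n =>
    Metric.ediam_mono (disjointed_subset U n)
  have hpiece : ∀ n, μ (D n) ≤
      θ * (μ (D n) ^ 2 * (Metric.ediam (D n) ^ s)⁻¹) + Metric.ediam (D n) ^ s / θ := by
    intro n
    by_cases hzero : Metric.ediam (D n) = 0
    · simp [(Metric.ediam_eq_zero_iff.1 hzero).measure_zero μ]
    · have hfin : Metric.ediam (D n) ≠ ⊤ := ((hDU n).trans_lt (hUd n).lt_top).ne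
      exact le_mul_sq_mul_inv_add_div _ (by simp [ENNReal.rpow_eq_zero_iff, hzero, hfin])
        (ENNReal.rpow_ne_top_of_nonneg hs hfin) hθ hθ'
  calc μ E ≤ μ (⋃ n, D n) := measure_mono (by rwa [iUnion_disjointed])
    _ ≤ ∑' n, μ (D n) := measure_iUnion_le D
    _ ≤ ∑' n, (θ * (μ (D n) ^ 2 * (Metric.ediam (D n) ^ s)⁻¹) + Metric.ediam (D n) ^ s / θ) :=
        ENNReal.tsum_le_tsum hpiece
    _ = θ * ∑' n, μ (D n) ^ 2 * (Metric.ediam (D n) ^ s)⁻¹ +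
          (∑' n, Metric.ediam (D n) ^ s) / θ := by
        simp only [ENNReal.tsum_add, ENNReal.tsum_mul_left, div_eq_mul_inv, ENNReal.tsum_mul_right]
    _ ≤ θ * energy s μ + (∑' n, Metric.ediam (U n) ^ s) / θ := by
        gcongr
        · exact tsum_sq_measure_mul_inv_le_energy hs (fun n => .disjointed hU n)
            (disjoint_disjointed U)
        · exact disjointed_subset U _

variable [BorelSpace X]

theorem exists_cover_tsum_ediam_rpow_lt {C : Set X} (hs : 0 < s)
    (hC : Measure.hausdorffMeasure s C = 0) {η : ℝ≥0∞} (hη : 0 < η) :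
    ∃ t : ℕ → Set X, C ⊆ ⋃ n, t n ∧ (∀ n, Metric.ediam (t n) ≠ ⊤) ∧
      ∑' n, Metric.ediam (t n) ^ s < η := by
  have hinf : (⨅ (t : ℕ → Set X) (_ : C ⊆ ⋃ n, t n) (_ : ∀ n, Metric.ediam (t n) ≤ 1),
      ∑' n, ⨆ _ : (t n).Nonempty, Metric.ediam (t n) ^ s) < η := by
    refine lt_of_le_of_lt ?_ hη
    rw [← hC, Measure.hausdorffMeasure_apply]
    exact le_iSup₂ (f := fun (r : ℝ≥0∞) (_ : 0 < r) =>
      ⨅ (t : ℕ → Set X) (_ : C ⊆ ⋃ n, t n) (_ : ∀ n, Metric.ediam (t n) ≤ r),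
        ∑' n, ⨆ _ : (t n).Nonempty, Metric.ediam (t n) ^ s) 1 one_pos
  simp only [iInf_lt_iff] at hinf
  obtain ⟨t, ht, htd, hsum⟩ := hinf
  refine ⟨t, ht, fun n => ((htd n).trans_lt ENNReal.one_lt_top).ne, lt_of_eq_of_lt ?_ hsum⟩
  refine tsum_congr fun n => ?_
  rcases (t n).eq_empty_or_nonempty with hempty | hne
  · simp [hempty, ENNReal.zero_rpow_of_pos hs]
  · simp [hne]

theorem exists_isOpen_cover_tsum_ediam_rpow_le {C : Set X} (hs : 0 < s)
    (hC : Measure.hausdorffMeasure s C = 0) {η : ℝ≥0∞} (hη : 0 < η) :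
    ∃ U : ℕ → Set X, (∀ n, IsOpen (U n)) ∧ C ⊆ ⋃ n, U n ∧ (∀ n, Metric.ediam (U n) ≠ ⊤) ∧
      ∑' n, Metric.ediam (U n) ^ s ≤ η := by
  have hη2 : 0 < η / 2 := ENNReal.half_pos hη.ne'
  obtain ⟨t, ht, htd, hsum⟩ := exists_cover_tsum_ediam_rpow_lt hs hC hη2
  obtain ⟨e, he, hesum⟩ := ENNReal.exists_pos_sum_of_countable' hη2.ne' ℕ
  choose V hVo htV hVd hVs using fun n => exists_isOpen_ediam_rpow_le_add hs.le (htd n) (he n)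
  refine ⟨V, hVo, ht.trans (Set.iUnion_mono htV), hVd, ?_⟩
  calc ∑' n, Metric.ediam (V n) ^ s
      ≤ ∑' n, (Metric.ediam (t n) ^ s + e n) := ENNReal.tsum_le_tsum hVs
    _ = ∑' n, Metric.ediam (t n) ^ s + ∑' n, e n := ENNReal.tsum_add
    _ ≤ η / 2 + η / 2 := by gcongr
    _ = η := ENNReal.add_halves η

theorem hausdorffMeasure_iInter_ne_zero_of_energy_le (hs : 0 < s) {C : ℕ → Set X}
    (hanti : Antitone C) (hC : ∀ n, IsCompact (C n)) {ν : ℕ → Measure X}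
    [∀ n, NullSingletonClass (ν n)] {a M : ℝ≥0∞} (ha : a ≠ 0) (hM : M ≠ ⊤)
    (h : ∃ᶠ n in atTop, a ≤ ν n (C n) ∧ energy s (ν n) ≤ M) :
    Measure.hausdorffMeasure s (⋂ n, C n) ≠ 0 := by
  intro hnull
  obtain ⟨θ, hθ₀, hθ⟩ := ENNReal.exists_nnreal_pos_mul_lt (b := a) (a := M + 1)
    (by simpa using hM) ha
  have hθ_ne : (θ : ℝ≥0∞) ≠ 0 := by exact_mod_cast hθ₀.ne'
  obtain ⟨U, hUo, hCU, hUd, hUs⟩ := exists_isOpen_cover_tsum_ediam_rpow_le hs hnull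
    (η := θ * θ) (pos_iff_ne_zero.2 (mul_ne_zero hθ_ne hθ_ne))
  obtain ⟨i, hi⟩ := exists_subset_nhds_of_isCompact hanti.directed_ge hC
    fun x hx => (isOpen_iUnion hUo).mem_nhds (hCU hx)
  obtain ⟨n, hn, hmass, henergy⟩ := frequently_atTop.1 h i
  refine hθ.not_ge ?_
  calc a ≤ ν n (C n) := hmass
    _ ≤ θ * energy s (ν n) + (∑' n, Metric.ediam (U n) ^ s) / θ :=
        measure_le_mul_energy_add hs.le (fun n => (hUo n).measurableSet)
          ((hanti hn).trans hi) hUd hθ_ne ENNReal.coe_ne_top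
    _ ≤ θ * M + θ := by
        gcongr
        exact ENNReal.div_le_of_le_mul hUs
    _ = θ * (M + 1) := by ring

theorem ofReal_le_dimH_iInter_of_energy_le (hs : 0 < s) {E : ℕ → Set X} (hanti : Antitone E)
    (hcomp : ∀ n, IsCompact (closure (E n))) (hcl : ∀ n, (closure (E n) \ E n).Countable)
    {ν : ℕ → Measure X} [∀ n, NullSingletonClass (ν n)] {a M : ℝ≥0∞} (ha : a ≠ 0) (hM : M ≠ ⊤)
    (h : ∃ᶠ n in atTop, a ≤ ν n (E n) ∧ energy s (ν n) ≤ M) :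
    ENNReal.ofReal s ≤ dimH (⋂ n, E n) := by
  refine le_trans ?_ (dimH_iInter_closure_le hcl)
  refine le_dimH_of_hausdorffMeasure_ne_zero ?_
  rw [Real.coe_toNNReal s hs.le]
  exact hausdorffMeasure_iInter_ne_zero_of_energy_le hs (fun _ _ hmn => closure_mono (hanti hmn))
    hcomp ha hM (h.mono fun _ hn => ⟨hn.1.trans (measure_mono subset_closure), hn.2⟩)

end

/-! ### Products of correlations -/

section

variable {γ κ C δ : ℝ} {r : ℕ → ℝ}

theorem prod_le_exp_of_le_one_add_rpow (hγ : 1 < γ) (hκ : 0 < κ) (hC : 0 ≤ C) (hδ : 0 < δ)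
    (hr₀ : ∀ k, 0 ≤ r k) (hr : ∀ k, r k ≤ 1 + C * (δ * γ ^ k) ^ (-κ)) (n : ℕ) :
    ∏ k ∈ Finset.range n, r k ≤ Real.exp (C / (1 - γ ^ (-κ)) * δ ^ (-κ)) := by
  have hγ₀ : 0 < γ := zero_lt_one.trans hγ
  set x := γ ^ (-κ)
  have hx₀ : 0 < x := Real.rpow_pos_of_pos hγ₀ _
  have hx₁ : x < 1 := Real.rpow_lt_one_of_one_lt_of_neg hγ (neg_lt_zero.2 hκ)
  have hterm (k : ℕ) : (δ * γ ^ k) ^ (-κ) = δ ^ (-κ) * x ^ k := by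
    rw [Real.mul_rpow hδ.le (by positivity), ← Real.rpow_natCast_mul hγ₀.le,
      mul_comm (k : ℝ), Real.rpow_mul_natCast hγ₀.le]
  calc ∏ k ∈ Finset.range n, r k
      ≤ ∏ k ∈ Finset.range n, (1 + C * δ ^ (-κ) * x ^ k) :=
        Finset.prod_le_prod (fun k _ => hr₀ k) fun k _ => by
          rw [mul_assoc, ← hterm]
          exact hr k
    _ ≤ Real.exp (∑ k ∈ Finset.range n, C * δ ^ (-κ) * x ^ k) :=
        Real.prod_one_add_le_exp_sum _ fun k => by positivity
    _ ≤ Real.exp (C * δ ^ (-κ) * (1 - x)⁻¹) := by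
        rw [← Finset.mul_sum, ← tsum_geometric_of_lt_one hx₀.le hx₁]
        gcongr
        exact (summable_geometric_of_lt_one hx₀.le hx₁).sum_le_tsum _ fun k _ => by positivity
    _ = Real.exp (C / (1 - x) * δ ^ (-κ)) := by
        congr 1
        ring

theorem exp_mul_le_one_add_exp_mul (b : ℝ) {y : ℝ} (hy₀ : 0 ≤ y) (hy₁ : y ≤ 1) :
    Real.exp (b * y) ≤ 1 + Real.exp b * y := by
  have h := convexOn_exp.2 (Set.mem_univ 0) (Set.mem_univ b) (sub_nonneg.2 hy₁) hy₀ (by ring)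
  simp only [smul_eq_mul, mul_zero, zero_add, Real.exp_zero, mul_one] at h
  rw [mul_comm b]
  linarith

theorem prod_le_of_one_le (hγ : 1 < γ) (hκ : 0 < κ) (hC : 0 ≤ C) (hδ : 1 ≤ δ)
    (hr₀ : ∀ k, 0 ≤ r k) (hr : ∀ k, r k ≤ 1 + C * (δ * γ ^ k) ^ (-κ)) (n : ℕ) :
    ∏ k ∈ Finset.range n, r k ≤ 1 + Real.exp (C / (1 - γ ^ (-κ))) * δ ^ (-κ) :=
  (prod_le_exp_of_le_one_add_rpow hγ hκ hC (zero_lt_one.trans_le hδ) hr₀ hr n).trans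
    (exp_mul_le_one_add_exp_mul _ (by positivity)
      (Real.rpow_le_one_of_one_le_of_nonpos hδ (neg_nonpos.2 hκ.le)))

theorem prod_le_pow_mul_exp {G : ℝ} (hγ : 1 < γ) (hκ : 0 < κ) (hC : 0 ≤ C) (hG : 1 ≤ G)
    (hδ : 0 < δ) (hr₀ : ∀ k, 0 ≤ r k) (hrG : ∀ k, r k ≤ G)
    (hr : ∀ k, r k ≤ 1 + C * (δ * γ ^ k) ^ (-κ)) {m : ℕ} (hm : 1 ≤ δ * γ ^ m) (n : ℕ) :
    ∏ k ∈ Finset.range n, r k ≤ G ^ m * Real.exp (C / (1 - γ ^ (-κ))) := by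
  have hexp : 0 ≤ C / (1 - γ ^ (-κ)) := div_nonneg hC (sub_nonneg.2
    (Real.rpow_le_one_of_one_le_of_nonpos hγ.le (neg_nonpos.2 hκ.le)))
  have hpow (l : ℕ) : ∏ k ∈ Finset.range l, r k ≤ G ^ l :=
    (Finset.prod_le_prod (fun k _ => hr₀ k) fun k _ => hrG k).trans_eq (by simp)
  rcases le_total n m with hnm | hnm
  · exact (hpow n).trans ((pow_le_pow_right₀ hG hnm).trans
      (le_mul_of_one_le_right (by positivity) (Real.one_le_exp hexp)))
  obtain ⟨l, rfl⟩ := Nat.exists_eq_add_of_le hnm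
  rw [Finset.prod_range_add]
  refine mul_le_mul (hpow m) ?_ (Finset.prod_nonneg fun k _ => hr₀ _) (by positivity)
  refine (prod_le_exp_of_le_one_add_rpow (δ := δ * γ ^ m) hγ hκ hC (by positivity)
    (fun k => hr₀ (m + k)) (fun k => ?_) l).trans ?_
  · rw [mul_assoc, ← pow_add]
    exact hr (m + k)
  · exact Real.exp_le_exp.2 (mul_le_of_le_one_right hexp
      (Real.rpow_le_one_of_one_le_of_nonpos hm (neg_nonpos.2 hκ.le)))

theorem one_le_mul_pow_natCeil_logb_inv (hγ : 1 < γ) (hδ : 0 < δ) :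
    1 ≤ δ * γ ^ ⌈Real.logb γ δ⁻¹⌉₊ := by
  have h := (Real.logb_le_iff_le_rpow hγ (inv_pos.2 hδ)).1 (Nat.le_ceil (Real.logb γ δ⁻¹))
  rw [Real.rpow_natCast, inv_le_iff_one_le_mul₀' hδ] at h
  exact h

theorem pow_natCeil_logb_inv_le {G : ℝ} (hγ : 1 < γ) (hG : 1 ≤ G) (hδ₀ : 0 < δ) (hδ₁ : δ ≤ 1) :
    G ^ ⌈Real.logb γ δ⁻¹⌉₊ ≤ G * δ ^ (-Real.logb γ G) := by
  have hG₀ : 0 < G := zero_lt_one.trans_le hG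
  have hceil : (⌈Real.logb γ δ⁻¹⌉₊ : ℝ) ≤ Real.logb γ δ⁻¹ + 1 :=
    (Nat.ceil_lt_add_one (Real.logb_nonneg hγ (one_le_inv₀ hδ₀ |>.2 hδ₁))).le
  calc G ^ ⌈Real.logb γ δ⁻¹⌉₊ = G ^ (⌈Real.logb γ δ⁻¹⌉₊ : ℝ) := (Real.rpow_natCast _ _).symm
    _ ≤ G ^ (Real.logb γ δ⁻¹ + 1) := Real.rpow_le_rpow_of_exponent_le hG hceil
    _ = G * G ^ Real.logb γ δ⁻¹ := by rw [Real.rpow_add_one hG₀.ne', mul_comm]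
    _ = G * δ ^ (-Real.logb γ G) := by
        rw [Real.rpow_def_of_pos hG₀, Real.rpow_def_of_pos hδ₀, Real.logb_inv, Real.logb, Real.logb]
        ring_nf

-- The factors up to the scale `γ ^ m ≈ 1 / δ` are bounded by `G`; the later ones are summably
-- close to `1`.
theorem prod_le_of_le_one {G : ℝ} (hγ : 1 < γ) (hκ : 0 < κ) (hC : 0 ≤ C) (hG : 1 ≤ G)
    (hδ₀ : 0 < δ) (hδ₁ : δ ≤ 1) (hr₀ : ∀ k, 0 ≤ r k) (hrG : ∀ k, r k ≤ G)
    (hr : ∀ k, r k ≤ 1 + C * (δ * γ ^ k) ^ (-κ)) (n : ℕ) :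
    ∏ k ∈ Finset.range n, r k ≤ G * Real.exp (C / (1 - γ ^ (-κ))) * δ ^ (-Real.logb γ G) := by
  refine (prod_le_pow_mul_exp hγ hκ hC hG hδ₀ hr₀ hrG hr
    (one_le_mul_pow_natCeil_logb_inv hγ hδ₀) n).trans ?_
  rw [mul_right_comm]
  exact mul_le_mul_of_nonneg_right (pow_natCeil_logb_inv_le hγ hG hδ₀ hδ₁) (Real.exp_pos _).le

theorem prod_le_mul_one_add_rpow {G : ℝ} (hγ : 1 < γ) (hκ : 0 < κ) (hC : 0 ≤ C) (hG : 1 ≤ G)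
    (hδ : 0 < δ) (hr₀ : ∀ k, 0 ≤ r k) (hrG : ∀ k, r k ≤ G)
    (hr : ∀ k, r k ≤ 1 + C * (δ * γ ^ k) ^ (-κ)) (n : ℕ) :
    ∏ k ∈ Finset.range n, r k ≤
      2 * G * Real.exp (C / (1 - γ ^ (-κ))) * (1 + δ ^ (-Real.logb γ G)) := by
  have hexp : 1 ≤ Real.exp (C / (1 - γ ^ (-κ))) := Real.one_le_exp (div_nonneg hC
    (sub_nonneg.2 (Real.rpow_le_one_of_one_le_of_nonpos hγ.le (neg_nonpos.2 hκ.le))))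
  set E := Real.exp (C / (1 - γ ^ (-κ)))
  have hGE : E ≤ G * E := le_mul_of_one_le_left (by positivity) hG
  have hGEpow : 0 < G * E * δ ^ (-Real.logb γ G) := by positivity
  rcases le_total δ 1 with hδ₁ | hδ₁
  · linarith [prod_le_of_le_one hγ hκ hC hG hδ hδ₁ hr₀ hrG hr n]
  · have hκ₁ : E * δ ^ (-κ) ≤ E := mul_le_of_le_one_right (by positivity)
      (Real.rpow_le_one_of_one_le_of_nonpos hδ₁ (neg_nonpos.2 hκ.le))
    linarith [prod_le_of_one_le hγ hκ hC hδ₁ hr₀ hr n]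

theorem prod_le_one_add_mul_rpow_add_rpow {G : ℝ} (hγ : 1 < γ) (hκ : 0 < κ) (hC : 0 ≤ C)
    (hG : 1 ≤ G) (hδ : 0 < δ) (hr₀ : ∀ k, 0 ≤ r k) (hrG : ∀ k, r k ≤ G)
    (hr : ∀ k, r k ≤ 1 + C * (δ * γ ^ k) ^ (-κ)) (n : ℕ) :
    ∏ k ∈ Finset.range n, r k ≤
      1 + G * Real.exp (C / (1 - γ ^ (-κ))) * (δ ^ (-Real.logb γ G) + δ ^ (-κ)) := by
  set E := Real.exp (C / (1 - γ ^ (-κ)))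
  have hlogb : 0 ≤ G * E * δ ^ (-Real.logb γ G) := by positivity
  have hκ₀ : 0 ≤ E * δ ^ (-κ) := by positivity
  have hGκ : E * δ ^ (-κ) ≤ G * E * δ ^ (-κ) := by
    rw [mul_assoc]
    exact le_mul_of_one_le_left hκ₀ hG
  rcases le_total δ 1 with hδ₁ | hδ₁
  · linarith [prod_le_of_le_one hγ hκ hC hG hδ hδ₁ hr₀ hrG hr n]
  · linarith [prod_le_of_one_le hγ hκ hC hδ₁ hr₀ hr n]

end

/-! ### Integrals of functions of the distance -/

theorem setLIntegral_ofReal_rpow_neg {β L : ℝ} (hβ : β < 1) (hL : 0 ≤ L) :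
    ∫⁻ u in Set.Ioc 0 L, ENNReal.ofReal (u ^ (-β)) = ENNReal.ofReal (L ^ (1 - β) / (1 - β)) := by
  have hβ' : -1 < -β := neg_lt_neg hβ
  rw [← ofReal_integral_eq_lintegral_ofReal
      ((intervalIntegral.intervalIntegrable_rpow' hβ').1)
      ((ae_restrict_mem measurableSet_Ioc).mono fun u hu => Real.rpow_nonneg hu.1.le _),
    ← intervalIntegral.integral_of_le hL, integral_rpow (Or.inl hβ'),
    Real.zero_rpow (by linarith), sub_zero, neg_add_eq_sub]

theorem setLIntegral_comp_abs_sub_le {L x : ℝ} (hx : x ∈ Set.Icc 0 L) {g : ℝ → ℝ≥0∞}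
    (hg : Measurable g) : ∫⁻ y in Set.Icc 0 L, g |x - y| ≤ 2 * ∫⁻ u in Set.Ioc 0 L, g u := by
  set G : ℝ → ℝ≥0∞ := (Set.Ioc 0 L).indicator g with hG
  have hle : ∀ᵐ y, (Set.Icc 0 L).indicator (fun y => g |x - y|) y ≤ G (y - x) + G (x - y) := by
    filter_upwards [Measure.ae_ne volume x] with y hy
    refine Set.indicator_apply_le' (fun hyL => ?_) fun _ => zero_le
    rcases lt_or_gt_of_ne hy with hlt | hgt
    · rw [abs_of_pos (sub_pos.2 hlt), hG,
        Set.indicator_of_mem (s := Set.Ioc 0 L) (a := x - y)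
          ⟨sub_pos.2 hlt, (sub_le_self x hyL.1).trans hx.2⟩]
      exact le_add_self
    · rw [abs_sub_comm, abs_of_pos (sub_pos.2 hgt), hG,
        Set.indicator_of_mem (s := Set.Ioc 0 L) (a := y - x)
          ⟨sub_pos.2 hgt, (sub_le_self y hx.1).trans hyL.2⟩]
      exact le_self_add
  rw [← lintegral_indicator measurableSet_Icc]
  refine (lintegral_mono_ae hle).trans_eq ?_
  have hGm : Measurable G := hg.indicator measurableSet_Ioc
  rw [lintegral_add_left (f := fun y => G (y - x)) (by fun_prop), lintegral_sub_right_eq_self G x,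
    lintegral_sub_left_eq_self G x, ← two_mul, lintegral_indicator measurableSet_Ioc]

theorem lintegral_lintegral_comp_abs_sub_le (L : ℝ) {g : ℝ → ℝ≥0∞} (hg : Measurable g) :
    ∫⁻ x in Set.Icc 0 L, ∫⁻ y in Set.Icc 0 L, g |x - y| ≤
      2 * (∫⁻ u in Set.Ioc 0 L, g u) * ENNReal.ofReal L := by
  calc ∫⁻ x in Set.Icc 0 L, ∫⁻ y in Set.Icc 0 L, g |x - y|
      ≤ ∫⁻ _ in Set.Icc 0 L, 2 * ∫⁻ u in Set.Ioc 0 L, g u :=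
        setLIntegral_mono' measurableSet_Icc fun _ hx => setLIntegral_comp_abs_sub_le hx hg
    _ = 2 * (∫⁻ u in Set.Ioc 0 L, g u) * ENNReal.ofReal L := by
        rw [setLIntegral_const, Real.volume_Icc, sub_zero]

theorem lintegral_lintegral_le_of_forall_ne {μ : Measure ℝ} [NullSingletonClass μ]
    {f g : ℝ → ℝ → ℝ≥0∞} (h : ∀ x y, x ≠ y → f x y ≤ g x y) :
    ∫⁻ x, ∫⁻ y, f x y ∂μ ∂μ ≤ ∫⁻ x, ∫⁻ y, g x y ∂μ ∂μ :=
  lintegral_mono fun x => lintegral_mono_ae <|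
    (Measure.ae_ne μ x).mono fun y hy => h x y hy.symm

/-! ### Random sets -/

section RandomSet

variable {Ω Y : Type*} [MeasurableSpace Ω] [MeasurableSpace Y] {P : Measure Ω} {μ : Measure Y}
  [SFinite μ] {E : Ω → Set Y} {f : Y → ℝ≥0∞}

theorem measurable_setLIntegral (hE : MeasurableSet {p : Ω × Y | p.2 ∈ E p.1})
    (hf : Measurable f) : Measurable fun ω => ∫⁻ y in E ω, f y ∂μ := by
  have hind : Measurable fun p : Ω × Y => (E p.1).indicator f p.2 :=
    (hf.comp measurable_snd).indicator hE
  have heq (ω : Ω) : ∫⁻ y, (E ω).indicator f y ∂μ = ∫⁻ y in E ω, f y ∂μ :=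
    lintegral_indicator (measurable_prodMk_left hE) f
  simpa only [heq] using hind.lintegral_prod_right' (ν := μ)

theorem lintegral_setLIntegral [SFinite P] (hE : MeasurableSet {p : Ω × Y | p.2 ∈ E p.1})
    (hf : Measurable f) :
    ∫⁻ ω, ∫⁻ y in E ω, f y ∂μ ∂P = ∫⁻ y, f y * P {ω | y ∈ E ω} ∂μ := by
  have hind : Measurable fun p : Ω × Y => (E p.1).indicator f p.2 :=
    (hf.comp measurable_snd).indicator hE
  calc ∫⁻ ω, ∫⁻ y in E ω, f y ∂μ ∂P = ∫⁻ ω, ∫⁻ y, (E ω).indicator f y ∂μ ∂P :=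
        lintegral_congr fun ω => (lintegral_indicator (measurable_prodMk_left hE) f).symm
    _ = ∫⁻ y, ∫⁻ ω, (E ω).indicator f y ∂P ∂μ := lintegral_lintegral_swap hind.aemeasurable
    _ = ∫⁻ y, f y * P {ω | y ∈ E ω} ∂μ := lintegral_congr fun y =>
        lintegral_indicator_const (measurable_prodMk_right hE) (f y)

theorem measurableSet_prodMk_mem_prod (hE : MeasurableSet {p : Ω × Y | p.2 ∈ E p.1}) :
    MeasurableSet {p : Ω × Y × Y | p.2 ∈ E p.1 ×ˢ E p.1} :=
  (hE.preimage (measurable_fst.prodMk measurable_snd.fst)).inter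
    (hE.preimage (measurable_fst.prodMk measurable_snd.snd))

theorem energy_zero {X : Type*} [EMetricSpace X] [MeasurableSpace X] (μ : Measure X) :
    energy 0 μ = μ Set.univ ^ 2 := by
  simp [energy, pow_two]

theorem energy_smul {X : Type*} [EMetricSpace X] [MeasurableSpace X] (s : ℝ) {c : ℝ≥0∞}
    (hc : c ≠ ⊤) (μ : Measure X) : energy s (c • μ) = c ^ 2 * energy s μ := by
  simp only [energy, lintegral_smul_measure, smul_eq_mul, lintegral_const_mul' c _ hc, pow_two,
    mul_assoc]

variable {X : Type*} [EMetricSpace X] [SecondCountableTopology X] [MeasurableSpace X]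
  [OpensMeasurableSpace X] {μ : Measure X} [SFinite μ] {E : Ω → Set X}

theorem energy_restrict (s : ℝ) (A : Set X) :
    energy s (μ.restrict A) = ∫⁻ p in A ×ˢ A, edist p.1 p.2 ^ (-s) ∂μ.prod μ := by
  rw [← Measure.prod_restrict, lintegral_prod _ (by fun_prop), energy]

theorem measurable_energy_restrict (s : ℝ) (hE : MeasurableSet {p : Ω × X | p.2 ∈ E p.1}) :
    Measurable fun ω => energy s (μ.restrict (E ω)) := by
  simp only [energy_restrict]
  exact measurable_setLIntegral (measurableSet_prodMk_mem_prod hE) (by fun_prop)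

theorem lintegral_energy_restrict [SFinite P] (s : ℝ)
    (hE : MeasurableSet {p : Ω × X | p.2 ∈ E p.1}) :
    ∫⁻ ω, energy s (μ.restrict (E ω)) ∂P =
      ∫⁻ x, ∫⁻ y, edist x y ^ (-s) * P {ω | x ∈ E ω ∧ y ∈ E ω} ∂μ ∂μ := by
  simp only [energy_restrict]
  have hE₂ := measurableSet_prodMk_mem_prod hE
  rw [lintegral_setLIntegral hE₂ (by fun_prop)]
  refine lintegral_prod _ (Measurable.aemeasurable ?_)
  exact Measurable.mul (by fun_prop) (measurable_measure_prodMk_right hE₂)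

end RandomSet

/-! ### The probabilities of the box events -/

/-- The probability of the `k`-th box event at a fixed dynamical time. -/
def boxProb (γ : ℝ) (k : ℕ) : ℝ :=
  survProb (2 * (boxSize γ k).toNat) ((boxSize γ k).toNat ^ 2) (boxSize γ k).toNat

/-- The probability that the `k`-th box event occurs at two dynamical times at which the arrows of
each site have correlation `ρ`. -/
def boxPairProb (γ ρ : ℝ) (k : ℕ) : ℝ :=
  pairSurvProb ρ (2 * (boxSize γ k).toNat) ((boxSize γ k).toNat ^ 2) (boxSize γ k).toNat
    (boxSize γ k).toNat

theorem le_boxProb {γ : ℝ} (hγ : 0 ≤ γ) (k : ℕ) : Real.exp (-8) / 3 ≤ boxProb γ k := by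
  obtain ⟨e, he⟩ : ∃ e : ℕ, (boxSize γ k).toNat = 2 * e :=
    ⟨(⌊γ ^ k / 2⌋ + 1).toNat, by rw [boxSize]; lia⟩
  have hsize := two_le_boxSize hγ k
  rw [boxProb, he, Nat.cast_mul, Nat.cast_ofNat]
  exact le_survProb (by lia)

theorem boxProb_pos {γ : ℝ} (hγ : 0 ≤ γ) (k : ℕ) : 0 < boxProb γ k :=
  lt_of_lt_of_le (by positivity) (le_boxProb hγ k)

theorem boxProb_zero (γ : ℝ) : boxProb γ 0 = 1 / 16 := by
  have hsize : boxSize γ 0 = 2 := by norm_num [boxSize]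
  rw [boxProb, hsize, show (2 : ℤ).toNat = 2 from rfl]
  norm_num [survProb]

theorem boxX_succ_sub {γ : ℝ} (hγ : 0 ≤ γ) (k : ℕ) :
    boxX γ (k + 1) - (boxX γ k - boxSize γ k) = 2 * (boxSize γ k).toNat := by
  rw [natCast_toNat_boxSize hγ, boxX_succ]
  ring

theorem boxBase_fst_sub {γ : ℝ} (hγ : 0 ≤ γ) (k : ℕ) :
    (boxBase γ k).1.1 - (boxX γ k - boxSize γ k) = (boxSize γ k).toNat := by
  rw [natCast_toNat_boxSize hγ]
  exact sub_sub_cancel _ _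

theorem boxT_mono (γ : ℝ) : Monotone (boxT γ) :=
  fun _ _ hmn => Finset.sum_le_sum_of_subset_of_nonneg (Finset.range_mono hmn)
    fun _ _ _ => sq_nonneg _

section

variable {Ω : Type*} {W : Site → ℕ → Ω → ℝ} {ε : Site → ℕ → Ω → Bool} {γ : ℝ}

theorem siteAlg_measurableSet_boxSurvives (hγ : 0 ≤ γ) (k : ℕ) (τ : ℝ) :
    MeasurableSet[siteAlg W ε (rows (boxT γ k) (boxT γ (k + 1)))]
      {ω | BoxSurvives γ k (arrows W ε τ ω)} :=
  siteAlg_measurableSet_survives (z := boxBase γ k) (by rw [boxT_succ hγ]; rfl) τ _ _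

variable [mΩ : MeasurableSpace Ω] {P : Measure Ω} [IsProbabilityMeasure P]

namespace IsWebNoise

theorem measureReal_boxSurvives (h : IsWebNoise P W ε) (hγ : 0 ≤ γ) (k : ℕ) {τ : ℝ} (hτ : 0 ≤ τ) :
    P.real {ω | BoxSurvives γ k (arrows W ε τ ω)} = boxProb γ k := by
  rw [boxProb, ← boxX_succ_sub hγ, ← boxBase_fst_sub hγ]
  exact h.measureReal_survives hτ _ _ _ _

theorem measureReal_boxSurvives_inter (h : IsWebNoise P W ε) (hγ : 0 ≤ γ) (k : ℕ) {τ δ : ℝ}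
    (hτ : 0 ≤ τ) (hδ : 0 ≤ δ) :
    P.real ({ω | BoxSurvives γ k (arrows W ε τ ω)} ∩
      {ω | BoxSurvives γ k (arrows W ε (τ + δ) ω)}) = boxPairProb γ (Real.exp (-δ)) k := by
  rw [boxPairProb, ← boxX_succ_sub hγ, ← boxBase_fst_sub hγ]
  exact h.measureReal_survives_inter hτ hδ _ _ _ _ _ rfl

theorem boxPairProb_nonneg (h : IsWebNoise P W ε) (hγ : 0 ≤ γ) (k : ℕ) {δ : ℝ} (hδ : 0 ≤ δ) :
    0 ≤ boxPairProb γ (Real.exp (-δ)) k :=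
  h.measureReal_boxSurvives_inter hγ k le_rfl hδ ▸ measureReal_nonneg

theorem boxPairProb_le_boxProb (h : IsWebNoise P W ε) (hγ : 0 ≤ γ) (k : ℕ) {δ : ℝ} (hδ : 0 ≤ δ) :
    boxPairProb γ (Real.exp (-δ)) k ≤ boxProb γ k := by
  rw [← h.measureReal_boxSurvives_inter hγ k le_rfl hδ, ← h.measureReal_boxSurvives hγ k le_rfl]
  exact measureReal_mono Set.inter_subset_left

theorem measureReal_biInter_of_rows (h : IsWebNoise P W ε) {B : ℕ → Set Ω}
    (hB : ∀ k, MeasurableSet[siteAlg W ε (rows (boxT γ k) (boxT γ (k + 1)))] (B k)) (n : ℕ) :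
    P.real (⋂ k < n, B k) = ∏ k ∈ Finset.range n, P.real (B k) := by
  have hmeas (n : ℕ) : MeasurableSet[siteAlg W ε (rows 0 (boxT γ n))] (⋂ k < n, B k) := by
    refine MeasurableSet.biInter (Set.to_countable _) fun k (hk : k < n) => ?_
    exact siteAlg_mono (rows_subset (boxT_mono γ k.zero_le) (boxT_mono γ hk)) _ (hB k)
  induction n with
  | zero => simp
  | succ n ih =>
    rw [Set.biInter_lt_succ, Finset.prod_range_succ, ← ih]
    exact h.measureReal_inter_of_disjoint_sites (rows_disjoint le_rfl) (hmeas n) (hB n)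

theorem measure_boxEvent (h : IsWebNoise P W ε) (hγ : 0 ≤ γ) (k : ℕ) :
    P (boxEvent W ε γ k 0) = ENNReal.ofReal (boxProb γ k) := by
  have hbox : boxEvent W ε γ k 0 = {ω | BoxSurvives γ k (arrows W ε 0 ω)} :=
    Set.ext fun ω => mem_boxEvent_iff W ε hγ k 0 ω
  rw [hbox, ← h.measureReal_boxSurvives hγ k le_rfl, ofReal_measureReal]

theorem inv_boxProb_le_gammaZero (h : IsWebNoise P W ε) {K : ℝ} (hK : 0 < K) (k : ℕ) :
    ENNReal.ofReal (boxProb (gammaOf K) k)⁻¹ ≤ gammaZero P W ε := by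
  have hγ : 0 ≤ gammaOf K := by linarith [(gammaOf_spec hK).1]
  rw [ENNReal.ofReal_inv_of_pos (boxProb_pos hγ k), ← h.measure_boxEvent hγ]
  exact le_iSup_of_le k (le_iSup₂_of_le K hK le_rfl)

theorem sixteen_le_gammaZero (h : IsWebNoise P W ε) : 16 ≤ gammaZero P W ε := by
  simpa [boxProb_zero] using h.inv_boxProb_le_gammaZero one_pos 0

theorem gammaZero_lt_top (h : IsWebNoise P W ε) : gammaZero P W ε < ⊤ := by
  have hle : gammaZero P W ε ≤ (ENNReal.ofReal (Real.exp (-8) / 3))⁻¹ := by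
    refine iSup_le fun k => iSup₂_le fun K hK => ?_
    have hγ : 0 ≤ gammaOf K := by linarith [(gammaOf_spec hK).1]
    rw [h.measure_boxEvent hγ]
    exact ENNReal.inv_le_inv.2 (ENNReal.ofReal_le_ofReal (le_boxProb hγ k))
  refine hle.trans_lt (ENNReal.inv_lt_top.2 (ENNReal.ofReal_pos.2 ?_))
  positivity

end IsWebNoise

end

/-! ### The times at which the first boxes are survived -/

section

variable {Ω : Type*} {W : Site → ℕ → Ω → ℝ} {ε : Site → ℕ → Ω → Bool} {ω : Ω}

/-- The set of dynamical times in `[0, L]` at which the first `n` box events occur. -/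
def boxTimes (W : Site → ℕ → Ω → ℝ) (ε : Site → ℕ → Ω → Bool) (γ L : ℝ) (n : ℕ) (ω : Ω) : Set ℝ :=
  {τ | τ ∈ Set.Icc 0 L ∧ ∀ k < n, BoxSurvives γ k (arrows W ε τ ω)}

theorem boxTimes_subset_Icc (γ L : ℝ) (n : ℕ) (ω : Ω) : boxTimes W ε γ L n ω ⊆ Set.Icc 0 L :=
  fun _ hτ => hτ.1

theorem boxTimes_anti (γ L : ℝ) (ω : Ω) : Antitone fun n => boxTimes W ε γ L n ω :=
  fun _ _ hmn _ hτ => ⟨hτ.1, fun k hk => hτ.2 k (hk.trans_le hmn)⟩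

theorem iInter_boxTimes_subset {γ : ℝ} (hγ : 4 ≤ γ) (L : ℝ) (ω : Ω) :
    ⋂ n, boxTimes W ε γ L n ω ⊆ exceptionalTimes W ε (kOf γ) ω := by
  intro τ hτ
  rw [Set.mem_iInter] at hτ
  exact ⟨(hτ 0).1.1, fun t ht =>
    neg_kOf_mul_sqrt_le_path hγ (fun k => (hτ (k + 1)).2 k k.lt_succ_self) ht⟩

theorem eventually_survives_iff {τ : ℝ} (h : ∀ z, ∀ᶠ σ in 𝓝 τ, rings W σ ω z = rings W τ ω z)
    (lo hi : ℤ) (n : ℕ) (z : Site) :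
    ∀ᶠ σ in 𝓝 τ, (Survives (arrows W ε σ ω) lo hi n z ↔ Survives (arrows W ε τ ω) lo hi n z) := by
  induction n generalizing z with
  | zero => exact .of_forall fun σ => Iff.rfl
  | succ n ih =>
    filter_upwards [h z, ih (nbr z (arrows W ε τ ω z))] with σ hrings hsurv
    have harr : arrows W ε σ ω z = arrows W ε τ ω z := by rw [arrows, arrows, hrings]
    rw [survives_succ, survives_succ, harr, hsurv]

namespace GoodClocks

theorem eventually_rings_eq (hω : GoodClocks W ω) (z : Site) {τ : ℝ} (hτ₀ : 0 ≤ τ)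
    (hτ : ∀ n, ringTime W z n ω ≠ τ) : ∀ᶠ σ in 𝓝 τ, rings W σ ω z = rings W τ ω z := by
  have hmem := hω.mem_Ico_ringTime_rings z hτ₀
  filter_upwards [Ioo_mem_nhds (hmem.1.lt_of_ne (hτ _)) hmem.2] with σ hσ
  exact hω.rings_eq_of_mem_Ico (Set.Ioo_subset_Ico_self hσ)

theorem countable_closure_sdiff_boxTimes (hω : GoodClocks W ω) (γ L : ℝ) (n : ℕ) :
    (closure (boxTimes W ε γ L n ω) \ boxTimes W ε γ L n ω).Countable := by
  refine (Set.countable_range fun p : Site × ℕ => ringTime W p.1 p.2 ω).mono ?_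
  rintro τ ⟨hcl, hnot⟩
  by_contra hring
  have hIcc : τ ∈ Set.Icc 0 L := closure_minimal (boxTimes_subset_Icc γ L n ω) isClosed_Icc hcl
  have hrings (z : Site) : ∀ᶠ σ in 𝓝 τ, rings W σ ω z = rings W τ ω z :=
    hω.eventually_rings_eq z hIcc.1 fun m hm => hring ⟨(z, m), hm⟩
  have hbox : ∀ᶠ σ in 𝓝 τ, ∀ k ∈ Set.Iio n,
      (BoxSurvives γ k (arrows W ε σ ω) ↔ BoxSurvives γ k (arrows W ε τ ω)) :=
    (Filter.eventually_all_finite (Set.finite_Iio n)).2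
      fun _ _ => eventually_survives_iff hrings _ _ _ _
  obtain ⟨σ, hσ, hστ⟩ := ((mem_closure_iff_frequently.1 hcl).and_eventually hbox).exists
  exact hnot ⟨hIcc, fun k hk => (hστ k hk).1 (hσ.2 k hk)⟩

end GoodClocks

variable [mΩ : MeasurableSpace Ω] {P : Measure Ω}

namespace IsWebNoise

theorem measurableSet_mem_boxTimes (h : IsWebNoise P W ε) (γ L : ℝ) (n : ℕ) :
    MeasurableSet {p : Ω × ℝ | p.2 ∈ boxTimes W ε γ L n p.1} := by
  have hset : {p : Ω × ℝ | p.2 ∈ boxTimes W ε γ L n p.1} =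
      Prod.snd ⁻¹' Set.Icc 0 L ∩ ⋂ k < n, {p | BoxSurvives γ k (arrows W ε p.2 p.1)} := by
    ext p
    simp [boxTimes]
  have harr (y : Site) : Measurable fun p : Ω × ℝ => arrows W ε p.2 p.1 y :=
    ((h.measurable_arrows_uncurry y).comp measurable_swap :)
  rw [hset]
  refine (measurable_snd measurableSet_Icc).inter
    (MeasurableSet.biInter (Set.to_countable _) fun k _ => ?_)
  exact measurableSet_survives (fun p : Ω × ℝ => arrows W ε p.2 p.1) _ _ _ _ fun y _ => harr y

variable [IsProbabilityMeasure P] {γ L τ σ : ℝ}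

theorem measureReal_mem_boxTimes (h : IsWebNoise P W ε) (hγ : 0 ≤ γ) (hτ : τ ∈ Set.Icc 0 L)
    (n : ℕ) : P.real {ω | τ ∈ boxTimes W ε γ L n ω} = ∏ k ∈ Finset.range n, boxProb γ k := by
  have hset : {ω | τ ∈ boxTimes W ε γ L n ω} =
      ⋂ k < n, {ω | BoxSurvives γ k (arrows W ε τ ω)} := by
    ext ω
    simp [boxTimes, hτ.1, hτ.2]
  rw [hset, h.measureReal_biInter_of_rows fun k => siteAlg_measurableSet_boxSurvives hγ k τ]
  exact Finset.prod_congr rfl fun k _ => h.measureReal_boxSurvives hγ k hτ.1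

theorem measureReal_mem_boxTimes_and_mem (h : IsWebNoise P W ε) (hγ : 0 ≤ γ)
    (hτ : τ ∈ Set.Icc 0 L) (hσ : σ ∈ Set.Icc 0 L) (n : ℕ) :
    P.real {ω | τ ∈ boxTimes W ε γ L n ω ∧ σ ∈ boxTimes W ε γ L n ω} =
      ∏ k ∈ Finset.range n, boxPairProb γ (Real.exp (-|τ - σ|)) k := by
  wlog hle : τ ≤ σ generalizing τ σ
  · simpa only [abs_sub_comm, and_comm] using this hσ hτ (le_of_not_ge hle)
  have hset : {ω | τ ∈ boxTimes W ε γ L n ω ∧ σ ∈ boxTimes W ε γ L n ω} =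
      ⋂ k < n, {ω | BoxSurvives γ k (arrows W ε τ ω)} ∩
        {ω | BoxSurvives γ k (arrows W ε σ ω)} := by
    ext ω
    simp [boxTimes, hτ.1, hτ.2, hσ.1, hσ.2, forall₂_and]
  rw [hset, h.measureReal_biInter_of_rows fun k => MeasurableSet.inter
    (siteAlg_measurableSet_boxSurvives hγ k τ) (siteAlg_measurableSet_boxSurvives hγ k σ)]
  refine Finset.prod_congr rfl fun k _ => ?_
  rw [abs_sub_comm, abs_of_nonneg (sub_nonneg.2 hle),
    ← h.measureReal_boxSurvives_inter hγ k hτ.1 (sub_nonneg.2 hle), add_sub_cancel]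

end IsWebNoise

end

/-! ### The natural measures on the box times -/

/-- The two-point correlation, at dynamical times at distance `δ`, of the survival of the first `n`
boxes. -/
def boxCorr (γ : ℝ) (n : ℕ) (δ : ℝ) : ℝ :=
  ∏ k ∈ Finset.range n, boxPairProb γ (Real.exp (-δ)) k / boxProb γ k ^ 2

section

variable {Ω : Type*} {W : Site → ℕ → Ω → ℝ} {ε : Site → ℕ → Ω → Bool}

/-- Lebesgue measure on the dynamical times in `[0, L]` at which the first `n` box events occur,
normalized so that its intensity is Lebesgue measure on `[0, L]`. -/
def boxMeasure (W : Site → ℕ → Ω → ℝ) (ε : Site → ℕ → Ω → Bool) (γ L : ℝ) (n : ℕ) (ω : Ω) :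
    Measure ℝ :=
  ENNReal.ofReal (∏ k ∈ Finset.range n, boxProb γ k)⁻¹ • volume.restrict (boxTimes W ε γ L n ω)

instance nullSingletonClass_boxMeasure (γ L : ℝ) (n : ℕ) (ω : Ω) :
    NullSingletonClass (boxMeasure W ε γ L n ω) :=
  ⟨fun τ => by simp [boxMeasure]⟩

theorem restrict_Icc_restrict_boxTimes (γ L : ℝ) (n : ℕ) (ω : Ω) :
    (volume.restrict (Set.Icc 0 L)).restrict (boxTimes W ε γ L n ω) =
      volume.restrict (boxTimes W ε γ L n ω) :=
  Measure.restrict_restrict_of_subset (boxTimes_subset_Icc γ L n ω)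

theorem boxMeasure_self (γ L : ℝ) (n : ℕ) (ω : Ω) :
    boxMeasure W ε γ L n ω (boxTimes W ε γ L n ω) = boxMeasure W ε γ L n ω Set.univ := by
  simp [boxMeasure]

theorem energy_boxMeasure (s γ L : ℝ) (n : ℕ) (ω : Ω) :
    energy s (boxMeasure W ε γ L n ω) =
      ENNReal.ofReal (∏ k ∈ Finset.range n, boxProb γ k)⁻¹ ^ 2 *
        energy s (volume.restrict (boxTimes W ε γ L n ω)) :=
  energy_smul s ENNReal.ofReal_ne_top _

variable [mΩ : MeasurableSpace Ω] {P : Measure Ω} {γ : ℝ}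

namespace IsWebNoise

theorem measurable_energy_boxMeasure (h : IsWebNoise P W ε) (s γ L : ℝ) (n : ℕ) :
    Measurable fun ω => energy s (boxMeasure W ε γ L n ω) := by
  simp only [energy_boxMeasure]
  exact (measurable_energy_restrict s (h.measurableSet_mem_boxTimes γ L n)).const_mul _

theorem measurable_boxMeasure_univ (h : IsWebNoise P W ε) (γ L : ℝ) (n : ℕ) :
    Measurable fun ω => boxMeasure W ε γ L n ω Set.univ := by
  have hvol : Measurable fun ω => volume (boxTimes W ε γ L n ω) :=
    measurable_measure_prodMk_left (h.measurableSet_mem_boxTimes γ L n)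
  simpa [boxMeasure] using hvol.const_mul (ENNReal.ofReal (∏ k ∈ Finset.range n, boxProb γ k)⁻¹)

variable [IsProbabilityMeasure P]

theorem lintegral_boxMeasure_univ (h : IsWebNoise P W ε) (hγ : 0 ≤ γ) (L : ℝ) (n : ℕ) :
    ∫⁻ ω, boxMeasure W ε γ L n ω Set.univ ∂P = ENNReal.ofReal L := by
  have hp : 0 < ∏ k ∈ Finset.range n, boxProb γ k := Finset.prod_pos fun k _ => boxProb_pos hγ k
  have hvol : ∫⁻ ω, volume (boxTimes W ε γ L n ω) ∂P =
      ENNReal.ofReal (∏ k ∈ Finset.range n, boxProb γ k) * ENNReal.ofReal L := by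
    calc ∫⁻ ω, volume (boxTimes W ε γ L n ω) ∂P
        = ∫⁻ ω, ∫⁻ _ in boxTimes W ε γ L n ω, 1 ∂volume.restrict (Set.Icc 0 L) ∂P := by
          simp only [restrict_Icc_restrict_boxTimes, lintegral_one, Measure.restrict_apply_univ]
      _ = ∫⁻ τ in Set.Icc 0 L, 1 * P {ω | τ ∈ boxTimes W ε γ L n ω} :=
          lintegral_setLIntegral (h.measurableSet_mem_boxTimes γ L n) measurable_const
      _ = ∫⁻ _ in Set.Icc 0 L, ENNReal.ofReal (∏ k ∈ Finset.range n, boxProb γ k) :=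
          setLIntegral_congr_fun measurableSet_Icc fun τ hτ => by
            rw [one_mul, ← h.measureReal_mem_boxTimes hγ hτ, ofReal_measureReal]
      _ = ENNReal.ofReal (∏ k ∈ Finset.range n, boxProb γ k) * ENNReal.ofReal L := by
          rw [setLIntegral_const, Real.volume_Icc, sub_zero]
  simp only [boxMeasure, Measure.smul_apply, Measure.restrict_apply_univ, smul_eq_mul]
  rw [lintegral_const_mul' _ _ ENNReal.ofReal_ne_top, hvol, ← mul_assoc,
    ← ENNReal.ofReal_mul (inv_nonneg.2 hp.le), inv_mul_cancel₀ hp.ne', ENNReal.ofReal_one, one_mul]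

theorem lintegral_energy_boxMeasure (h : IsWebNoise P W ε) (hγ : 0 ≤ γ) (s L : ℝ) (n : ℕ) :
    ∫⁻ ω, energy s (boxMeasure W ε γ L n ω) ∂P =
      ∫⁻ τ in Set.Icc 0 L, ∫⁻ σ in Set.Icc 0 L,
        edist τ σ ^ (-s) * ENNReal.ofReal (boxCorr γ n |τ - σ|) := by
  set p := ∏ k ∈ Finset.range n, boxProb γ k with hp
  have hp₀ : 0 ≤ p⁻¹ := inv_nonneg.2 (Finset.prod_nonneg fun k _ => (boxProb_pos hγ k).le)
  simp only [energy_boxMeasure, ← restrict_Icc_restrict_boxTimes]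
  rw [lintegral_const_mul' _ _ (by finiteness),
    lintegral_energy_restrict s (h.measurableSet_mem_boxTimes γ L n),
    ← lintegral_const_mul' _ _ (by finiteness)]
  refine setLIntegral_congr_fun measurableSet_Icc fun τ hτ => ?_
  rw [← lintegral_const_mul' _ _ (by finiteness)]
  refine setLIntegral_congr_fun measurableSet_Icc fun σ hσ => ?_
  rw [← ofReal_measureReal, h.measureReal_mem_boxTimes_and_mem hγ hτ hσ, mul_left_comm,
    ← ENNReal.ofReal_pow hp₀, ← ENNReal.ofReal_mul (pow_nonneg hp₀ 2), boxCorr,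
    Finset.prod_div_distrib, Finset.prod_pow, ← hp, inv_pow, div_eq_inv_mul]

end IsWebNoise

end

/-! ### Bounds for the correlations -/

/-- The constant in the bounds for the two-point correlations of the box times. -/
def corrConst (γ G : ℝ) : ℝ :=
  G * Real.exp (22 * G ^ 2 / (1 - γ ^ (-(1 / 3) : ℝ)))

section

variable {γ G δ : ℝ}

theorem exp_neg_mul_one_sub_exp_neg_rpow_le {κ : ℝ} (hδ : 0 < δ) (hκ₀ : 0 ≤ κ) (hκ₁ : κ ≤ 1) :
    Real.exp (-δ) * (1 - Real.exp (-δ)) ^ (-κ) ≤ δ ^ (-κ) := by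
  set ρ := Real.exp (-δ)
  have hρ₀ : 0 < ρ := Real.exp_pos _
  have hρ₁ : ρ ≤ 1 := Real.exp_le_one_iff.2 (neg_nonpos.2 hδ.le)
  have hmul : δ * ρ ≤ 1 - ρ := by
    have hinv : Real.exp δ * ρ = 1 := by rw [← Real.exp_add, add_neg_cancel, Real.exp_zero]
    linarith [mul_le_mul_of_nonneg_right (Real.add_one_le_exp δ) hρ₀.le]
  calc ρ * (1 - ρ) ^ (-κ) ≤ ρ ^ κ * (δ * ρ) ^ (-κ) :=
        mul_le_mul (Real.self_le_rpow_of_le_one hρ₀.le hρ₁ hκ₁)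
          (Real.rpow_le_rpow_of_nonpos (by positivity) hmul (neg_nonpos.2 hκ₀))
          (Real.rpow_nonneg (sub_nonneg.2 hρ₁) _) (by positivity)
    _ = δ ^ (-κ) := by
        rw [Real.mul_rpow hδ.le hρ₀.le, mul_left_comm, ← Real.rpow_add hρ₀, add_neg_cancel,
          Real.rpow_zero, mul_one]

theorem boxPairProb_le (hγ : 0 < γ) (hδ : 0 < δ) (k : ℕ) :
    boxPairProb γ (Real.exp (-δ)) k ≤
      boxProb γ k ^ 2 + 22 * (δ * γ ^ k) ^ (-(1 / 3) : ℝ) := by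
  have hρ : Real.exp (-δ) < 1 := Real.exp_lt_one_iff.2 (neg_lt_zero.2 hδ)
  have hsize : γ ^ k ≤ (boxSize γ k).toNat := by
    have hcast : ((boxSize γ k).toNat : ℝ) = boxSize γ k :=
      mod_cast congrArg (Int.cast : ℤ → ℝ) (natCast_toNat_boxSize hγ.le k)
    exact hcast ▸ (pow_lt_boxSize γ k).le
  have hd : 0 < (boxSize γ k).toNat := by
    have := two_le_boxSize hγ.le k
    lia
  refine (pairSurvProb_le (Real.exp_pos _).le hρ (by positivity) hd _).trans ?_
  rw [← boxProb, mul_assoc 22, Real.mul_rpow (sub_nonneg.2 hρ.le) (Nat.cast_nonneg _),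
    ← mul_assoc (Real.exp _), Real.mul_rpow hδ.le (pow_pos hγ k).le]
  have hexp : Real.exp (-δ) * (1 - Real.exp (-δ)) ^ (-(1 / 3) : ℝ) ≤ δ ^ (-(1 / 3) : ℝ) :=
    exp_neg_mul_one_sub_exp_neg_rpow_le hδ (by norm_num) (by norm_num)
  have hpow : ((boxSize γ k).toNat : ℝ) ^ (-(1 / 3) : ℝ) ≤ (γ ^ k) ^ (-(1 / 3) : ℝ) :=
    Real.rpow_le_rpow_of_nonpos (by positivity) hsize (by norm_num)
  gcongr

theorem boxPairProb_div_le (hγ : 0 < γ) (hG : ∀ k, (boxProb γ k)⁻¹ ≤ G) (hδ : 0 < δ) (k : ℕ) :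
    boxPairProb γ (Real.exp (-δ)) k / boxProb γ k ^ 2 ≤
      1 + 22 * G ^ 2 * (δ * γ ^ k) ^ (-(1 / 3) : ℝ) := by
  have hp := boxProb_pos hγ.le k
  have hGp : 1 ≤ G ^ 2 * boxProb γ k ^ 2 := by
    rw [← mul_pow]
    exact one_le_pow₀ ((inv_le_iff_one_le_mul₀ hp).1 (hG k))
  have hy : 0 ≤ 22 * (δ * γ ^ k) ^ (-(1 / 3) : ℝ) := by positivity
  rw [div_le_iff₀ (by positivity)]
  linarith [boxPairProb_le hγ hδ k, mul_le_mul_of_nonneg_left hGp hy]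

variable {Ω : Type*} {W : Site → ℕ → Ω → ℝ} {ε : Site → ℕ → Ω → Bool} [MeasurableSpace Ω]
  {P : Measure Ω} [IsProbabilityMeasure P]

namespace IsWebNoise

theorem boxPairProb_div_nonneg (h : IsWebNoise P W ε) (hγ : 0 ≤ γ) (hδ : 0 ≤ δ) (k : ℕ) :
    0 ≤ boxPairProb γ (Real.exp (-δ)) k / boxProb γ k ^ 2 :=
  div_nonneg (h.boxPairProb_nonneg hγ k hδ) (sq_nonneg _)

theorem boxPairProb_div_le_inv (h : IsWebNoise P W ε) (hγ : 0 ≤ γ) (hδ : 0 ≤ δ) (k : ℕ) :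
    boxPairProb γ (Real.exp (-δ)) k / boxProb γ k ^ 2 ≤ (boxProb γ k)⁻¹ := by
  have hp := boxProb_pos hγ k
  rw [div_le_iff₀ (pow_pos hp 2), sq, inv_mul_cancel_left₀ hp.ne']
  exact h.boxPairProb_le_boxProb hγ k hδ

theorem boxCorr_le_mul_one_add_rpow (h : IsWebNoise P W ε) (hγ : 1 < γ) (hG₁ : 1 ≤ G)
    (hG : ∀ k, (boxProb γ k)⁻¹ ≤ G) (hδ : 0 < δ) (n : ℕ) :
    boxCorr γ n δ ≤ 2 * corrConst γ G * (1 + δ ^ (-Real.logb γ G)) := by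
  have hγ₀ : 0 < γ := zero_lt_one.trans hγ
  rw [corrConst, ← mul_assoc]
  exact prod_le_mul_one_add_rpow hγ (by norm_num) (by positivity) hG₁ hδ
    (h.boxPairProb_div_nonneg hγ₀.le hδ.le)
    (fun k => (h.boxPairProb_div_le_inv hγ₀.le hδ.le k).trans (hG k))
    (boxPairProb_div_le hγ₀ hG hδ) n

theorem boxCorr_le_one_add_mul_rpow_add_rpow (h : IsWebNoise P W ε) (hγ : 1 < γ) (hG₁ : 1 ≤ G)
    (hG : ∀ k, (boxProb γ k)⁻¹ ≤ G) (hδ : 0 < δ) (n : ℕ) :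
    boxCorr γ n δ ≤
      1 + corrConst γ G * (δ ^ (-Real.logb γ G) + δ ^ (-(1 / 3) : ℝ)) := by
  have hγ₀ : 0 < γ := zero_lt_one.trans hγ
  exact prod_le_one_add_mul_rpow_add_rpow hγ (by norm_num) (by positivity) hG₁ hδ
    (h.boxPairProb_div_nonneg hγ₀.le hδ.le)
    (fun k => (h.boxPairProb_div_le_inv hγ₀.le hδ.le k).trans (hG k))
    (boxPairProb_div_le hγ₀ hG hδ) n

end IsWebNoise

end

/-! ### Bounds for the moments -/

theorem lintegral_lintegral_ofReal_rpow_add_rpow_le {α β A L : ℝ} (hα : α < 1) (hβ : β < 1)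
    (hA : 0 ≤ A) (hL : 0 ≤ L) :
    ∫⁻ x in Set.Icc 0 L, ∫⁻ y in Set.Icc 0 L,
        ENNReal.ofReal (A * (|x - y| ^ (-α) + |x - y| ^ (-β))) ≤
      ENNReal.ofReal (2 * A * (L ^ (1 - α) / (1 - α) + L ^ (1 - β) / (1 - β)) * L) := by
  have hα₀ : 0 ≤ L ^ (1 - α) / (1 - α) := div_nonneg (Real.rpow_nonneg hL _) (sub_pos.2 hα).le
  have hβ₀ : 0 ≤ L ^ (1 - β) / (1 - β) := div_nonneg (Real.rpow_nonneg hL _) (sub_pos.2 hβ).le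
  have hint : ∫⁻ u in Set.Ioc 0 L, ENNReal.ofReal (A * (u ^ (-α) + u ^ (-β))) =
      ENNReal.ofReal (A * (L ^ (1 - α) / (1 - α) + L ^ (1 - β) / (1 - β))) := by
    calc ∫⁻ u in Set.Ioc 0 L, ENNReal.ofReal (A * (u ^ (-α) + u ^ (-β)))
        = ∫⁻ u in Set.Ioc 0 L,
            ENNReal.ofReal A * (ENNReal.ofReal (u ^ (-α)) + ENNReal.ofReal (u ^ (-β))) :=
          setLIntegral_congr_fun measurableSet_Ioc fun u hu => by
            rw [ENNReal.ofReal_mul hA,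
              ENNReal.ofReal_add (Real.rpow_nonneg hu.1.le _) (Real.rpow_nonneg hu.1.le _)]
      _ = ENNReal.ofReal (A * (L ^ (1 - α) / (1 - α) + L ^ (1 - β) / (1 - β))) := by
          rw [lintegral_const_mul' _ _ ENNReal.ofReal_ne_top, lintegral_add_left (by fun_prop),
            setLIntegral_ofReal_rpow_neg hα hL, setLIntegral_ofReal_rpow_neg hβ hL,
            ← ENNReal.ofReal_add hα₀ hβ₀, ← ENNReal.ofReal_mul hA]
  refine (lintegral_lintegral_comp_abs_sub_le L
    (g := fun u => ENNReal.ofReal (A * (u ^ (-α) + u ^ (-β)))) (by fun_prop)).trans_eq ?_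
  rw [hint, ← ENNReal.ofReal_ofNat 2, ← ENNReal.ofReal_mul zero_le_two,
    ← ENNReal.ofReal_mul (by positivity), ← mul_assoc 2 A]

section

variable {γ G L s : ℝ}

theorem logb_lt_one (hG : 1 < G) (hGγ : G < γ) : Real.logb γ G < 1 :=
  (Real.logb_lt_iff_lt_rpow (hG.trans hGγ) (zero_lt_one.trans hG)).2 (by rwa [Real.rpow_one])

/-- A bound for the relative variance of the mass of the natural measures on `[0, L]`. -/
def massVarBound (γ G L : ℝ) : ℝ :=
  2 * corrConst γ G * (L ^ (-Real.logb γ G) / (1 - Real.logb γ G) +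
    L ^ (-(1 / 3) : ℝ) / (1 - 1 / 3))

theorem tendsto_massVarBound_atTop (hG : 1 < G) (hGγ : G < γ) :
    Tendsto (massVarBound γ G) atTop (𝓝 0) := by
  have hlog : 0 < Real.logb γ G := Real.logb_pos (hG.trans hGγ) hG
  have hsum := ((tendsto_rpow_neg_atTop hlog).div_const (1 - Real.logb γ G)).add
    ((tendsto_rpow_neg_atTop (y := 1 / 3) (by norm_num)).div_const (1 - 1 / 3))
  have hlim := hsum.const_mul (2 * corrConst γ G)
  rw [zero_div, zero_div, add_zero, mul_zero] at hlim
  exact hlim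

theorem massVarBound_nonneg (hG : 1 < G) (hGγ : G < γ) (hL : 0 < L) : 0 ≤ massVarBound γ G L := by
  have : 0 < 1 - Real.logb γ G := sub_pos.2 (logb_lt_one hG hGγ)
  have : (0 : ℝ) < 1 - 1 / 3 := by norm_num
  rw [massVarBound, corrConst]
  positivity

theorem sq_mul_one_add_massVarBound (hL : 0 < L) :
    L ^ 2 * (1 + massVarBound γ G L) = L * L +
      2 * corrConst γ G * (L ^ (1 - Real.logb γ G) / (1 - Real.logb γ G) +
        L ^ (1 - 1 / 3 : ℝ) / (1 - 1 / 3)) * L := by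
  rw [massVarBound, sub_eq_add_neg 1 (Real.logb γ G), sub_eq_add_neg (1 : ℝ) (1 / 3),
    Real.rpow_add hL, Real.rpow_add hL, Real.rpow_one]
  ring

variable {Ω : Type*} {W : Site → ℕ → Ω → ℝ} {ε : Site → ℕ → Ω → Bool} [MeasurableSpace Ω]
  {P : Measure Ω} [IsProbabilityMeasure P]

namespace IsWebNoise

theorem lintegral_energy_boxMeasure_le (h : IsWebNoise P W ε) (hγ : 1 < γ) (hG₁ : 1 ≤ G)
    (hG : ∀ k, (boxProb γ k)⁻¹ ≤ G) (hGs : Real.logb γ G + s < 1) (hL : 0 ≤ L)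
    (n : ℕ) :
    ∫⁻ ω, energy s (boxMeasure W ε γ L n ω) ∂P ≤
      ENNReal.ofReal (2 * (2 * corrConst γ G) * (L ^ (1 - s) / (1 - s) +
        L ^ (1 - (Real.logb γ G + s)) / (1 - (Real.logb γ G + s))) * L) := by
  have hlogb : 0 ≤ Real.logb γ G := Real.logb_nonneg hγ hG₁
  have hC : 0 ≤ 2 * corrConst γ G := by
    rw [corrConst]
    positivity
  rw [h.lintegral_energy_boxMeasure (zero_le_one.trans hγ.le)]
  refine (lintegral_lintegral_le_of_forall_ne fun τ σ hne => ?_).trans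
    (lintegral_lintegral_ofReal_rpow_add_rpow_le (by linarith) hGs hC hL)
  have hδ : 0 < |τ - σ| := abs_pos.2 (sub_ne_zero.2 hne)
  rw [edist_dist, Real.dist_eq, ENNReal.ofReal_rpow_of_pos hδ, ← ENNReal.ofReal_mul (by positivity)]
  refine ENNReal.ofReal_le_ofReal ?_
  calc |τ - σ| ^ (-s) * boxCorr γ n |τ - σ|
      ≤ |τ - σ| ^ (-s) * (2 * corrConst γ G * (1 + |τ - σ| ^ (-Real.logb γ G))) := by
        gcongr
        exact h.boxCorr_le_mul_one_add_rpow hγ hG₁ hG hδ n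
    _ = 2 * corrConst γ G * (|τ - σ| ^ (-s) + |τ - σ| ^ (-(Real.logb γ G + s))) := by
        rw [neg_add, Real.rpow_add hδ]
        ring

theorem lintegral_boxMeasure_univ_sq_le (h : IsWebNoise P W ε) (hG₁ : 1 < G) (hGγ : G < γ)
    (hG : ∀ k, (boxProb γ k)⁻¹ ≤ G) (hL : 0 < L) (n : ℕ) :
    ∫⁻ ω, boxMeasure W ε γ L n ω Set.univ ^ 2 ∂P ≤
      ENNReal.ofReal (L ^ 2 * (1 + massVarBound γ G L)) := by
  have hγ : 1 < γ := hG₁.trans hGγ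
  have hlogb : Real.logb γ G < 1 := logb_lt_one hG₁ hGγ
  have hC : 0 ≤ corrConst γ G := by
    rw [corrConst]
    positivity
  have : 0 < 1 - Real.logb γ G := sub_pos.2 hlogb
  have : (0 : ℝ) < 1 - 1 / 3 := by norm_num
  simp only [← energy_zero]
  rw [h.lintegral_energy_boxMeasure (zero_le_one.trans hγ.le), sq_mul_one_add_massVarBound hL,
    ENNReal.ofReal_add (by positivity) (by positivity)]
  calc ∫⁻ τ in Set.Icc 0 L, ∫⁻ σ in Set.Icc 0 L,
        edist τ σ ^ (-(0 : ℝ)) * ENNReal.ofReal (boxCorr γ n |τ - σ|)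
      ≤ ∫⁻ τ in Set.Icc 0 L, ∫⁻ σ in Set.Icc 0 L, (1 + ENNReal.ofReal (corrConst γ G *
          (|τ - σ| ^ (-Real.logb γ G) + |τ - σ| ^ (-(1 / 3) : ℝ)))) :=
        lintegral_lintegral_le_of_forall_ne fun τ σ hne => by
          have hδ : 0 < |τ - σ| := abs_pos.2 (sub_ne_zero.2 hne)
          rw [neg_zero, ENNReal.rpow_zero, one_mul, ← ENNReal.ofReal_one,
            ← ENNReal.ofReal_add zero_le_one (by positivity)]
          exact ENNReal.ofReal_le_ofReal
            (h.boxCorr_le_one_add_mul_rpow_add_rpow hγ hG₁.le hG hδ n)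
    _ = ENNReal.ofReal (L * L) + ∫⁻ τ in Set.Icc 0 L, ∫⁻ σ in Set.Icc 0 L,
          ENNReal.ofReal (corrConst γ G *
            (|τ - σ| ^ (-Real.logb γ G) + |τ - σ| ^ (-(1 / 3) : ℝ))) := by
        simp only [lintegral_add_left measurable_const, setLIntegral_const, Real.volume_Icc,
          sub_zero, one_mul, ENNReal.ofReal_mul hL.le]
    _ ≤ _ := by
        gcongr
        exact lintegral_lintegral_ofReal_rpow_add_rpow_le hlogb (by norm_num) hC hL.le

end IsWebNoise

end

/-! ### The dimension of the set of exceptional times -/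

section

variable {Ω : Type*} [MeasurableSpace Ω] {P : Measure Ω}

theorem measure_eventually_le {B : ℕ → Set Ω} {q : ℝ≥0∞} (h : ∀ n, P (B n) ≤ q) :
    P {ω | ∀ᶠ n in atTop, ω ∈ B n} ≤ q := by
  have hUnion : {ω | ∀ᶠ n in atTop, ω ∈ B n} = ⋃ N, ⋂ n ≥ N, B n := by
    ext ω
    simp [eventually_atTop]
  have hmono : Monotone fun N => ⋂ n ≥ N, B n :=
    fun _ _ hMN => Set.biInter_mono (fun _ hn => hMN.trans hn) fun _ _ => subset_rfl
  rw [hUnion, hmono.measure_iUnion]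
  exact iSup_le fun N => (measure_mono (Set.biInter_subset_of_mem le_rfl)).trans (h N)

theorem measure_eventually_not_le_and_le_le {X I : ℕ → Ω → ℝ≥0∞} {a q B : ℝ≥0∞}
    (hX : ∀ n, P {ω | X n ω < a} ≤ q) (hI : ∀ n, AEMeasurable (I n) P)
    (hIB : ∀ n, ∫⁻ ω, I n ω ∂P ≤ B) (hB : B ≠ ⊤) :
    P {ω | ∀ M : ℝ≥0∞, M ≠ ⊤ → ∀ᶠ n in atTop, ¬(a ≤ X n ω ∧ I n ω ≤ M)} ≤ q := by
  have hbound (M : ℕ) (hM : M ≠ 0) :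
      P {ω | ∀ M : ℝ≥0∞, M ≠ ⊤ → ∀ᶠ n in atTop, ¬(a ≤ X n ω ∧ I n ω ≤ M)} ≤ q + B / M := by
    have hM₀ : (M : ℝ≥0∞) ≠ 0 := Nat.cast_ne_zero.2 hM
    have hM₁ : (M : ℝ≥0∞) ≠ ⊤ := ENNReal.natCast_ne_top M
    refine (measure_mono fun ω hω => ?_).trans (measure_eventually_le
      (B := fun n => {ω | X n ω < a} ∪ {ω | (M : ℝ≥0∞) ≤ I n ω}) fun n => ?_)
    · filter_upwards [hω M hM₁] with n hn
      by_contra! hc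
      simp only [Set.mem_union, Set.mem_ofPred_eq, not_or, not_lt, not_le] at hc
      exact hn ⟨hc.1, hc.2.le⟩
    · refine (measure_union_le _ _).trans (add_le_add (hX n) ?_)
      exact (meas_ge_le_lintegral_div (hI n) hM₀ hM₁).trans (ENNReal.div_le_div_right (hIB n) _)
  have hlim : Tendsto (fun M : ℕ => q + B / M) atTop (𝓝 (q + B / ⊤)) :=
    tendsto_const_nhds.add (ENNReal.Tendsto.const_div ENNReal.tendsto_nat_nhds_top (.inr hB))
  rw [ENNReal.div_top, add_zero] at hlim
  exact ge_of_tendsto hlim ((eventually_ne_atTop 0).mono hbound)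

theorem measure_lt_half_le [IsProbabilityMeasure P] {X : Ω → ℝ≥0∞} (hX : AEMeasurable X P)
    {m ψ : ℝ} (hm : 0 < m) (hψ : 0 ≤ ψ) (h₁ : ∫⁻ ω, X ω ∂P = ENNReal.ofReal m)
    (h₂ : ∫⁻ ω, X ω ^ 2 ∂P ≤ ENNReal.ofReal (m ^ 2 * (1 + ψ))) :
    P {ω | X ω < ENNReal.ofReal (m / 2)} ≤ ENNReal.ofReal (4 * ψ) := by
  set Y : Ω → ℝ := fun ω => (X ω).toReal
  have hX₂ : AEMeasurable (fun ω => X ω ^ 2) P := hX.pow_const 2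
  have htop₂ : ∫⁻ ω, X ω ^ 2 ∂P ≠ ⊤ := (h₂.trans_lt ENNReal.ofReal_lt_top).ne
  have hYsq : (fun ω => Y ω ^ 2) = fun ω => (X ω ^ 2).toReal :=
    funext fun ω => (ENNReal.toReal_pow _ _).symm
  have hY : MemLp Y 2 P := by
    rw [memLp_two_iff_integrable_sq hX.ennreal_toReal.aestronglyMeasurable, hYsq]
    exact integrable_toReal_of_lintegral_ne_top hX₂ htop₂
  have hmean : P[Y] = m := by
    rw [integral_toReal hX (ae_lt_top' hX (h₁ ▸ ENNReal.ofReal_ne_top)), h₁,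
      ENNReal.toReal_ofReal hm.le]
  have hvar : Var[Y; P] ≤ m ^ 2 * ψ := by
    have hsq : P[Y ^ 2] ≤ m ^ 2 * (1 + ψ) := by
      change ∫ ω, Y ω ^ 2 ∂P ≤ _
      rw [hYsq, integral_toReal hX₂ (ae_lt_top' hX₂ htop₂)]
      exact ENNReal.toReal_le_of_le_ofReal (by positivity) h₂
    rw [variance_eq_sub hY, hmean]
    linarith
  calc P {ω | X ω < ENNReal.ofReal (m / 2)} ≤ P {ω | m / 2 ≤ |Y ω - P[Y]|} :=
        measure_mono fun ω (hω : X ω < _) => by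
          have hlt : Y ω < m / 2 := ENNReal.toReal_lt_of_lt_ofReal hω
          rw [hmean, Set.mem_ofPred_eq, abs_sub_comm]
          exact (by linarith : m / 2 ≤ m - Y ω).trans (le_abs_self _)
    _ ≤ ENNReal.ofReal (Var[Y; P] / (m / 2) ^ 2) := meas_ge_le_variance_div_sq hY (half_pos hm)
    _ ≤ ENNReal.ofReal (4 * ψ) := by
        refine ENNReal.ofReal_le_ofReal ?_
        rw [div_le_iff₀ (by positivity)]
        linarith

end

section

variable {Ω : Type*} {W : Site → ℕ → Ω → ℝ} {ε : Site → ℕ → Ω → Bool}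

theorem exceptionalTimes_mono (ω : Ω) : Monotone fun K => exceptionalTimes W ε K ω :=
  fun _ _ hK _ hτ => ⟨hτ.1, fun t ht => (mul_le_mul_of_nonneg_right (neg_le_neg hK)
    (Real.sqrt_nonneg t)).trans (hτ.2 t ht)⟩

theorem lt_gammaOf {g K : ℝ} (hg : 2 < g) (hK : 0 < K) (hgK : kOf g < K) : g < gammaOf K := by
  rw [← (gammaOf_spec hK).2] at hgK
  exact (kOf_strictMonoOn.lt_iff_lt hg (gammaOf_spec hK).1).1 hgK

theorem tendsto_gammaOf_atTop : Tendsto gammaOf atTop atTop := by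
  refine tendsto_atTop.2 fun b => ?_
  filter_upwards [eventually_gt_atTop 0, eventually_gt_atTop (kOf (max b 3))] with K hK₀ hK
  exact (le_max_left b 3).trans (lt_gammaOf (lt_max_of_lt_right (by norm_num)) hK₀ hK).le

theorem tendsto_one_sub_log_div_log_gammaOf (G : ℝ) :
    Tendsto (fun K => ENNReal.ofReal (1 - Real.log G / Real.log (gammaOf K))) atTop (𝓝 1) := by
  have hlog : Tendsto (fun K => Real.log G / Real.log (gammaOf K)) atTop (𝓝 0) :=
    (Real.tendsto_log_atTop.comp tendsto_gammaOf_atTop).const_div_atTop _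
  simpa using ENNReal.tendsto_ofReal (hlog.const_sub 1)

variable [MeasurableSpace Ω] {P : Measure Ω} [IsProbabilityMeasure P] {γ G s K L : ℝ}

namespace IsWebNoise

theorem measure_not_le_dimH_exceptionalTimes_le (h : IsWebNoise P W ε) (hγ : 4 ≤ γ) (hG₁ : 1 < G)
    (hGγ : G < γ) (hG : ∀ k, (boxProb γ k)⁻¹ ≤ G) (hs : 0 < s) (hGs : Real.logb γ G + s < 1)
    (hL : 0 < L) :
    P {ω | ¬ENNReal.ofReal s ≤ dimH (exceptionalTimes W ε (kOf γ) ω)} ≤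
      ENNReal.ofReal (4 * massVarBound γ G L) := by
  have hγ₀ : 0 ≤ γ := by linarith
  have hmass (n : ℕ) : P {ω | boxMeasure W ε γ L n ω Set.univ < ENNReal.ofReal (L / 2)} ≤
      ENNReal.ofReal (4 * massVarBound γ G L) :=
    measure_lt_half_le (h.measurable_boxMeasure_univ γ L n).aemeasurable hL
      (massVarBound_nonneg hG₁ hGγ hL) (h.lintegral_boxMeasure_univ hγ₀ L n)
      (h.lintegral_boxMeasure_univ_sq_le hG₁ hGγ hG hL n)
  have hbad := measure_eventually_not_le_and_le_le hmass
    (fun n => (h.measurable_energy_boxMeasure s γ L n).aemeasurable)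
    (h.lintegral_energy_boxMeasure_le (hG₁.trans hGγ) hG₁.le hG hGs hL.le) ENNReal.ofReal_ne_top
  refine (measure_mono_ae ?_).trans hbad
  filter_upwards [h.ae_goodClocks] with ω hω hdim M hM
  by_contra hev
  have hfreq : ∃ᶠ n in atTop, ENNReal.ofReal (L / 2) ≤
      boxMeasure W ε γ L n ω (boxTimes W ε γ L n ω) ∧ energy s (boxMeasure W ε γ L n ω) ≤ M := by
    simpa only [boxMeasure_self, not_not] using not_eventually.1 hev
  have hdim' := ofReal_le_dimH_iInter_of_energy_le hs (boxTimes_anti γ L ω)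
    (fun n => isCompact_Icc.closure_of_subset (boxTimes_subset_Icc γ L n ω))
    (hω.countable_closure_sdiff_boxTimes γ L) (ENNReal.ofReal_pos.2 (half_pos hL)).ne' hM hfreq
  exact hdim (hdim'.trans (dimH_mono (iInter_boxTimes_subset hγ L ω)))

theorem ae_ofReal_le_dimH_exceptionalTimes (h : IsWebNoise P W ε) (hγ : 4 ≤ γ) (hG₁ : 1 < G)
    (hGγ : G < γ) (hG : ∀ k, (boxProb γ k)⁻¹ ≤ G) (hs : 0 < s) (hGs : Real.logb γ G + s < 1) :
    ∀ᵐ ω ∂P, ENNReal.ofReal s ≤ dimH (exceptionalTimes W ε (kOf γ) ω) := by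
  have hlim : Tendsto (fun L => ENNReal.ofReal (4 * massVarBound γ G L)) atTop (𝓝 0) := by
    simpa using ENNReal.tendsto_ofReal ((tendsto_massVarBound_atTop hG₁ hGγ).const_mul 4)
  exact ae_iff.2 <| nonpos_iff_eq_zero.1 <| ge_of_tendsto hlim <|
    (eventually_gt_atTop 0).mono fun L hL =>
      h.measure_not_le_dimH_exceptionalTimes_le hγ hG₁ hGγ hG hs hGs hL

theorem ae_one_sub_logb_le_dimH_exceptionalTimes (h : IsWebNoise P W ε) (hγ : 4 ≤ γ) (hG₁ : 1 < G)
    (hGγ : G < γ) (hG : ∀ k, (boxProb γ k)⁻¹ ≤ G) :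
    ∀ᵐ ω ∂P, ENNReal.ofReal (1 - Real.logb γ G) ≤ dimH (exceptionalTimes W ε (kOf γ) ω) := by
  obtain ⟨s, -, hs, hlim⟩ := exists_seq_strictMono_tendsto' (sub_pos.2 (logb_lt_one hG₁ hGγ))
  have hae : ∀ᵐ ω ∂P, ∀ n, ENNReal.ofReal (s n) ≤ dimH (exceptionalTimes W ε (kOf γ) ω) :=
    ae_all_iff.2 fun n => h.ae_ofReal_le_dimH_exceptionalTimes hγ hG₁ hGγ hG (hs n).1
      (by linarith [(hs n).2])
  exact hae.mono fun ω hω => le_of_tendsto' (ENNReal.tendsto_ofReal hlim) hω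

theorem sixteen_le_toReal_gammaZero (h : IsWebNoise P W ε) : 16 ≤ (gammaZero P W ε).toReal :=
  (ENNReal.ofReal_le_iff_le_toReal h.gammaZero_lt_top.ne).1
    (by simpa using h.sixteen_le_gammaZero)

theorem ae_le_dimH_exceptionalTimes (h : IsWebNoise P W ε)
    (hK : kOf (gammaZero P W ε).toReal < K) :
    ∀ᵐ ω ∂P,
      ENNReal.ofReal (1 - Real.log (gammaZero P W ε).toReal / Real.log (gammaOf K)) ≤
        dimH (exceptionalTimes W ε K ω) := by
  have hG := h.sixteen_le_toReal_gammaZero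
  have hK₀ : 0 < K := (kOf_nonneg (by linarith)).trans_lt hK
  have hGγ : (gammaZero P W ε).toReal < gammaOf K := lt_gammaOf (by linarith) hK₀ hK
  have hdim := h.ae_one_sub_logb_le_dimH_exceptionalTimes (by linarith) (by linarith) hGγ fun k =>
    (ENNReal.ofReal_le_iff_le_toReal h.gammaZero_lt_top.ne).1 (h.inv_boxProb_le_gammaZero hK₀ k)
  rwa [(gammaOf_spec hK₀).2] at hdim

-- The exceptional null sets depend on `K`; by monotonicity in `K` only the integers matter.
theorem ae_tendsto_dimH_exceptionalTimes (h : IsWebNoise P W ε) :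
    ∀ᵐ ω ∂P, Tendsto (fun K : ℝ => dimH (exceptionalTimes W ε K ω)) atTop (𝓝 1) := by
  set G := (gammaZero P W ε).toReal
  have hae : ∀ᵐ ω ∂P, ∀ n : ℕ, kOf G < n → ENNReal.ofReal
      (1 - Real.log G / Real.log (gammaOf n)) ≤ dimH (exceptionalTimes W ε n ω) :=
    ae_all_iff.2 fun n => eventually_imp_distrib_left.2 h.ae_le_dimH_exceptionalTimes
  filter_upwards [hae] with ω hω
  have hfloor : Tendsto (fun K : ℝ => (⌊K⌋₊ : ℝ)) atTop atTop :=
    tendsto_natCast_atTop_atTop.comp tendsto_nat_floor_atTop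
  refine tendsto_of_tendsto_of_tendsto_of_le_of_le'
    ((tendsto_one_sub_log_div_log_gammaOf G).comp hfloor) tendsto_const_nhds ?_ ?_
  · filter_upwards [hfloor.eventually_gt_atTop (kOf G), eventually_ge_atTop 0] with K hK hK₀
    exact (hω _ hK).trans (dimH_mono (exceptionalTimes_mono ω (Nat.floor_le hK₀)))
  · exact .of_forall fun K => (dimH_mono (Set.subset_univ _)).trans Real.dimH_univ.le

end IsWebNoise

end

end

end DynWeb

theorem proposition4 {Ω : Type*} [MeasurableSpace Ω] (P : Measure Ω) [IsProbabilityMeasure P]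
    (W : DynWeb.Site → ℕ → Ω → ℝ) (ε : DynWeb.Site → ℕ → Ω → Bool)
    (h : DynWeb.IsWebNoise P W ε) :
    (2 < DynWeb.gammaZero P W ε ∧ DynWeb.gammaZero P W ε < ⊤) ∧
    (∀ K : ℝ, DynWeb.kOf (DynWeb.gammaZero P W ε).toReal < K →
      ∀ᵐ ω ∂P,
        ENNReal.ofReal
            (1 - Real.log (DynWeb.gammaZero P W ε).toReal / Real.log (DynWeb.gammaOf K)) ≤
          dimH (DynWeb.exceptionalTimes W ε K ω)) ∧
    (∀ᵐ ω ∂P,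
      Filter.Tendsto (fun K : ℝ => dimH (DynWeb.exceptionalTimes W ε K ω)) Filter.atTop (𝓝 1)) := by
  refine ⟨⟨?_, h.gammaZero_lt_top⟩, fun K hK => ?_, h.ae_tendsto_dimH_exceptionalTimes⟩
  · exact lt_of_lt_of_le (by norm_num) h.sixteen_le_gammaZero
  · exact h.ae_le_dimH_exceptionalTimes hK
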